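/- **Setting.** Let $K\ge 1$, $s\ge 1$, $n_T\le n_S$, $N=Kn_S+n_T$. For tasks $k=0$ (target, sample size $n_0=n_T$) and $k=1,\dots,K$ (sources, sample size $n_k=n_S$) we observe $y^{(k)}_i=\langle X^{(k)}_i,\beta^{(k)}\rangle+\epsilon^{(k)}_i$, $1\le i\le n_k$, with $\beta^{(k)}\in\mathbb R^p$, $\|\beta^{(0)}\|_0\le s$ and $\|\beta^{(k)}-\beta^{(0)}\|_1\le h_k$ for $1\le k\le K$. Put $\bar h=\frac{n_S}{N}\sum_{k=1}^K h_k$. Assume: (i) for each $k$ the rows $X^{(k)}_i$ are independent, sub-Gaussian with a common constant $\kappa$ (that is, $\mathbb E\,e^{t\langle u,X^{(k)}_i\rangle}\le e^{\kappa\|u\|_2^2t^2/2}$ for all $u\in\mathbb R^p$, $t\in\mathbb R$), centred, with covariance matrix $\Sigma^{(k)}$ whose eigenvalues lie in $[1/c,c]$; (ii) the errors $\epsilon^{(k)}_i$ are independent centred Gaussian variables with variances at most $\sigma^2$, independent of the designs. For tuning parameters $\lambda_0,a_k,\tilde\lambda$ let $$\hat\beta\in\arg\min_{(b^{(0)},\dots,b^{(K)})}\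 \frac1{2N}\sum_{k=0}^K\sum_{i=1}^{n_k}\big(y^{(k)}_i-\langle X^{(k)}_i,b^{(k)}\rangle\big)^2+\lambda_0\Big(\|b^{(0)}\|_1+\sum_{k=1}^K a_k\|b^{(k)}-b^{(0)}\|_1\Big),$$ $$\hat w=\frac{n_S}{N}\sum_{k=1}^K\hat\beta^{(k)}+\frac{n_T}{N}\hat\beta^{(0)},\qquad \hat\delta\in\arg\min_{\delta\in\mathbb R^p}\ \frac1{2n_T}\sum_{i=1}^{n_T}\big(y^{(0)}_i-\langle X^{(0)}_i,\hat w\rangle-\langle X^{(0)}_i,\delta\rangle\big)^2+\tilde\lambda\|\delta\|_1,$$ and let $\hat\beta_{\mathrm{TF}}=\hat w+\hat\delta$ be the two-step TransFusion estimator. **Theorem.** For all constants $c,C_T,C_S>0$ and $\sigma,\kappa\ge 0$ there are constants $c_0,c_1,c_2,c_3,C,\eta>0$, depending only on $c,\sigma,\kappa,C_T,C_S$, such that the following holds for every instance of the above setting with $$ s\log p\le C_T\,n_T,\qquad K^2s\log p\le C_S\,n_S,\qquad \bar h\sqrt{\frac{\log p}{n_T}}+\frac{Ks\log p}{n_S}\le\eta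 .$$ Let $A$ be the (deterministic) event $\{s\log p/n_S\ge\bar h\sqrt{\log p/n_T}\}$, and choose $$\lambda_0=c_0\Big(\sqrt{\tfrac{\log p}{N}}\,\mathbb 1_A+\sqrt{\tfrac{\log p}{n_S}}\,\mathbb 1_{A^c}\Big),\quad a_k=8\Big(\sqrt{\tfrac{n_S}{N}}\,\mathbb 1_A+\tfrac{n_S}{N}\,\mathbb 1_{A^c}\Big),\quad \tilde\lambda=c_1\sqrt{\tfrac{\log p}{n_T}} .$$ Then, with probability at least $1-c_2\exp(-c_3\log p)$, every choice of the minimizers satisfies $$\|\hat\beta_{\mathrm{TF}}-\beta^{(0)}\|_2^2\le C\Big(\frac{s\log p}{N}+\bar h\sqrt{\frac{\log p}{n_T}}\Big).$$ -/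

import Mathlib

open MeasureTheory ProbabilityTheory
open scoped NNReal

noncomputable section

namespace TransFusion

/-- Sample sizes of the `K + 1` tasks: task `0` is the target, tasks `1, …, K` are the sources. -/
def sampleSize (nT nS : ℕ) {K : ℕ} : Fin (K + 1) → ℕ :=
  Fin.cons nT (fun _ => nS)

/-- The total sample size `N = K n_S + n_T`. -/
def totalSize (K nT nS : ℕ) : ℝ := (K : ℝ) * nS + nT

/-- The `ℓ₁` norm of a vector. -/
def l1norm {p : ℕ} (x : EuclideanSpace ℝ (Fin p)) : ℝ := ∑ j, |x j|

/-- The number of nonzero entries of a vector. -/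
def l0norm {p : ℕ} (x : EuclideanSpace ℝ (Fin p)) : ℕ := Set.ncard {j | x j ≠ 0}

/-- The parameter space: the target parameter is `s`-sparse, and the `k`-th contrast
has `ℓ₁` norm at most `h k`. -/
def parameterSpace {p K : ℕ} (s : ℕ) (h : Fin K → ℝ) :
    Set (Fin (K + 1) → EuclideanSpace ℝ (Fin p)) :=
  {β | l0norm (β 0) ≤ s ∧ ∀ k : Fin K, l1norm (β k.succ - β 0) ≤ h k}

/-- The average magnitude of the model shifts, `h̄ = (n_S / N) ∑ₖ hₖ`. -/
def hbar {K : ℕ} (nT nS : ℕ) (h : Fin K → ℝ) : ℝ :=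
  (nS : ℝ) / totalSize K nT nS * ∑ k, h k

/-- Sub-Gaussian designs. Within each task the rows are independent, centred, with covariance
matrix `Cov k`, all of whose eigenvalues lie in `[1 / c, c]`, and every one-dimensional marginal
`⟪u, X k i⟫` is sub-Gaussian with variance proxy `κ ‖u‖²`. The rows of a task need not be
identically distributed, and nothing is assumed on the dependence between designs of different
tasks. -/
structure SubGaussianDesign {Ω : Type*} [MeasurableSpace Ω] (μ : Measure Ω) {p K nT nS : ℕ}
    (c : ℝ) (κ : ℝ≥0)
    (X : (k : Fin (K + 1)) → Fin (sampleSize nT nS k) → Ω → EuclideanSpace ℝ (Fin p))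
    (Cov : Fin (K + 1) → Matrix (Fin p) (Fin p) ℝ) : Prop where
  measurable : ∀ k i, Measurable (X k i)
  indep : ∀ k, iIndepFun (X k) μ
  mean_zero : ∀ k i j, ∫ ω, X k i ω j ∂μ = 0
  covariance_eq : ∀ k i j l, cov[fun ω => X k i ω j, fun ω => X k i ω l; μ] = Cov k j l
  spectrum_subset : ∀ k, spectrum ℝ (Cov k) ⊆ Set.Icc (1 / c) c
  subGaussian : ∀ k i (u : EuclideanSpace ℝ (Fin p)),
    HasSubgaussianMGF (fun ω => inner ℝ u (X k i ω)) (κ * ‖u‖₊ ^ 2) μ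

/-- Gaussian errors: all errors are independent (over samples and tasks), centred Gaussian with
variances at most `σ²`, and they are independent of the designs. -/
structure GaussianErrors {Ω : Type*} [MeasurableSpace Ω] (μ : Measure Ω) {p K nT nS : ℕ}
    (σ : ℝ)
    (X : (k : Fin (K + 1)) → Fin (sampleSize nT nS k) → Ω → EuclideanSpace ℝ (Fin p))
    (ε : (k : Fin (K + 1)) → Fin (sampleSize nT nS k) → Ω → ℝ) : Prop where
  measurable : ∀ k i, Measurable (ε k i)
  gaussian : ∀ k i, ∃ v : ℝ≥0, (v : ℝ) ≤ σ ^ 2 ∧ μ.map (ε k i) = gaussianReal 0 v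
  indep : iIndepFun
    (fun (ki : (k : Fin (K + 1)) × Fin (sampleSize nT nS k)) => ε ki.1 ki.2) μ
  indep_design : IndepFun (fun ω k i => ε k i ω) (fun ω k i => X k i ω) μ

/-- The responses of the linear models, `y k i = ⟪X k i, β k⟫ + ε k i`. -/
def response {p K nT nS : ℕ} (β : Fin (K + 1) → EuclideanSpace ℝ (Fin p))
    (x : (k : Fin (K + 1)) → Fin (sampleSize nT nS k) → EuclideanSpace ℝ (Fin p))
    (e : (k : Fin (K + 1)) → Fin (sampleSize nT nS k) → ℝ) :
    (k : Fin (K + 1)) → Fin (sampleSize nT nS k) → ℝ :=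
  fun k i => inner ℝ (x k i) (β k) + e k i

/-- The objective function of the co-training step. -/
def coTrainingObjective {p K nT nS : ℕ}
    (x : (k : Fin (K + 1)) → Fin (sampleSize nT nS k) → EuclideanSpace ℝ (Fin p))
    (y : (k : Fin (K + 1)) → Fin (sampleSize nT nS k) → ℝ)
    (lam0 : ℝ) (a : Fin K → ℝ) (b : Fin (K + 1) → EuclideanSpace ℝ (Fin p)) : ℝ :=
  1 / (2 * totalSize K nT nS) * ∑ k, ∑ i, (y k i - inner ℝ (x k i) (b k)) ^ 2
    + lam0 * (l1norm (b 0) + ∑ k : Fin K, a k * l1norm (b k.succ - b 0))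

/-- The sample-size weighted average `(n_S / N) ∑ₖ b k + (n_T / N) b 0`. -/
def weightedAverage {p K : ℕ} (nT nS : ℕ) (b : Fin (K + 1) → EuclideanSpace ℝ (Fin p)) :
    EuclideanSpace ℝ (Fin p) :=
  ((nS : ℝ) / totalSize K nT nS) • ∑ k : Fin K, b k.succ
    + ((nT : ℝ) / totalSize K nT nS) • b 0

/-- The objective function of the local debias step on the target sample, started at `w`. -/
def debiasObjective {p K nT nS : ℕ}
    (x : (k : Fin (K + 1)) → Fin (sampleSize nT nS k) → EuclideanSpace ℝ (Fin p))
    (y : (k : Fin (K + 1)) → Fin (sampleSize nT nS k) → ℝ)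
    (lamT : ℝ) (w δ : EuclideanSpace ℝ (Fin p)) : ℝ :=
  1 / (2 * (nT : ℝ)) * ∑ i, (y 0 i - inner ℝ (x 0 i) w - inner ℝ (x 0 i) δ) ^ 2
    + lamT * l1norm δ

/-- `βhat` is an output of the two-step method: `βhat = ŵ + δ̂`, where `ŵ` is the weighted
average of a minimizer of the co-training objective, and `δ̂` is a minimizer of the debias
objective started at `ŵ`. -/
def IsTwoStepEstimate {p K nT nS : ℕ}
    (x : (k : Fin (K + 1)) → Fin (sampleSize nT nS k) → EuclideanSpace ℝ (Fin p))
    (y : (k : Fin (K + 1)) → Fin (sampleSize nT nS k) → ℝ)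
    (lam0 : ℝ) (a : Fin K → ℝ) (lamT : ℝ) (βhat : EuclideanSpace ℝ (Fin p)) : Prop :=
  ∃ (b : Fin (K + 1) → EuclideanSpace ℝ (Fin p)) (δ : EuclideanSpace ℝ (Fin p)),
    IsMinOn (coTrainingObjective x y lam0 a) Set.univ b ∧
    IsMinOn (debiasObjective x y lamT (weightedAverage nT nS b)) Set.univ δ ∧
    βhat = weightedAverage nT nS b + δ

/-- The event `A = {s log p / n_S ≥ h̄ √(log p / n_T)}` (it involves no randomness). -/
def EventA {K : ℕ} (p s nT nS : ℕ) (h : Fin K → ℝ) : Prop :=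
  (s : ℝ) * Real.log p / nS ≥ hbar nT nS h * √(Real.log p / nT)

open Classical in
/-- The tuning parameter `λ₀ = c₀ (√(log p / N) 1_A + √(log p / n_S) 1_{Aᶜ})`. -/
def lambdaZero {K : ℕ} (c₀ : ℝ) (p s nT nS : ℕ) (h : Fin K → ℝ) : ℝ :=
  c₀ * (if EventA p s nT nS h then √(Real.log p / totalSize K nT nS)
    else √(Real.log p / nS))

open Classical in
/-- The weights `aₖ = 8 (√(n_S / N) 1_A + (n_S / N) 1_{Aᶜ})`, the same for all `k`. -/
def weight {K : ℕ} (p s nT nS : ℕ) (h : Fin K → ℝ) : Fin K → ℝ :=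
  fun _ => 8 * (if EventA p s nT nS h then √((nS : ℝ) / totalSize K nT nS)
    else (nS : ℝ) / totalSize K nT nS)

/-- The tuning parameter `λ̃ = c₁ √(log p / n_T)` of the debias step. -/
def lambdaTilde (c₁ : ℝ) (p nT : ℕ) : ℝ := c₁ * √(Real.log p / nT)

end TransFusion

end

namespace TransFusion

/-! ### Elementary `ℓ₁` and `ℓ₂` inequalities. -/

section Norms

variable {p : ℕ}

/-! Deterministic part. Let `Δ₀` be the target error and `D k` the contrast errors of the
co-training minimizer. Noise meets `Δ₀` only through the pooled score, of order √(N log p), and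
meets `D k` only through the score of source `k`, of order √(n_S log p). The tuning makes the
penalties dominate both, which gives a cone inequality (`coTraining_basic_inequality`). Restricted
eigenvalue bounds in the sources, averaged over tasks, close it (`sum_abs_target_error_le`,
`cone_bounds`). In ŵ the errors recombine into the sample-size weighted mean of the task errors `Δ₀`
and `Δ₀ + D k`, so by Cauchy–Schwarz its norm costs only the root of the pooled prediction error
(`weighted_error_bounds`). What remains in ŵ is the average true contrast, of `ℓ₁` norm at most h̄;
the debias lasso removes it at the price h̄ √(log p / n_T).

The difficulty is uniformity in K, which no power of p bounds: a union bound over all source scores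
would not leave failure probability p^(-c). If K ≤ p, the union bound works. If K > p, the smallness
of K s log p / n_S forces n_S above a large multiple of p log p, so every source design is well
conditioned on the whole space. Then the comparison point is moved: for the sources in an
exceptional set `B`, those with a large score, a lasso fit `d k` of the noise is added to the true
contrast. The optimality condition of the fit plays the part of the missing score bound. Markov's
inequality gives p |B| ≤ K / 10. The fits are odd functions of independent symmetric noise vectors,
hence centred and pairwise independent, and Chebyshev's inequality makes their sum and the sum of
their Gram images negligible (`exists_noiseFits`).

Random designs. Tail bounds for a fixed vector and a union bound over sums of m signed basis
vectors, m of order n / log p, give two-sided control of the prediction norm there; Maurey's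
averaging extends it to all vectors at the cost of a multiple of (log p / n) ‖v‖₁². The errors being
independent of the designs, the noise events are bounded for each fixed regular design and
integrated by Fubini (`measureReal_le_of_indepFun`), so that independence between designs of
different tasks is not needed. -/

theorem l1norm_nonneg (v : EuclideanSpace ℝ (Fin p)) : 0 ≤ l1norm v :=
  Finset.sum_nonneg fun _ _ => abs_nonneg _

@[simp] theorem l1norm_zero : l1norm (0 : EuclideanSpace ℝ (Fin p)) = 0 := by simp [l1norm]

theorem l1norm_add_le (v w : EuclideanSpace ℝ (Fin p)) :
    l1norm (v + w) ≤ l1norm v + l1norm w := by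
  unfold l1norm
  rw [← Finset.sum_add_distrib]
  exact Finset.sum_le_sum fun j _ => by simpa using abs_add_le (v j) (w j)

@[simp] theorem l1norm_neg (v : EuclideanSpace ℝ (Fin p)) : l1norm (-v) = l1norm v := by
  simp [l1norm]

theorem l1norm_sub_le (v w : EuclideanSpace ℝ (Fin p)) :
    l1norm (v - w) ≤ l1norm v + l1norm w := by
  simpa [sub_eq_add_neg] using l1norm_add_le v (-w)

theorem l1norm_smul (t : ℝ) (v : EuclideanSpace ℝ (Fin p)) :
    l1norm (t • v) = |t| * l1norm v := by
  simp [l1norm, abs_mul, Finset.mul_sum]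

theorem l1norm_sum_le {ι : Type*} (s : Finset ι) (f : ι → EuclideanSpace ℝ (Fin p)) :
    l1norm (∑ i ∈ s, f i) ≤ ∑ i ∈ s, l1norm (f i) := by
  classical
  induction s using Finset.induction_on with
  | empty => simp
  | insert a s ha ih =>
    rw [Finset.sum_insert ha, Finset.sum_insert ha]
    exact (l1norm_add_le _ _).trans (by gcongr)

theorem continuous_l1norm : Continuous (l1norm : EuclideanSpace ℝ (Fin p) → ℝ) := by
  unfold l1norm; fun_prop

theorem norm_le_l1norm (v : EuclideanSpace ℝ (Fin p)) : ‖v‖ ≤ l1norm v := by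
  rw [EuclideanSpace.norm_eq]
  refine Real.sqrt_le_iff.2 ⟨l1norm_nonneg v, ?_⟩
  simpa [l1norm] using Finset.sum_sq_le_sq_sum_of_nonneg (s := Finset.univ)
    (f := fun j => |v j|) (fun j _ => abs_nonneg _)

theorem sum_abs_le_sqrt_mul_norm (S : Finset (Fin p)) {s : ℕ} (hS : S.card ≤ s)
    (v : EuclideanSpace ℝ (Fin p)) : ∑ j ∈ S, |v j| ≤ √s * ‖v‖ := by
  rw [EuclideanSpace.norm_eq, ← Real.sqrt_mul (by positivity)]
  refine Real.le_sqrt_of_sq_le ?_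
  calc (∑ j ∈ S, |v j|) ^ 2 ≤ S.card * ∑ j ∈ S, |v j| ^ 2 := sq_sum_le_card_mul_sum_sq
    _ ≤ s * ∑ j, ‖v j‖ ^ 2 := by
      gcongr
      exact Finset.sum_le_sum_of_subset_of_nonneg (Finset.subset_univ S)
        fun _ _ _ => by positivity

theorem l1norm_le_sqrt_mul_norm (v : EuclideanSpace ℝ (Fin p)) : l1norm v ≤ √p * ‖v‖ :=
  sum_abs_le_sqrt_mul_norm Finset.univ (by simp) v

theorem abs_inner_le_mul_l1norm {t : ℝ} {w : EuclideanSpace ℝ (Fin p)} (hw : ∀ j, |w j| ≤ t)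
    (v : EuclideanSpace ℝ (Fin p)) : |inner ℝ w v| ≤ t * l1norm v := by
  rw [PiLp.inner_apply, l1norm, Finset.mul_sum]
  refine (Finset.abs_sum_le_sum_abs _ _).trans (Finset.sum_le_sum fun j _ => ?_)
  simp only [RCLike.inner_apply, conj_trivial, abs_mul]
  rw [mul_comm]
  exact mul_le_mul_of_nonneg_right (hw j) (abs_nonneg _)

/-- The `ℓ₁` norm of a perturbation of a vector supported on `S`. -/
theorem l1norm_sub_l1norm_add_le (S : Finset (Fin p)) {b : EuclideanSpace ℝ (Fin p)}
    (hb : ∀ j ∉ S, b j = 0) (v : EuclideanSpace ℝ (Fin p)) :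
    l1norm b - l1norm (b + v) ≤ ∑ j ∈ S, |v j| - ∑ j ∈ Sᶜ, |v j| := by
  unfold l1norm
  rw [← Finset.sum_add_sum_compl S, ← Finset.sum_add_sum_compl S (fun j => |(b + v) j|)]
  have h1 : ∑ j ∈ S, |b j| ≤ ∑ j ∈ S, |(b + v) j| + ∑ j ∈ S, |v j| := by
    rw [← Finset.sum_add_distrib]
    refine Finset.sum_le_sum fun j _ => ?_
    have := abs_sub (b j + v j) (v j)
    simpa using this
  have h2 : ∑ j ∈ Sᶜ, |b j| = 0 := Finset.sum_eq_zero fun j hj => by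
    rw [hb j (Finset.mem_compl.1 hj), abs_zero]
  have h3 : ∑ j ∈ Sᶜ, |(b + v) j| = ∑ j ∈ Sᶜ, |v j| := Finset.sum_congr rfl fun j hj => by
    simp [hb j (Finset.mem_compl.1 hj)]
  linarith

end Norms

/-! ### Prediction norms and scores of a fixed design. -/

section Design

variable {p n : ℕ}

/-- The squared prediction norm `‖x v‖²` of a design with rows `x i`. -/
noncomputable def predSq (x : Fin n → EuclideanSpace ℝ (Fin p)) (v : EuclideanSpace ℝ (Fin p)) : ℝ :=
  ∑ i, inner ℝ (x i) v ^ 2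

/-- The correlation `xᵀ e` of a design with a vector of responses. -/
noncomputable def score (x : Fin n → EuclideanSpace ℝ (Fin p)) (e : Fin n → ℝ) : EuclideanSpace ℝ (Fin p) :=
  ∑ i, e i • x i

theorem predSq_nonneg (x : Fin n → EuclideanSpace ℝ (Fin p)) (v : EuclideanSpace ℝ (Fin p)) :
    0 ≤ predSq x v := Finset.sum_nonneg fun _ _ => sq_nonneg _

theorem predSq_smul (x : Fin n → EuclideanSpace ℝ (Fin p)) (t : ℝ)
    (v : EuclideanSpace ℝ (Fin p)) : predSq x (t • v) = t ^ 2 * predSq x v := by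
  simp [predSq, inner_smul_right, mul_pow, Finset.mul_sum]

theorem inner_score (x : Fin n → EuclideanSpace ℝ (Fin p)) (e : Fin n → ℝ)
    (v : EuclideanSpace ℝ (Fin p)) : inner ℝ (score x e) v = ∑ i, e i * inner ℝ (x i) v := by
  simp [score, sum_inner, inner_smul_left]

theorem score_apply (x : Fin n → EuclideanSpace ℝ (Fin p)) (e : Fin n → ℝ) (j : Fin p) :
    score x e j = ∑ i, e i * x i j := by
  simp [score]

theorem score_neg (x : Fin n → EuclideanSpace ℝ (Fin p)) (e : Fin n → ℝ) :
    score x (-e) = -score x e := by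
  simp [score]

theorem sum_residual_sq (x : Fin n → EuclideanSpace ℝ (Fin p)) (e : Fin n → ℝ)
    (v : EuclideanSpace ℝ (Fin p)) :
    ∑ i, (e i - inner ℝ (x i) v) ^ 2 = ∑ i, e i ^ 2 - 2 * inner ℝ (score x e) v + predSq x v := by
  rw [inner_score, predSq, Finset.mul_sum, ← Finset.sum_sub_distrib, ← Finset.sum_add_distrib]
  exact Finset.sum_congr rfl fun i _ => by ring

end Design

/-! ### The basic inequality of the co-training step. -/

section Deterministic

variable {p K nT nS : ℕ}

/-- Expand the squares around the comparison point with target `β₀` and contrasts `δ k + d k`, where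
the source residuals are `r k`. The pairing of the noise with `Δ₀` is absorbed by half of the target
penalty, and its pairing with `D k`, for `k ∉ B`, by half of the contrast penalty. For `k ∈ B` the
optimality of `d k` consumes the whole penalty, so no `ℓ₁` control of `D k` survives there. -/
theorem coTraining_basic_inequality {N lam a : ℝ} (hN : 0 < N) (hlam : 0 ≤ lam) (ha : 0 ≤ a)
    (x₀ : Fin nT → EuclideanSpace ℝ (Fin p)) (x : Fin K → Fin nS → EuclideanSpace ℝ (Fin p))
    (e₀ : Fin nT → ℝ) (r : Fin K → Fin nS → ℝ)
    (β₀ Δ₀ : EuclideanSpace ℝ (Fin p)) (δ d D : Fin K → EuclideanSpace ℝ (Fin p))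
    (S : Finset (Fin p)) (B : Finset (Fin K))
    (hmin : 1 / (2 * N) * (∑ i, (e₀ i - inner ℝ (x₀ i) Δ₀) ^ 2
        + ∑ k, ∑ i, (r k i - inner ℝ (x k i) (Δ₀ + D k)) ^ 2)
        + lam * (l1norm (β₀ + Δ₀) + ∑ k, a * l1norm (δ k + d k + D k))
      ≤ 1 / (2 * N) * (∑ i, e₀ i ^ 2 + ∑ k, ∑ i, r k i ^ 2)
        + lam * (l1norm β₀ + ∑ k, a * l1norm (δ k + d k)))
    (hS : ∀ j ∉ S, β₀ j = 0)
    (htot : ∀ j, |(score x₀ e₀ + ∑ k, score (x k) (r k)) j| ≤ N * lam / 2)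
    (hgood : ∀ k ∉ B, d k = 0 ∧ ∀ j, |score (x k) (r k) j| ≤ N * (lam * a) / 2)
    (hbad : ∀ k ∈ B, ∀ v, inner ℝ (score (x k) (r k)) v
      ≤ N * (lam * a) * (l1norm (d k + v) - l1norm (d k))) :
    (1 / 2 * (predSq x₀ Δ₀ + ∑ k, predSq (x k) (Δ₀ + D k))) / N
        + lam / 2 * ∑ j ∈ Sᶜ, |Δ₀ j| + lam * a / 2 * ∑ k ∈ Bᶜ, l1norm (D k)
      ≤ 3 / 2 * lam * ∑ j ∈ S, |Δ₀ j| + 2 * (lam * a) * ∑ k, l1norm (δ k) := by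
  have hsplit : l1norm Δ₀ = ∑ j ∈ S, |Δ₀ j| + ∑ j ∈ Sᶜ, |Δ₀ j| :=
    (Finset.sum_add_sum_compl S _).symm
  have hcone := mul_le_mul_of_nonneg_left (l1norm_sub_l1norm_add_le S hS Δ₀) hlam
  have htot' : inner ℝ (score x₀ e₀ + ∑ k, score (x k) (r k)) Δ₀ ≤ N * lam / 2 * l1norm Δ₀ :=
    (le_abs_self _).trans (abs_inner_le_mul_l1norm htot Δ₀)
  have hla : 0 ≤ lam * a := mul_nonneg hlam ha
  -- per-task comparison of the noise with the penalty
  have htask : ∀ k, inner ℝ (score (x k) (r k)) (D k)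
      + N * (lam * a) * (l1norm (δ k + d k) - l1norm (δ k + d k + D k))
      ≤ N * (2 * (lam * a) * l1norm (δ k))
        - (if k ∈ B then 0 else N * (lam * a / 2 * l1norm (D k))) := by
    intro k
    by_cases hk : k ∈ B
    · have h1 := hbad k hk (D k)
      have h2 := l1norm_add_le (δ k) (d k)
      have h3 : l1norm (d k + D k) ≤ l1norm (δ k + d k + D k) + l1norm (δ k) := by
        have := l1norm_sub_le (δ k + d k + D k) (δ k)
        rwa [show δ k + d k + D k - δ k = d k + D k by abel] at this
      rw [if_pos hk]
      -- Removing `δ k` changes each of the two norms by at most `‖δ k‖₁`, whence the factor 2.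
      have h4 : N * (lam * a) * (l1norm (δ k + d k) - l1norm (δ k + d k + D k)
          + (l1norm (d k + D k) - l1norm (d k))) ≤ N * (lam * a) * (2 * l1norm (δ k)) := by
        gcongr
        linarith
      linarith
    · obtain ⟨h0, h1⟩ := hgood k hk
      have h2 := (le_abs_self _).trans (abs_inner_le_mul_l1norm h1 (D k))
      have h3 : l1norm (D k) ≤ l1norm (δ k + d k + D k) + l1norm (δ k) := by
        have := l1norm_sub_le (δ k + d k + D k) (δ k)
        rwa [show δ k + d k + D k - δ k = D k by rw [h0]; abel] at this
      rw [if_neg hk]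
      have h4 : N * (lam * a) * (l1norm (δ k + d k) - l1norm (δ k + d k + D k))
          ≤ N * (lam * a) * (2 * l1norm (δ k) - l1norm (D k)) := by
        refine mul_le_mul_of_nonneg_left ?_ (by positivity)
        rw [h0, add_zero] at h3 ⊢
        linarith
      linarith
  have hsum := Finset.sum_le_sum fun k (_ : k ∈ Finset.univ) => htask k
  rw [Finset.sum_add_distrib, Finset.sum_sub_distrib] at hsum
  have hif : ∑ k, (if k ∈ B then 0 else N * (lam * a / 2 * l1norm (D k)))
      = N * (lam * a / 2 * ∑ k ∈ Bᶜ, l1norm (D k)) := by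
    rw [Finset.mul_sum, Finset.mul_sum, ← Finset.sum_add_sum_compl B,
      Finset.sum_eq_zero fun k hk => if_pos hk, zero_add]
    exact Finset.sum_congr rfl fun k hk => if_neg (Finset.mem_compl.1 hk)
  rw [hif, ← Finset.mul_sum, ← Finset.mul_sum, ← Finset.mul_sum, Finset.sum_sub_distrib] at hsum
  have hres : ∑ k, ∑ i, (r k i - inner ℝ (x k i) (Δ₀ + D k)) ^ 2 = ∑ k, ∑ i, r k i ^ 2
      - 2 * (∑ k, inner ℝ (score (x k) (r k)) Δ₀ + ∑ k, inner ℝ (score (x k) (r k)) (D k))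
      + ∑ k, predSq (x k) (Δ₀ + D k) := by
    rw [← Finset.sum_add_distrib, Finset.mul_sum, ← Finset.sum_sub_distrib,
      ← Finset.sum_add_distrib]
    exact Finset.sum_congr rfl fun k _ => by rw [sum_residual_sq, inner_add_right]
  rw [sum_residual_sq, hres, ← Finset.mul_sum, ← Finset.mul_sum] at hmin
  rw [inner_add_left, sum_inner] at htot'
  rw [hsplit] at htot'
  have hmin' := mul_le_mul_of_nonneg_left hmin hN.le
  have e1 : ∀ t, N * (1 / (2 * N) * t) = t / 2 := fun t => by field_simp
  rw [mul_add N, mul_add N, e1, e1] at hmin'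
  have hcone' := mul_le_mul_of_nonneg_left hcone hN.le
  refine le_of_mul_le_mul_left ?_ hN
  rw [mul_add, mul_add, mul_div_cancel₀ _ hN.ne']
  nlinarith [hmin', hcone', hsum, htot']

end Deterministic

/-! ### Compatibility across the sources and solution of the cone inequality. -/

section Deterministic

variable {p K nT nS : ℕ}

theorem sum_sqrt_le {ι : Type*} (s : Finset ι) (f : ι → ℝ) (hf : ∀ i ∈ s, 0 ≤ f i) :
    ∑ i ∈ s, √(f i) ≤ √s.card * √(∑ i ∈ s, f i) := by
  rw [← Real.sqrt_mul (by positivity)]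
  refine Real.le_sqrt_of_sq_le (sq_sum_le_card_mul_sum_sq.trans (le_of_eq ?_))
  congr 1
  exact Finset.sum_congr rfl fun i hi => Real.sq_sqrt (hf i hi)

/-- The target error restricted to a small set of coordinates is controlled by the prediction
errors and the contrast errors of the sources outside `B`. -/
theorem sum_abs_target_error_le {N a C₁ C₂ l : ℝ} {s : ℕ} (hK : 0 < K) (hnS : 0 < nS)
    (hC₁ : 0 ≤ C₁) (hN : 0 < N) (hN2 : N ≤ 2 * K * nS) (ha : 8 * (nS / N) ≤ a)
    (hθ : C₂ * √(s * l / nS) ≤ 1 / 100)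
    (x : Fin K → Fin nS → EuclideanSpace ℝ (Fin p))
    (hx : ∀ k v, √nS * ‖v‖ ≤ C₁ * √(predSq (x k) v) + C₂ * √l * l1norm v)
    (Δ₀ : EuclideanSpace ℝ (Fin p)) (D : Fin K → EuclideanSpace ℝ (Fin p))
    (S : Finset (Fin p)) (hS : S.card ≤ s) (B : Finset (Fin K)) (hB : 10 * B.card ≤ K) {m : ℝ}
    (hm : ∑ k, predSq (x k) (Δ₀ + D k) ≤ 2 * (m * N)) :
    ∑ j ∈ S, |Δ₀ j| ≤ C₁ * √(5 * (s * m)) + 1 / 100 * l1norm Δ₀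
      + 101 / 360 * (a * ∑ k ∈ Bᶜ, l1norm (D k)) := by
  have hnS' : (0 : ℝ) < nS := by exact_mod_cast hnS
  have hK' : (0 : ℝ) < K := by exact_mod_cast hK
  -- Only `Δ₀ + D k` is seen by the design of source `k`, so `D k` is traded for its `ℓ₁` norm; `hθ`
  -- makes the `ℓ₁` remainder of the restricted eigenvalue bound a hundredth. The inequalities are
  -- then averaged over `Bᶜ`.
  have htask : ∀ k ∈ Bᶜ, ∑ j ∈ S, |Δ₀ j| ≤ √s * C₁ / √nS * √(predSq (x k) (Δ₀ + D k))
      + 1 / 100 * l1norm Δ₀ + 101 / 100 * l1norm (D k) := by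
    intro k _
    have h1 : ∑ j ∈ S, |Δ₀ j| ≤ ∑ j ∈ S, |(Δ₀ + D k) j| + l1norm (D k) := by
      refine le_trans ?_ (add_le_add_right (Finset.sum_le_sum_of_subset_of_nonneg
        (Finset.subset_univ S) fun j _ _ => abs_nonneg (D k j)) _)
      rw [← Finset.sum_add_distrib]
      refine Finset.sum_le_sum fun j _ => ?_
      simpa using abs_sub (Δ₀ j + D k j) (D k j)
    have h2 := sum_abs_le_sqrt_mul_norm S hS (Δ₀ + D k)
    have h3 : ‖Δ₀ + D k‖
        ≤ (C₁ * √(predSq (x k) (Δ₀ + D k)) + C₂ * √l * l1norm (Δ₀ + D k)) / √nS := by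
      rw [le_div_iff₀ (by positivity), mul_comm]
      exact hx k _
    have h4 : √s * ‖Δ₀ + D k‖ ≤ √s * C₁ / √nS * √(predSq (x k) (Δ₀ + D k))
        + C₂ * √(s * l / nS) * l1norm (Δ₀ + D k) := by
      refine (mul_le_mul_of_nonneg_left h3 (Real.sqrt_nonneg _)).trans (le_of_eq ?_)
      rw [Real.sqrt_div' _ hnS'.le, Real.sqrt_mul (by positivity)]
      ring
    have h5 : C₂ * √(s * l / nS) * l1norm (Δ₀ + D k)
        ≤ 1 / 100 * (l1norm Δ₀ + l1norm (D k)) := by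
      refine (mul_le_mul_of_nonneg_right hθ (l1norm_nonneg _)).trans ?_
      gcongr
      exact l1norm_add_le _ _
    linarith
  have hsum := Finset.sum_le_sum htask
  rw [Finset.sum_add_distrib, Finset.sum_add_distrib, Finset.sum_const, Finset.sum_const,
    ← Finset.mul_sum, ← Finset.mul_sum, nsmul_eq_mul, nsmul_eq_mul] at hsum
  set Mc : ℝ := (Bᶜ.card : ℝ) with hMc
  have hM : 9 / 10 * (K : ℝ) ≤ Mc := by
    rw [hMc, Finset.card_compl, Fintype.card_fin, Nat.cast_sub (by omega)]
    have : (10 : ℝ) * B.card ≤ K := by exact_mod_cast hB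
    linarith
  have hM0 : 0 < Mc := by linarith
  have hmN : 0 ≤ m * N := by
    have : 0 ≤ ∑ k, predSq (x k) (Δ₀ + D k) := Finset.sum_nonneg fun k _ => predSq_nonneg _ _
    linarith
  have hm0 : 0 ≤ m := nonneg_of_mul_nonneg_left hmN hN
  have hpred : ∑ k ∈ Bᶜ, √(predSq (x k) (Δ₀ + D k)) ≤ √Mc * √(2 * (m * N)) := by
    refine (sum_sqrt_le _ _ fun _ _ => predSq_nonneg _ _).trans ?_
    gcongr
    exact (Finset.sum_le_sum_of_subset_of_nonneg (Finset.subset_univ _)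
      fun _ _ _ => predSq_nonneg _ _).trans hm
  have h6 : √s * C₁ / √nS * ∑ k ∈ Bᶜ, √(predSq (x k) (Δ₀ + D k))
      ≤ Mc * (C₁ * √(5 * (s * m))) := by
    refine (mul_le_mul_of_nonneg_left hpred (by positivity)).trans ?_
    have e1 : √s * C₁ / √nS * (√Mc * √(2 * (m * N)))
        = C₁ * √(s * (Mc * (2 * (m * N))) / nS) := by
      rw [Real.sqrt_div' _ hnS'.le, Real.sqrt_mul (Nat.cast_nonneg s), Real.sqrt_mul hM0.le]
      ring
    have e2 : Mc * (C₁ * √(5 * (s * m))) = C₁ * √(Mc ^ 2 * (5 * (s * m))) := by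
      rw [Real.sqrt_mul (sq_nonneg Mc), Real.sqrt_sq hM0.le]
      ring
    rw [e1, e2]
    refine mul_le_mul_of_nonneg_left (Real.sqrt_le_sqrt ?_) hC₁
    rw [div_le_iff₀ hnS']
    -- `2 N ≤ 4 K n_S`, and at least nine tenths of the sources lie outside `B`.
    have h7 : 2 * N ≤ 5 * Mc * nS := by
      have := mul_le_mul_of_nonneg_right hM hnS'.le
      linarith [mul_pos hK' hnS']
    have h8 : 0 ≤ s * Mc * m := by positivity
    linarith [mul_le_mul_of_nonneg_left h7 h8]
  -- `K a ≥ 4` and `(9/10) (5/18) 4 = 1`; with the factor 101/100 of `htask` this produces 101/360.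
  have h9 : ∑ k ∈ Bᶜ, l1norm (D k) ≤ Mc * (5 / 18 * (a * ∑ k ∈ Bᶜ, l1norm (D k))) := by
    have h10 : 1 ≤ Mc * (5 / 18 * a) := by
      have h11 : 4 ≤ K * a := by
        have h13 : (1 : ℝ) ≤ 2 * K * (nS / N) := by
          rw [← mul_div_assoc, le_div_iff₀ hN]; linarith
        have := mul_le_mul_of_nonneg_left ha hK'.le
        linarith
      have h12 : 0 ≤ a := le_trans (by positivity) ha
      linarith [mul_le_mul_of_nonneg_right hM h12]
    have := mul_le_mul_of_nonneg_right h10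
      (Finset.sum_nonneg fun k (_ : k ∈ Bᶜ) => l1norm_nonneg (D k))
    linarith
  have h14 : Mc * ∑ j ∈ S, |Δ₀ j| ≤ Mc * (C₁ * √(5 * (s * m)) + 1 / 100 * l1norm Δ₀
      + 101 / 360 * (a * ∑ k ∈ Bᶜ, l1norm (D k))) := by
    linarith
  exact le_of_mul_le_mul_left h14 hM0

/-- Solution of the quadratic inequality behind the co-training step. -/
theorem cone_bounds {m lam V W G H C₁ s : ℝ} (hm : 0 ≤ m) (hlam : 0 < lam) (hV : 0 ≤ V)
    (hW : 0 ≤ W) (hG : 0 ≤ G) (hH : 0 ≤ H) (hC₁ : 0 ≤ C₁) (hs : 0 ≤ s)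
    (h1 : m + lam / 2 * W + lam / 2 * G ≤ 3 / 2 * lam * V + 2 * lam * H)
    (h2 : V ≤ C₁ * √(5 * (s * m)) + 1 / 100 * (V + W) + 101 / 360 * G) :
    m ≤ (20 * C₁ ^ 2 + 4) * (lam ^ 2 * s + lam * H) ∧
    (V + W + G) ^ 2 ≤ 3200 * (100 * C₁ ^ 4 + 10 * C₁ ^ 2 + 1) * (lam ^ 2 * s ^ 2 + H ^ 2) := by
  set q := C₁ * √(5 * (s * m)) with hq
  have hq0 : 0 ≤ q := by positivity
  have hq2 : q ^ 2 = 5 * C₁ ^ 2 * s * m := by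
    rw [hq, mul_pow, Real.sq_sqrt (by positivity)]; ring
  -- Add `lam / 20 * V` to both sides, so that `V` has coefficient 31/20 on the right, and insert
  -- the bound on `V`. The resulting coefficient of `G` is 31/70, just below the 9/20 still
  -- available on the left.
  have h3 : m + lam / 20 * (V + W + G) ≤ 2 * lam * (q + H) := by
    have h4 : V ≤ 100 / 99 * q + 1 / 99 * W + 2 / 7 * G := by linarith
    have h5 : lam * (31 / 20 * V) ≤ lam * (31 / 20 * (100 / 99 * q + 1 / 99 * W + 2 / 7 * G)) := by
      gcongr
    linarith [mul_nonneg hlam.le hq0, mul_nonneg hlam.le hW, mul_nonneg hlam.le hG]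
  have hZ : 0 ≤ V + W + G := by positivity
  have h6 : 2 * lam * q ≤ m / 2 + 10 * C₁ ^ 2 * lam ^ 2 * s := by
    have h7 : 0 ≤ m / 2 + 10 * C₁ ^ 2 * lam ^ 2 * s := by positivity
    refine (pow_le_pow_iff_left₀ (by positivity) h7 two_ne_zero).1 ?_
    have : (2 * lam * q) ^ 2 = 20 * lam ^ 2 * C₁ ^ 2 * s * m := by rw [mul_pow, hq2]; ring
    rw [this]
    nlinarith [sq_nonneg (m / 2 - 10 * C₁ ^ 2 * lam ^ 2 * s)]
  have hm1 : m ≤ 20 * C₁ ^ 2 * lam ^ 2 * s + 4 * lam * H := by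
    linarith [mul_nonneg hlam.le hZ]
  refine ⟨?_, ?_⟩
  · have e1 : 0 ≤ C₁ ^ 2 * (lam * H) := by positivity
    have e2 : 0 ≤ lam ^ 2 * s := by positivity
    linarith
  · have h8 : V + W + G ≤ 40 * (q + H) := by
      have : lam / 20 * (V + W + G) ≤ lam / 20 * (40 * (q + H)) := by linarith
      exact le_of_mul_le_mul_left this (by positivity)
    have h9 : (V + W + G) ^ 2 ≤ 3200 * (q ^ 2 + H ^ 2) := by
      have : (V + W + G) ^ 2 ≤ (40 * (q + H)) ^ 2 := by gcongr
      nlinarith [sq_nonneg (q - H)]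
    have h10 : q ^ 2 ≤ 5 * C₁ ^ 2 * s * (20 * C₁ ^ 2 * lam ^ 2 * s + 4 * lam * H) := by
      rw [hq2]; gcongr
    have h11 : 2 * (lam * s * H) ≤ lam ^ 2 * s ^ 2 + H ^ 2 := by
      nlinarith [sq_nonneg (lam * s - H)]
    have h12 := mul_le_mul_of_nonneg_left h11 (by positivity : 0 ≤ 10 * C₁ ^ 2)
    have h13 : 0 ≤ C₁ ^ 4 * H ^ 2 := by positivity
    have h14 : 0 ≤ lam ^ 2 * s ^ 2 := by positivity
    linarith

end Deterministic

/-! ### Error of the weighted average, and the debias step. -/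

section Deterministic

variable {p K nT nS : ℕ}

/-- Cauchy–Schwarz, to be used with `a = n_T`, `b = n_S`, `c = K`: averaging over tasks costs no
more than the root of the pooled prediction error. -/
theorem sqrt_mul_add_sqrt_mul_le {N a b c P Q m : ℝ} (ha : 0 ≤ a) (hb : 0 ≤ b) (hc : 0 ≤ c)
    (hP : 0 ≤ P) (hQ : 0 ≤ Q) (hm : 0 ≤ m) (hN0 : 0 ≤ N) (hN : a + b * c = N)
    (h : P + Q ≤ 2 * (m * N)) : √a * √P + √b * (√c * √Q) ≤ √(2 * m) * N := by
  have h3 : √(2 * m) * N = √(2 * m * N ^ 2) := by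
    rw [Real.sqrt_mul (mul_nonneg zero_le_two hm), Real.sqrt_sq hN0]
  rw [h3]
  refine Real.le_sqrt_of_sq_le ?_
  have e1 : (√a * √P + √b * (√c * √Q)) ^ 2 ≤ (√a ^ 2 + (√b * √c) ^ 2) * (√P ^ 2 + √Q ^ 2) := by
    linarith [sq_nonneg (√a * √Q - √b * √c * √P)]
  rw [mul_pow, Real.sq_sqrt ha, Real.sq_sqrt hb, Real.sq_sqrt hc, Real.sq_sqrt hP,
    Real.sq_sqrt hQ, hN] at e1
  linarith [mul_le_mul_of_nonneg_left h hN0]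

/-- `ℓ₁` and `ℓ₂` errors of the weighted average after the co-training step. -/
theorem weighted_error_bounds {N a C₁ C₂ C₃ l m : ℝ} (hN : N = K * nS + nT) (hnT : 0 < nT)
    (hnTS : nT ≤ nS) (hp : 0 < p) (hl : 0 ≤ l)
    (hC₁ : 0 ≤ C₁) (hC₂ : 0 ≤ C₂) (hC₃ : 0 ≤ C₃) (ha : 8 * (nS / N) ≤ a) (hm0 : 0 ≤ m)
    (x₀ : Fin nT → EuclideanSpace ℝ (Fin p)) (x : Fin K → Fin nS → EuclideanSpace ℝ (Fin p))
    (hx₀ : ∀ v, √nT * ‖v‖ ≤ C₁ * √(predSq x₀ v) + C₂ * √l * l1norm v)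
    (hx : ∀ k v, √nS * ‖v‖ ≤ C₁ * √(predSq (x k) v) + C₂ * √l * l1norm v)
    (Δ₀ : EuclideanSpace ℝ (Fin p)) (D d : Fin K → EuclideanSpace ℝ (Fin p))
    (B : Finset (Fin K)) (hB : 10 * (p * B.card) ≤ K)
    (hxB : ∀ k ∈ B, ∀ v, √nS * l1norm v ≤ C₃ * √p * √(predSq (x k) v))
    (hm : predSq x₀ Δ₀ + ∑ k, predSq (x k) (Δ₀ + D k) ≤ 2 * (m * N)) :
    l1norm (Δ₀ + ((nS : ℝ) / N) • ∑ k, (D k + d k))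
      ≤ 2 * (l1norm Δ₀ + a * ∑ k ∈ Bᶜ, l1norm (D k)) + C₃ * √m
        + l1norm (((nS : ℝ) / N) • ∑ k, d k) ∧
    ‖Δ₀ + ((nS : ℝ) / N) • ∑ k, (D k + d k)‖
      ≤ C₁ * √(2 * m) + C₂ * √(l / nT) * (2 * (l1norm Δ₀ + a * ∑ k ∈ Bᶜ, l1norm (D k))
        + C₃ * √m) + l1norm (((nS : ℝ) / N) • ∑ k, d k) := by
  have hnT' : (0 : ℝ) < nT := by exact_mod_cast hnT
  have hnS' : (0 : ℝ) < nS := by exact_mod_cast hnT.trans_le hnTS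
  have hnTS' : (nT : ℝ) ≤ nS := by exact_mod_cast hnTS
  have hN0 : 0 < N := by rw [hN]; positivity
  have hKN : (K : ℝ) * nS ≤ N := by rw [hN]; linarith
  have hw0 : 0 ≤ (nS : ℝ) / N := by positivity
  have hKw : (K : ℝ) * (nS / N) ≤ 1 := by
    rw [← mul_div_assoc, div_le_one hN0]; exact hKN
  have hBK : (B.card : ℝ) ≤ K := by
    have h1 : p * B.card ≤ K := by omega
    exact_mod_cast (Nat.le_mul_of_pos_left _ hp).trans h1
  have hp0 : 0 ≤ predSq x₀ Δ₀ := predSq_nonneg _ _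
  have hpk : ∀ k, 0 ≤ predSq (x k) (Δ₀ + D k) := fun k => predSq_nonneg _ _
  have hPk : 0 ≤ ∑ k, predSq (x k) (Δ₀ + D k) := Finset.sum_nonneg fun k _ => hpk k
  -- the contrast errors of the tasks in `B`
  have hTB : (nS : ℝ) / N * ∑ k ∈ B, l1norm (Δ₀ + D k) ≤ C₃ * √m := by
    have h1 : ∀ k ∈ B, l1norm (Δ₀ + D k) ≤ C₃ * √p / √nS * √(predSq (x k) (Δ₀ + D k)) := by
      intro k hk
      have := hxB k hk (Δ₀ + D k)
      rw [div_mul_eq_mul_div, le_div_iff₀ (by positivity)]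
      linarith
    have h2 := Finset.sum_le_sum h1
    rw [← Finset.mul_sum] at h2
    have h3 : ∑ k ∈ B, √(predSq (x k) (Δ₀ + D k)) ≤ √B.card * √(2 * (m * N)) := by
      refine (sum_sqrt_le _ _ fun k _ => hpk k).trans ?_
      gcongr
      refine (Finset.sum_le_sum_of_subset_of_nonneg (Finset.subset_univ B)
        fun k _ _ => hpk k).trans ?_
      linarith
    have h4 : (nS : ℝ) / N * (C₃ * √p / √nS * (√B.card * √(2 * (m * N))))
        = C₃ * √((nS / N) ^ 2 * (p * (B.card * (2 * (m * N))) / nS)) := by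
      rw [Real.sqrt_mul (sq_nonneg _), Real.sqrt_sq hw0, Real.sqrt_div' _ hnS'.le,
        Real.sqrt_mul (Nat.cast_nonneg p), Real.sqrt_mul (Nat.cast_nonneg _)]
      ring
    -- The factor `p` lost in bounding `ℓ₁` norms by prediction norms is paid for by `p |B| ≤ K /
    -- 10`.
    have h5 : ((nS : ℝ) / N) ^ 2 * (p * (B.card * (2 * (m * N))) / nS) ≤ m := by
      have h6 : ((nS : ℝ) / N) ^ 2 * (p * (B.card * (2 * (m * N))) / nS)
          = 2 * (p * B.card) * (nS / N) * m := by
        field_simp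
      have h7 : (10 : ℝ) * (p * B.card) ≤ K := by exact_mod_cast hB
      rw [h6]
      have h8 : 2 * ((p : ℝ) * B.card) * (nS / N) ≤ 1 := by
        have := mul_le_mul_of_nonneg_right h7 hw0
        have : 0 ≤ (p : ℝ) * B.card * (nS / N) := by positivity
        linarith
      exact mul_le_of_le_one_left hm0 h8
    calc (nS : ℝ) / N * ∑ k ∈ B, l1norm (Δ₀ + D k)
        ≤ nS / N * (C₃ * √p / √nS * (√B.card * √(2 * (m * N)))) := by
          refine mul_le_mul_of_nonneg_left (h2.trans ?_) hw0
          exact mul_le_mul_of_nonneg_left h3 (by positivity)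
      _ ≤ C₃ * √m := by rw [h4]; gcongr
  -- For `k ∈ B` only `Δ₀ + D k` is controlled, through its prediction error, so `D k` is recovered
  -- as a difference.
  have hDB : ∑ k ∈ B, l1norm (D k) ≤ B.card * l1norm Δ₀ + ∑ k ∈ B, l1norm (Δ₀ + D k) := by
    rw [← nsmul_eq_mul, ← Finset.sum_const, ← Finset.sum_add_distrib]
    refine Finset.sum_le_sum fun k _ => ?_
    have := l1norm_sub_le (Δ₀ + D k) Δ₀
    rw [add_sub_cancel_left] at this
    linarith
  set G := a * ∑ k ∈ Bᶜ, l1norm (D k) with hG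
  have hGs : 0 ≤ ∑ k ∈ Bᶜ, l1norm (D k) := Finset.sum_nonneg fun k _ => l1norm_nonneg _
  have hG0 : 0 ≤ G := mul_nonneg (le_trans (by positivity) ha) hGs
  have hT : (nS : ℝ) / N * ∑ k, l1norm (D k) ≤ l1norm Δ₀ + G + C₃ * √m := by
    rw [← Finset.sum_add_sum_compl B, mul_add]
    have h1 := mul_le_mul_of_nonneg_left hDB hw0
    have h2 : (nS : ℝ) / N * (B.card * l1norm Δ₀) ≤ l1norm Δ₀ := by
      rw [← mul_assoc]
      refine mul_le_of_le_one_left (l1norm_nonneg _) (le_trans ?_ hKw)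
      rw [mul_comm]; gcongr
    have h3 : 8 * ((nS : ℝ) / N) * ∑ k ∈ Bᶜ, l1norm (D k) ≤ G :=
      mul_le_mul_of_nonneg_right ha hGs
    have h4 : 0 ≤ (nS : ℝ) / N * ∑ k ∈ Bᶜ, l1norm (D k) := mul_nonneg hw0 hGs
    rw [mul_add] at h1
    linarith
  have hsplit : Δ₀ + ((nS : ℝ) / N) • ∑ k, (D k + d k)
      = (Δ₀ + ((nS : ℝ) / N) • ∑ k, D k) + ((nS : ℝ) / N) • ∑ k, d k := by
    rw [Finset.sum_add_distrib, smul_add, add_assoc]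
  rw [hsplit]
  constructor
  · refine (l1norm_add_le _ _).trans (add_le_add_left ((l1norm_add_le _ _).trans ?_) _)
    have : l1norm (((nS : ℝ) / N) • ∑ k, D k) ≤ nS / N * ∑ k, l1norm (D k) := by
      rw [l1norm_smul, abs_of_nonneg hw0]
      exact mul_le_mul_of_nonneg_left (l1norm_sum_le _ _) hw0
    linarith
  · refine (norm_add_le _ _).trans (add_le_add ?_ (norm_le_l1norm _))
    -- Since `n_T + K n_S = N`, this is a convex combination of the task errors, to each of which a
    -- restricted eigenvalue bound applies.
    have hrep : Δ₀ + ((nS : ℝ) / N) • ∑ k, D k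
        = ((nT : ℝ) / N) • Δ₀ + ∑ k, ((nS : ℝ) / N) • (Δ₀ + D k) := by
      rw [← Finset.smul_sum, Finset.sum_add_distrib, Finset.sum_const, Finset.card_univ,
        Fintype.card_fin, smul_add, ← add_assoc, ← Nat.cast_smul_eq_nsmul ℝ, smul_smul,
        ← add_smul]
      congr 1
      rw [show (nT : ℝ) / N + nS / N * K = 1 by rw [hN] at hN0 ⊢; field_simp; ring, one_smul]
    have hnorm : ‖Δ₀ + ((nS : ℝ) / N) • ∑ k, D k‖
        ≤ nT / N * ‖Δ₀‖ + ∑ k, (nS : ℝ) / N * ‖Δ₀ + D k‖ := by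
      rw [hrep]
      refine (norm_add_le _ _).trans (add_le_add ?_ ((norm_sum_le _ _).trans
        (Finset.sum_le_sum fun k _ => ?_)))
      · rw [norm_smul, Real.norm_of_nonneg (by positivity)]
      · rw [norm_smul, Real.norm_of_nonneg hw0]
    have hsT : √nT * √nT = (nT : ℝ) := Real.mul_self_sqrt hnT'.le
    have hsS : √nS * √nS = (nS : ℝ) := Real.mul_self_sqrt hnS'.le
    have hlT : √l = √(l / nT) * √nT := by
      rw [← Real.sqrt_mul (by positivity), div_mul_cancel₀ _ hnT'.ne']
    have hlS : √l ≤ √(l / nT) * √nS := by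
      rw [hlT]; gcongr
    have h0 : nT / N * ‖Δ₀‖ ≤ (C₁ * (√nT * √(predSq x₀ Δ₀))
        + C₂ * √(l / nT) * (nT * l1norm Δ₀)) / N := by
      rw [div_mul_eq_mul_div]
      gcongr
      have := mul_le_mul_of_nonneg_left (hx₀ Δ₀) (Real.sqrt_nonneg nT)
      rw [← mul_assoc, hsT] at this
      refine this.trans (le_of_eq ?_)
      rw [hlT]
      linear_combination (C₂ * √(l / nT) * l1norm Δ₀) * hsT
    have hk : ∀ k, nS / N * ‖Δ₀ + D k‖ ≤ (C₁ * (√nS * √(predSq (x k) (Δ₀ + D k)))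
        + C₂ * √(l / nT) * (nS * (l1norm Δ₀ + l1norm (D k)))) / N := by
      intro k
      rw [div_mul_eq_mul_div]
      gcongr
      have h1 := mul_le_mul_of_nonneg_left (hx k (Δ₀ + D k)) (Real.sqrt_nonneg nS)
      rw [← mul_assoc, hsS] at h1
      refine h1.trans ?_
      have h2 : √nS * (C₂ * √l * l1norm (Δ₀ + D k))
          ≤ √nS * (C₂ * (√(l / nT) * √nS) * (l1norm Δ₀ + l1norm (D k))) := by
        gcongr
        · exact l1norm_nonneg _
        · exact l1norm_add_le _ _
      have h3 : √nS * (C₂ * (√(l / nT) * √nS) * (l1norm Δ₀ + l1norm (D k)))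
          = C₂ * √(l / nT) * (nS * (l1norm Δ₀ + l1norm (D k))) := by
        linear_combination (C₂ * √(l / nT) * (l1norm Δ₀ + l1norm (D k))) * hsS
      linarith
    have hkS := Finset.sum_le_sum fun k (_ : k ∈ Finset.univ) => hk k
    rw [← Finset.sum_div, Finset.sum_add_distrib, ← Finset.mul_sum, ← Finset.mul_sum,
      ← Finset.mul_sum, ← Finset.mul_sum, ← Finset.mul_sum, Finset.sum_add_distrib,
      Finset.sum_const, Finset.card_univ, Fintype.card_fin, nsmul_eq_mul] at hkS
    rw [← Finset.mul_sum] at hnorm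
    have hCS : √nT * √(predSq x₀ Δ₀) + √nS * ∑ k, √(predSq (x k) (Δ₀ + D k))
        ≤ √(2 * m) * N := by
      have h1 : ∑ k, √(predSq (x k) (Δ₀ + D k)) ≤ √K * √(∑ k, predSq (x k) (Δ₀ + D k)) := by
        simpa using sum_sqrt_le Finset.univ _ fun k _ => hpk k
      set P := ∑ k, predSq (x k) (Δ₀ + D k)
      set P₀ := predSq x₀ Δ₀
      have h2 : √nT * √P₀ + √nS * (√K * √P) ≤ √(2 * m) * N :=
        sqrt_mul_add_sqrt_mul_le hnT'.le hnS'.le (Nat.cast_nonneg K) hp0 hPk hm0 hN0.le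
          (by rw [hN]; ring) hm
      refine le_trans ?_ h2
      gcongr
    have hl1 : (nT * l1norm Δ₀ + nS * (K * l1norm Δ₀ + ∑ k, l1norm (D k))) / N
        = l1norm Δ₀ + nS / N * ∑ k, l1norm (D k) := by
      have : (nT : ℝ) + nS * K = N := by rw [hN]; ring
      rw [div_eq_iff hN0.ne', add_mul, mul_right_comm,
        div_mul_cancel₀ _ hN0.ne']
      linear_combination l1norm Δ₀ * this
    have hfin : ‖Δ₀ + ((nS : ℝ) / N) • ∑ k, D k‖
        ≤ C₁ * ((√nT * √(predSq x₀ Δ₀) + √nS * ∑ k, √(predSq (x k) (Δ₀ + D k))) / N)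
          + C₂ * √(l / nT)
            * ((nT * l1norm Δ₀ + nS * (K * l1norm Δ₀ + ∑ k, l1norm (D k))) / N) := by
      refine (hnorm.trans (add_le_add h0 hkS)).trans (le_of_eq ?_)
      ring
    refine hfin.trans ?_
    rw [hl1]
    have : (√nT * √(predSq x₀ Δ₀) + √nS * ∑ k, √(predSq (x k) (Δ₀ + D k))) / N ≤ √(2 * m) := by
      rw [div_le_iff₀ hN0]; exact hCS
    exact add_le_add (mul_le_mul_of_nonneg_left this hC₁)
      (mul_le_mul_of_nonneg_left (by linarith) (by positivity))

/-- Basic inequality of the debias step. -/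
theorem debias_basic_inequality {lam : ℝ} (hlam : 0 ≤ lam) (hnT : 0 < nT)
    (x₀ : Fin nT → EuclideanSpace ℝ (Fin p)) (e₀ : Fin nT → ℝ)
    (u v δ : EuclideanSpace ℝ (Fin p))
    (hmin : 1 / (2 * (nT : ℝ)) * ∑ i, (e₀ i - inner ℝ (x₀ i) (u + v)) ^ 2
        + lam * l1norm (δ + v)
      ≤ 1 / (2 * (nT : ℝ)) * ∑ i, (e₀ i - inner ℝ (x₀ i) u) ^ 2 + lam * l1norm δ)
    (hscore : ∀ j, |score x₀ e₀ j| ≤ nT * lam / 2) :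
    predSq x₀ (u + v) / nT + lam * l1norm v ≤ predSq x₀ u / nT + 4 * (lam * l1norm δ) := by
  have hnT' : (0 : ℝ) < nT := by exact_mod_cast hnT
  rw [sum_residual_sq, sum_residual_sq, inner_add_right] at hmin
  have h1 := (le_abs_self _).trans (abs_inner_le_mul_l1norm hscore v)
  have h2 : lam * l1norm v ≤ lam * (l1norm (δ + v) + l1norm δ) := by
    refine mul_le_mul_of_nonneg_left ?_ hlam
    have := l1norm_sub_le (δ + v) δ
    rwa [add_sub_cancel_left] at this
  have hmin' := mul_le_mul_of_nonneg_left hmin hnT'.le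
  have e1 : ∀ t, (nT : ℝ) * (1 / (2 * nT) * t) = t / 2 := fun t => by field_simp
  rw [mul_add (nT : ℝ), mul_add (nT : ℝ), e1, e1] at hmin'
  have h2' := mul_le_mul_of_nonneg_left h2 hnT'.le
  refine le_of_mul_le_mul_left ?_ hnT'
  rw [mul_add, mul_add, mul_div_cancel₀ _ hnT'.ne', mul_div_cancel₀ _ hnT'.ne']
  linarith

end Deterministic

/-! ### The two regimes of the tuning parameters, and the final algebra. -/

section Deterministic

variable {p K nT nS : ℕ}

/-- Bounds implied by the choice of the tuning parameters of the co-training step. -/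
theorem tuning_bounds {c₀ CT : ℝ} {s : ℕ} {h : Fin K → ℝ} (hc₀ : 0 < c₀) (hK : 1 ≤ K)
    (hp : 2 ≤ p) (hnT : 0 < nT) (hnTS : nT ≤ nS) (hh : ∀ k, 0 ≤ h k)
    (hT : (s : ℝ) * Real.log p ≤ CT * nT)
    (hη : hbar nT nS h * √(Real.log p / nT) + (K : ℝ) * s * Real.log p / nS ≤ 1) :
    ∃ lam a : ℝ, lambdaZero c₀ p s nT nS h = lam ∧ weight p s nT nS h = (fun _ => a) ∧
      0 < lam ∧ 8 * (nS / totalSize K nT nS) ≤ a ∧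
      totalSize K nT nS * (lam * a) = 8 * c₀ * √(nS * Real.log p) ∧
      c₀ * √(totalSize K nT nS * Real.log p) ≤ totalSize K nT nS * lam ∧
      lam ^ 2 * s ≤ c₀ ^ 2 * (s * Real.log p / totalSize K nT nS
        + hbar nT nS h * √(Real.log p / nT)) ∧
      lam * (a * ∑ k, h k) ≤ 8 * c₀ * (s * Real.log p / totalSize K nT nS
        + hbar nT nS h * √(Real.log p / nT)) ∧
      Real.log p / nT * (lam ^ 2 * (s : ℝ) ^ 2) ≤ c₀ ^ 2 * CT
        * (s * Real.log p / totalSize K nT nS + hbar nT nS h * √(Real.log p / nT)) ∧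
      Real.log p / nT * (a * ∑ k, h k) ^ 2 ≤ 128 * (s * Real.log p / totalSize K nT nS
        + hbar nT nS h * √(Real.log p / nT)) := by
  have hnT' : (0 : ℝ) < nT := by exact_mod_cast hnT
  have hnS' : (0 : ℝ) < nS := by exact_mod_cast hnT.trans_le hnTS
  have hnTS' : (nT : ℝ) ≤ nS := by exact_mod_cast hnTS
  have hK' : (1 : ℝ) ≤ K := by exact_mod_cast hK
  have hl : 0 < Real.log p := Real.log_pos (by exact_mod_cast hp)
  set l := Real.log p
  set N := totalSize K nT nS with hN
  have hNdef : N = K * nS + nT := rfl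
  have hN0 : 0 < N := by rw [hNdef]; positivity
  have hNS : (nS : ℝ) ≤ N := by
    rw [hNdef]; linarith [mul_le_mul_of_nonneg_right hK' hnS'.le]
  have hN2 : N ≤ 2 * K * nS := by
    rw [hNdef]; linarith [mul_le_mul_of_nonneg_right hK' hnS'.le]
  set Hs := ∑ k, h k with hHs
  have hH0 : 0 ≤ Hs := Finset.sum_nonneg fun k _ => hh k
  have hbar_eq : hbar nT nS h = nS / N * Hs := rfl
  set hb := hbar nT nS h with hhb
  have hb0 : 0 ≤ hb := by rw [hbar_eq]; positivity
  have hρ2 : √(l / nT) ^ 2 = l / nT := Real.sq_sqrt (by positivity)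
  set ρ := √(l / nT) with hρ
  have hρ0 : 0 ≤ ρ := Real.sqrt_nonneg _
  have ht0 : 0 ≤ hb * ρ := by positivity
  have hsl0 : 0 ≤ (s : ℝ) * l / N := by positivity
  have hsT : (s : ℝ) * (l / nT) ≤ CT := by
    rw [← mul_div_assoc, div_le_iff₀ hnT']; exact hT
  have hKs0 : 0 ≤ (K : ℝ) * s * l / nS := by positivity
  have hCT : 0 ≤ CT := le_trans (by positivity) hsT
  have hw1 : (nS : ℝ) / N ≤ 1 := (div_le_one hN0).2 hNS
  -- The product `lam * a` is the same in both regimes, so this bound is shared; it uses `n_T ≤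
  -- n_S`.
  have hlamH : ∀ lam a : ℝ, N * (lam * a) = 8 * c₀ * √(nS * l) →
      lam * (a * Hs) ≤ 8 * c₀ * (s * l / N + hb * ρ) := by
    intro lam a hla
    have h1 : lam * (a * Hs) = 8 * c₀ * (√(nS * l) / N * Hs) := by
      have : lam * a = 8 * c₀ * √(nS * l) / N := by rw [eq_div_iff hN0.ne', ← hla]; ring
      rw [← mul_assoc, this]; ring
    have h2 : √(nS * l) ≤ nS * ρ := by
      rw [hρ, Real.sqrt_le_left (by positivity), mul_pow, Real.sq_sqrt (by positivity), sq,
        mul_assoc]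
      gcongr
      rw [mul_div_assoc', le_div_iff₀ hnT', mul_comm]
      gcongr
    have h3 : √(nS * l) / N * Hs ≤ hb * ρ := by
      rw [hbar_eq]
      have : √(nS * l) / N * Hs ≤ nS * ρ / N * Hs := by gcongr
      linarith [show (nS : ℝ) * ρ / N * Hs = nS / N * Hs * ρ by ring]
    rw [h1]
    gcongr
    linarith
  by_cases hA : EventA p s nT nS h
  · have hA' : hb * ρ ≤ s * l / nS := hA
    have e1 : √(l / N) * √(nS / N) * N = √(nS * l) := by
      rw [← Real.sqrt_mul (by positivity)]
      have : l / N * (nS / N) = nS * l / N ^ 2 := by field_simp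
      rw [this, Real.sqrt_div' _ (by positivity), Real.sqrt_sq hN0.le, div_mul_cancel₀ _ hN0.ne']
    have hla : N * (c₀ * √(l / N) * (8 * √(nS / N))) = 8 * c₀ * √(nS * l) := by
      rw [← e1]; ring
    have hlam2 : (c₀ * √(l / N)) ^ 2 = c₀ ^ 2 * (l / N) := by
      rw [mul_pow, Real.sq_sqrt (by positivity)]
    have hw : (nS : ℝ) / N ≤ √(nS / N) := by
      refine Real.le_sqrt_of_sq_le ?_
      rw [sq]
      exact mul_le_of_le_one_left (by positivity) hw1
    refine ⟨c₀ * √(l / N), 8 * √(nS / N), by simp [lambdaZero, hA, N, l],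
      by funext k; simp only [weight, if_pos hA]; rfl, by positivity, by linarith, hla, ?_, ?_, hlamH _ _ hla, ?_, ?_⟩
    · have : N * (c₀ * √(l / N)) = c₀ * √(N * l) := by
        have : N * √(l / N) = √(N * l) := by
          rw [show N * l = N ^ 2 * (l / N) by field_simp, Real.sqrt_mul (sq_nonneg _),
            Real.sqrt_sq hN0.le]
        rw [← this]; ring
      rw [this]
    · rw [hlam2]
      have : c₀ ^ 2 * (l / N) * s = c₀ ^ 2 * (s * l / N) := by ring
      rw [this]
      gcongr
      linarith
    · rw [hlam2]
      have : l / nT * (c₀ ^ 2 * (l / N) * (s : ℝ) ^ 2)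
          = c₀ ^ 2 * (s * (l / nT)) * (s * l / N) := by ring
      rw [this]
      gcongr
      linarith
    · have h1 : l / nT * (8 * √(nS / N) * Hs) ^ 2 = 64 * (N / nS) * (hb * ρ) ^ 2 := by
        rw [mul_pow, mul_pow, mul_pow, Real.sq_sqrt (by positivity), hρ2, hbar_eq]
        field_simp
        ring
      rw [h1]
      -- The square of `hb * ρ` comes with `N / n_S ≤ 2 K`; on `A` this is compensated by `hb * ρ ≤
      -- s l / n_S` and the bound on `K s l / n_S`.
      have h2 : N / nS * (hb * ρ) ≤ 2 := by
        have h3 : N / nS ≤ 2 * K := by rw [div_le_iff₀ hnS']; exact hN2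
        calc N / nS * (hb * ρ) ≤ 2 * K * (s * l / nS) := by gcongr
          _ = 2 * (K * s * l / nS) := by ring
          _ ≤ 2 := by linarith
      calc 64 * (N / nS) * (hb * ρ) ^ 2 = 64 * (N / nS * (hb * ρ)) * (hb * ρ) := by ring
        _ ≤ 64 * 2 * (hb * ρ) := by gcongr
        _ ≤ 128 * (s * l / N + hb * ρ) := by linarith
  · have hA' : s * l / nS ≤ hb * ρ := (not_le.1 hA).le
    have e1 : √(l / nS) * nS = √(nS * l) := by
      rw [show (nS : ℝ) * l = nS ^ 2 * (l / nS) by field_simp, Real.sqrt_mul (sq_nonneg _),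
        Real.sqrt_sq hnS'.le, mul_comm]
    have hla : N * (c₀ * √(l / nS) * (8 * (nS / N))) = 8 * c₀ * √(nS * l) := by
      rw [← e1]; field_simp
    have hlam2 : (c₀ * √(l / nS)) ^ 2 = c₀ ^ 2 * (l / nS) := by
      rw [mul_pow, Real.sq_sqrt (by positivity)]
    refine ⟨c₀ * √(l / nS), 8 * (nS / N), by simp [lambdaZero, hA, l],
      by funext k; simp only [weight, if_neg hA]; rfl, by positivity, le_rfl, hla, ?_, ?_, hlamH _ _ hla, ?_, ?_⟩
    · have : √(N * l) ≤ N * √(l / nS) := by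
        rw [Real.sqrt_le_left (by positivity), mul_pow, Real.sq_sqrt (by positivity), sq,
          mul_assoc]
        gcongr
        rw [mul_div_assoc', le_div_iff₀ hnS', mul_comm]
        gcongr
      calc c₀ * √(N * l) ≤ c₀ * (N * √(l / nS)) := by gcongr
        _ = N * (c₀ * √(l / nS)) := by ring
    · rw [hlam2]
      -- Off `A` the larger `lam` is harmless, because `s l / n_S ≤ hb * ρ`.
      have : c₀ ^ 2 * (l / nS) * s = c₀ ^ 2 * (s * l / nS) := by ring
      rw [this]
      gcongr
      linarith
    · rw [hlam2]
      have : l / nT * (c₀ ^ 2 * (l / nS) * (s : ℝ) ^ 2)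
          = c₀ ^ 2 * (s * (l / nT)) * (s * l / nS) := by ring
      rw [this]
      gcongr
      linarith
    · have h1 : l / nT * (8 * (nS / N) * Hs) ^ 2 = 64 * (hb * ρ) * (hb * ρ) := by
        have : l / nT * (8 * (nS / N) * Hs) ^ 2 = 64 * (l / nT) * (nS / N * Hs) ^ 2 := by ring
        rw [this, ← hρ2, ← hbar_eq]; ring
      rw [h1]
      calc 64 * (hb * ρ) * (hb * ρ) ≤ 64 * 1 * (hb * ρ) := by gcongr; linarith
        _ ≤ 128 * (s * l / N + hb * ρ) := by linarith

/-- Combination of the bounds for the two steps. -/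
theorem error_combination {C₁ C₂ C₃ C₄ CT M₁ M₂ c₁ : ℝ} (hC₁ : 0 ≤ C₁) (hC₂ : 0 ≤ C₂)
    (hC₃ : 0 ≤ C₃) (hC₄ : 0 ≤ C₄) (hM₁ : 0 ≤ M₁) (hM₂ : 0 ≤ M₂)
    (hc₁ : 0 < c₁) :
    ∃ C : ℝ, 0 < C ∧ ∀ m Z Y ρ R u₁ u₂ v₁ P Q w δ : ℝ, 0 ≤ ρ → 0 ≤ Z → 0 ≤ Y →
      0 ≤ R → R ≤ 1 → 0 ≤ u₁ → 0 ≤ u₂ → 0 ≤ v₁ → 0 ≤ Q → 0 ≤ w →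
      m ≤ M₁ * R → ρ ^ 2 * Z ^ 2 ≤ M₂ * R → Y ^ 2 ≤ R → ρ ^ 2 ≤ CT → ρ * δ ≤ R →
      u₁ ≤ 2 * Z + C₃ * √m + Y →
      u₂ ≤ C₁ * √(2 * m) + C₂ * ρ * (2 * Z + C₃ * √m) + Y →
      P ≤ C₄ * (u₂ ^ 2 + ρ ^ 2 * u₁ ^ 2) →
      Q + c₁ * ρ * v₁ ≤ P + 4 * (c₁ * ρ * δ) →
      w ≤ C₁ * √Q + C₂ * ρ * (u₁ + v₁) → w ^ 2 ≤ C * R := by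
  -- In units of `√R`: `A₁` bounds `ρ * u₁`, `A₂` bounds `u₂` and `A₄` bounds `w`. In units of `R`:
  -- `M₃` bounds the right side of the debias inequality.
  set A₁ := 2 * √M₂ + √CT * (C₃ * √M₁) + √CT with hA₁
  set A₂ := C₁ * √(2 * M₁) + C₂ * (2 * √M₂ + √CT * (C₃ * √M₁)) + 1 with hA₂
  set M₃ := C₄ * (A₂ ^ 2 + A₁ ^ 2) + 4 * c₁ with hM₃
  set A₄ := C₁ * √M₃ + C₂ * (A₁ + M₃ / c₁) with hA₄
  have hA₁0 : 0 ≤ A₁ := by positivity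
  have hA₂0 : 0 ≤ A₂ := by positivity
  have hM₃0 : 0 ≤ M₃ := by positivity
  have hA₄0 : 0 ≤ A₄ := by positivity
  refine ⟨A₄ ^ 2 + 1, by positivity, ?_⟩
  intro m Z Y ρ R u₁ u₂ v₁ P Q w δ hρ hZ hY hR hR1 hu₁ hu₂ hv₁ hQ hw hm hρZ hYR hρT hδ h1 h2 h3
    h4 h5
  set g := √R with hg
  have hg0 : 0 ≤ g := Real.sqrt_nonneg _
  have hgR : g ^ 2 = R := Real.sq_sqrt hR
  -- The debias step bounds `ρ * v₁` by a multiple of `R`; since `R ≤ 1` this is no worse than the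
  -- `√R` of the other terms.
  have hRg : R ≤ g := Real.le_sqrt_of_sq_le (by rw [sq]; exact mul_le_of_le_one_left hR hR1)
  have hmg : √m ≤ √M₁ * g := by
    rw [hg, ← Real.sqrt_mul hM₁]; exact Real.sqrt_le_sqrt hm
  have h2mg : √(2 * m) ≤ √(2 * M₁) * g := by
    rw [hg, ← Real.sqrt_mul (by positivity)]; exact Real.sqrt_le_sqrt (by linarith)
  have hρZg : ρ * Z ≤ √M₂ * g := by
    rw [hg, ← Real.sqrt_mul hM₂]; exact Real.le_sqrt_of_sq_le (by rw [mul_pow]; exact hρZ)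
  have hYg : Y ≤ g := Real.le_sqrt_of_sq_le hYR
  have hρC : ρ ≤ √CT := Real.le_sqrt_of_sq_le hρT
  have hρm : ρ * (C₃ * √m) ≤ √CT * (C₃ * (√M₁ * g)) := by gcongr
  have hu₁g : ρ * u₁ ≤ A₁ * g := by
    have e1 := mul_le_mul_of_nonneg_left h1 hρ
    have e2 : ρ * Y ≤ √CT * g := by gcongr
    rw [hA₁]; linarith
  have hu₂g : u₂ ≤ A₂ * g := by
    have e1 : C₂ * (ρ * (2 * Z + C₃ * √m)) ≤ C₂ * ((2 * √M₂ + √CT * (C₃ * √M₁)) * g) := by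
      exact mul_le_mul_of_nonneg_left (by linarith) hC₂
    have e2 : C₁ * √(2 * m) ≤ C₁ * (√(2 * M₁) * g) := by gcongr
    rw [hA₂]; linarith
  have hP : P ≤ C₄ * (A₂ ^ 2 + A₁ ^ 2) * R := by
    have e1 : ρ ^ 2 * u₁ ^ 2 ≤ A₁ ^ 2 * R := by
      rw [← mul_pow, ← hgR, ← mul_pow]; gcongr
    have e2 : u₂ ^ 2 ≤ A₂ ^ 2 * R := by
      rw [← hgR, ← mul_pow]; gcongr
    refine h3.trans ?_
    rw [mul_assoc]
    gcongr
    linarith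
  have hδ' : c₁ * ρ * δ ≤ c₁ * R := by rw [mul_assoc]; gcongr
  have hM : Q + c₁ * ρ * v₁ ≤ M₃ * R := by rw [hM₃]; linarith
  have hρv0 : 0 ≤ c₁ * ρ * v₁ := by positivity
  have hQg : √Q ≤ √M₃ * g := by
    rw [hg, ← Real.sqrt_mul hM₃0]; exact Real.sqrt_le_sqrt (by linarith)
  have hv₁g : ρ * v₁ ≤ M₃ / c₁ * g := by
    have e1 : M₃ * R ≤ M₃ * g := by gcongr
    rw [div_mul_eq_mul_div, le_div_iff₀ hc₁]
    linarith
  have hwg : w ≤ A₄ * g := by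
    have e1 : C₁ * √Q ≤ C₁ * (√M₃ * g) := by gcongr
    have e2 : C₂ * (ρ * u₁ + ρ * v₁) ≤ C₂ * (A₁ * g + M₃ / c₁ * g) := by gcongr
    rw [hA₄]; linarith
  calc w ^ 2 ≤ (A₄ * g) ^ 2 := by gcongr
    _ = A₄ ^ 2 * R := by rw [mul_pow, hgR]
    _ ≤ (A₄ ^ 2 + 1) * R := by linarith

end Deterministic

/-! ### The deterministic error bound for the two-step estimator. -/

section Deterministic

variable {p K nT nS : ℕ}

theorem coTrainingObjective_eq
    (x : (k : Fin (K + 1)) → Fin (sampleSize nT nS k) → EuclideanSpace ℝ (Fin p))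
    (y : (k : Fin (K + 1)) → Fin (sampleSize nT nS k) → ℝ) (lam : ℝ) (a : Fin K → ℝ)
    (b : Fin (K + 1) → EuclideanSpace ℝ (Fin p)) :
    coTrainingObjective x y lam a b
      = 1 / (2 * totalSize K nT nS) * (∑ i : Fin nT, (y 0 i - inner ℝ (x 0 i) (b 0)) ^ 2
        + ∑ k : Fin K, ∑ i : Fin nS, (y k.succ i - inner ℝ (x k.succ i) (b k.succ)) ^ 2)
        + lam * (l1norm (b 0) + ∑ k : Fin K, a k * l1norm (b k.succ - b 0)) := by
  unfold coTrainingObjective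
  rw [Fin.sum_univ_succ]
  rfl

/-- Deterministic error bound for the two-step estimator. The sources in `B` may have an
exceptionally large noise correlation; for these, `d k` is a lasso fit of the noise. -/
theorem twoStep_error_bound {C₁ C₂ C₃ C₄ CT c₀ c₁ : ℝ} (hC₁ : 0 ≤ C₁) (hC₂ : 0 ≤ C₂)
    (hC₃ : 0 ≤ C₃) (hC₄ : 0 ≤ C₄) (hCT : 0 ≤ CT) (hc₀ : 0 < c₀) (hc₁ : 0 < c₁) :
    ∃ C : ℝ, 0 < C ∧ ∀ (p K nT nS s : ℕ) (h : Fin K → ℝ)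
      (β : Fin (K + 1) → EuclideanSpace ℝ (Fin p))
      (x : (k : Fin (K + 1)) → Fin (sampleSize nT nS k) → EuclideanSpace ℝ (Fin p))
      (e : (k : Fin (K + 1)) → Fin (sampleSize nT nS k) → ℝ)
      (d : Fin K → EuclideanSpace ℝ (Fin p)) (B : Finset (Fin K)),
      1 ≤ K → 1 ≤ s → 2 ≤ p → 0 < nT → nT ≤ nS →
      (s : ℝ) * Real.log p ≤ CT * nT →
      hbar nT nS h * √(Real.log p / nT) + (K : ℝ) * s * Real.log p / nS ≤ 1 →
      C₂ * √(s * Real.log p / nS) ≤ 1 / 100 →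
      β ∈ parameterSpace s h →
      (∀ v, √nT * ‖v‖ ≤ C₁ * √(predSq (n := nT) (x 0) v) + C₂ * √(Real.log p) * l1norm v) →
      (∀ (k : Fin K) v, √nS * ‖v‖ ≤ C₁ * √(predSq (n := nS) (x k.succ) v)
        + C₂ * √(Real.log p) * l1norm v) →
      (∀ v, predSq (n := nT) (x 0) v
        ≤ nT * (C₄ * (‖v‖ ^ 2 + Real.log p / nT * l1norm v ^ 2))) →
      10 * (p * B.card) ≤ K →
      (∀ k ∈ B, ∀ v, √nS * l1norm v ≤ C₃ * √p * √(predSq (n := nS) (x k.succ) v)) →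
      (∀ k ∉ B, d k = 0 ∧ ∀ j,
        |score (n := nS) (x k.succ) (e k.succ) j| ≤ 4 * c₀ * √(nS * Real.log p)) →
      (∀ k ∈ B, ∀ v, inner ℝ (score (n := nS) (x k.succ)
          fun i => e k.succ i - inner ℝ (x k.succ i) (d k)) v
        ≤ 8 * c₀ * √(nS * Real.log p) * (l1norm (d k + v) - l1norm (d k))) →
      (∀ j, |(score (n := nT) (x 0) (e 0) + ∑ k : Fin K, score (n := nS) (x k.succ)
          fun i => e k.succ i - inner ℝ (x k.succ i) (d k)) j|
        ≤ c₀ * √(totalSize K nT nS * Real.log p) / 2) →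
      l1norm (((nS : ℝ) / totalSize K nT nS) • ∑ k, d k) ^ 2
        ≤ Real.log p / totalSize K nT nS →
      (∀ j, |score (n := nT) (x 0) (e 0) j| ≤ c₁ * √(nT * Real.log p) / 2) →
      ∀ βhat, IsTwoStepEstimate x (response β x e) (lambdaZero c₀ p s nT nS h)
          (weight p s nT nS h) (lambdaTilde c₁ p nT) βhat →
        ‖βhat - β 0‖ ^ 2 ≤ C * ((s : ℝ) * Real.log p / totalSize K nT nS
          + hbar nT nS h * √(Real.log p / nT)) := by
  obtain ⟨C, hC, hcomb⟩ := error_combination (C₁ := C₁) (C₂ := C₂) (C₃ := C₃) (C₄ := C₄)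
    (CT := CT) (M₁ := (20 * C₁ ^ 2 + 4) * (c₀ ^ 2 + 8 * c₀))
    (M₂ := 3200 * (100 * C₁ ^ 4 + 10 * C₁ ^ 2 + 1) * (c₀ ^ 2 * CT + 128)) (c₁ := c₁)
    hC₁ hC₂ hC₃ hC₄ (by positivity) (by positivity) hc₁
  refine ⟨C, hC, ?_⟩
  intro p K nT nS s h β x e d B hK hs hp hnT hnTS hT hη hθ hβ hx₀ hx hup hB hxB hgood hbad htot
    hdbar htar βhat hest
  have hnT' : (0 : ℝ) < nT := by exact_mod_cast hnT
  have hnS : 0 < nS := hnT.trans_le hnTS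
  have hnS' : (0 : ℝ) < nS := by exact_mod_cast hnS
  have hnTS' : (nT : ℝ) ≤ nS := by exact_mod_cast hnTS
  have hK' : (1 : ℝ) ≤ K := by exact_mod_cast hK
  have hs' : (1 : ℝ) ≤ s := by exact_mod_cast hs
  have hl : 0 < Real.log p := Real.log_pos (by exact_mod_cast hp)
  have hh : ∀ k, 0 ≤ h k := fun k => (l1norm_nonneg _).trans (hβ.2 k)
  obtain ⟨lam, a, hlam_eq, ha_eq, hlam, ha, hla, hNlam, hr₁, hr₂, hr₃, hr₄⟩ :=
    tuning_bounds hc₀ hK hp hnT hnTS hh hT hη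
  rw [hlam_eq, ha_eq] at hest
  obtain ⟨b, dl, hb, hdl, rfl⟩ := hest
  set l := Real.log p with hl_def
  set N := totalSize K nT nS with hN
  have hNdef : N = K * nS + nT := rfl
  have hN0 : 0 < N := by rw [hNdef]; positivity
  have hKS : (nS : ℝ) ≤ K * nS := le_mul_of_one_le_left hnS'.le hK'
  have hN2 : N ≤ 2 * K * nS := by rw [hNdef]; linarith
  have ha0 : 0 ≤ a := le_trans (by positivity) ha
  set R := (s : ℝ) * l / N + hbar nT nS h * √(l / nT) with hR
  have hb0 : 0 ≤ hbar nT nS h :=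
    mul_nonneg (by positivity) (Finset.sum_nonneg fun k _ => hh k)
  have hR0 : 0 ≤ R := by positivity
  have hR1 : R ≤ 1 := by
    refine le_trans ?_ hη
    have : (s : ℝ) * l / N ≤ K * s * l / nS := by
      rw [mul_assoc (K : ℝ)]
      refine div_le_div₀ (by positivity) (le_mul_of_one_le_left (by positivity) hK') hnS' ?_
      rw [hNdef]; linarith
    linarith
  -- the co-training step
  obtain ⟨Δ₀, hΔ₀⟩ : ∃ Δ₀, Δ₀ = b 0 - β 0 := ⟨_, rfl⟩
  obtain ⟨δ, hδ⟩ : ∃ δ : Fin K → EuclideanSpace ℝ (Fin p), δ = fun k => β k.succ - β 0 :=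
    ⟨_, rfl⟩
  obtain ⟨D, hD⟩ : ∃ D : Fin K → EuclideanSpace ℝ (Fin p),
    D = fun k => b k.succ - b 0 - δ k - d k := ⟨_, rfl⟩
  obtain ⟨r, hr⟩ : ∃ r : Fin K → Fin nS → ℝ,
    r = fun k i => e k.succ i - inner ℝ (x k.succ i) (d k) := ⟨_, rfl⟩
  obtain ⟨S, hS, hSc⟩ : ∃ S : Finset (Fin p), (∀ j ∉ S, β 0 j = 0) ∧ S.card ≤ s := by
    classical
    refine ⟨Finset.univ.filter fun j => β 0 j ≠ 0, fun j hj => by simpa using hj, ?_⟩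
    have := hβ.1
    rw [l0norm, Set.ncard_eq_toFinset_card'] at this
    convert this using 2
    ext; simp
  have hy₀ : ∀ i : Fin nT, response β x e 0 i = inner ℝ (x 0 i) (β 0) + e 0 i := fun _ => rfl
  have hy : ∀ (k : Fin K) (i : Fin nS),
    response β x e k.succ i = inner ℝ (x k.succ i) (β k.succ) + e k.succ i := fun _ _ => rfl
  -- The comparison point: the truth with the noise fits added in the sources. Its residuals are `e
  -- 0` and `r`, and `D` is the contrast error relative to it.
  obtain ⟨cmp, hcmp₀, hcmp⟩ : ∃ cmp : Fin (K + 1) → EuclideanSpace ℝ (Fin p),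
    cmp 0 = β 0 ∧ ∀ k : Fin K, cmp k.succ = β k.succ + d k :=
    ⟨Fin.cons (β 0) fun k => β k.succ + d k, rfl, fun _ => rfl⟩
  have hq₁ : ∑ i : Fin nT, (e 0 i - inner ℝ (x 0 i) Δ₀) ^ 2
      = ∑ i : Fin nT, (response β x e 0 i - inner ℝ (x 0 i) (b 0)) ^ 2 :=
    Finset.sum_congr rfl fun i _ => by rw [hy₀, hΔ₀, inner_sub_right]; ring
  have hq₂ : ∑ k, ∑ i : Fin nS, (r k i - inner ℝ (x k.succ i) (Δ₀ + D k)) ^ 2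
      = ∑ k : Fin K, ∑ i : Fin nS,
        (response β x e k.succ i - inner ℝ (x k.succ i) (b k.succ)) ^ 2 :=
    Finset.sum_congr rfl fun k _ => Finset.sum_congr rfl fun i _ => by
      rw [hy, show b k.succ = β k.succ + (Δ₀ + D k) + d k by
        rw [hD, hδ, hΔ₀]; simp only; abel, hr]
      simp only [inner_add_right]; ring
  have hq₃ : ∑ i : Fin nT, e 0 i ^ 2
      = ∑ i : Fin nT, (response β x e 0 i - inner ℝ (x 0 i) (cmp 0)) ^ 2 :=
    Finset.sum_congr rfl fun i _ => by rw [hy₀, hcmp₀]; ring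
  have hq₄ : ∑ k, ∑ i : Fin nS, r k i ^ 2
      = ∑ k : Fin K, ∑ i : Fin nS,
        (response β x e k.succ i - inner ℝ (x k.succ i) (cmp k.succ)) ^ 2 :=
    Finset.sum_congr rfl fun k _ => Finset.sum_congr rfl fun i _ => by
      rw [hy, hcmp, hr]
      simp only [inner_add_right]; ring
  have hq₅ : ∀ k, δ k + d k + D k = b k.succ - b 0 := fun k => by rw [hD]; simp only; abel
  have hq₆ : ∀ k, δ k + d k = cmp k.succ - cmp 0 := fun k => by
    rw [hδ, hcmp, hcmp₀]; simp only; abel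
  have hq₇ : β 0 + Δ₀ = b 0 := by rw [hΔ₀]; abel
  have hbasic := coTraining_basic_inequality (N := N) (lam := lam) (a := a) hN0 hlam.le ha0
    (fun i : Fin nT => x 0 i) (fun (k : Fin K) (i : Fin nS) => x k.succ i) (fun i : Fin nT => e 0 i) r
    (β 0) Δ₀ δ d D S B
    (by
      have h1 : coTrainingObjective x (response β x e) lam (fun _ => a) b
          ≤ coTrainingObjective x (response β x e) lam (fun _ => a) cmp := hb (Set.mem_univ _)
      rw [coTrainingObjective_eq, coTrainingObjective_eq] at h1
      rw [hq₁, hq₂, hq₃, hq₄, hq₇]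
      simp only [hq₅]
      simp only [hq₆]
      rw [← hcmp₀]
      exact h1)
    hS
    (fun j => by
      rw [hr]
      exact (htot j).trans (by linarith))
    (fun k hk => by
      refine ⟨(hgood k hk).1, fun j => ?_⟩
      rw [hla, hr]
      simp only [(hgood k hk).1, inner_zero_right, sub_zero]
      exact ((hgood k hk).2 j).trans (le_of_eq (by ring)))
    (fun k hk v => by
      rw [hla, hr]
      exact hbad k hk v)
  obtain ⟨m, hm⟩ : ∃ m, m = (1 / 2 * (predSq (fun i : Fin nT => x 0 i) Δ₀
    + ∑ k : Fin K, predSq (fun i : Fin nS => x k.succ i) (Δ₀ + D k))) / N := ⟨_, rfl⟩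
  rw [← hm] at hbasic
  have hm0 : 0 ≤ m := by
    rw [hm]
    have := Finset.sum_nonneg fun (k : Fin K) (_ : k ∈ Finset.univ) =>
      predSq_nonneg (fun i : Fin nS => x k.succ i) (Δ₀ + D k)
    have := predSq_nonneg (fun i : Fin nT => x 0 i) Δ₀
    positivity
  have hmN : predSq (fun i : Fin nT => x 0 i) Δ₀
      + ∑ k : Fin K, predSq (fun i : Fin nS => x k.succ i) (Δ₀ + D k) ≤ 2 * (m * N) := by
    rw [hm, div_mul_cancel₀ _ hN0.ne']; linarith
  have hV := sum_abs_target_error_le (N := N) hK hnS hC₁ hN0 hN2 ha hθ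
    (fun (k : Fin K) (i : Fin nS) => x k.succ i) hx Δ₀ D S hSc B
    (le_trans (Nat.mul_le_mul_left 10 (Nat.le_mul_of_pos_left _ (by omega))) hB)
    (m := m) (by linarith [predSq_nonneg (fun i : Fin nT => x 0 i) Δ₀])
  have hsplit : l1norm Δ₀ = ∑ j ∈ S, |Δ₀ j| + ∑ j ∈ Sᶜ, |Δ₀ j| :=
    (Finset.sum_add_sum_compl S _).symm
  have hG0 : 0 ≤ a * ∑ k ∈ Bᶜ, l1norm (D k) :=
    mul_nonneg ha0 (Finset.sum_nonneg fun k _ => l1norm_nonneg _)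
  have hδh : ∑ k, l1norm (δ k) ≤ ∑ k, h k := by
    rw [hδ]; exact Finset.sum_le_sum fun k _ => hβ.2 k
  obtain ⟨hcm, hcZ⟩ := cone_bounds (m := m) (lam := lam) (V := ∑ j ∈ S, |Δ₀ j|)
    (W := ∑ j ∈ Sᶜ, |Δ₀ j|) (G := a * ∑ k ∈ Bᶜ, l1norm (D k)) (H := a * ∑ k, h k) (C₁ := C₁)
    (s := s) hm0 hlam (Finset.sum_nonneg fun _ _ => abs_nonneg _)
    (Finset.sum_nonneg fun _ _ => abs_nonneg _) hG0
    (mul_nonneg ha0 (Finset.sum_nonneg fun k _ => hh k)) hC₁ (by positivity)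
    (by
      have := mul_le_mul_of_nonneg_left hδh (mul_nonneg hlam.le ha0)
      linarith)
    (by rw [← hsplit]; exact hV)
  rw [← hsplit] at hcZ
  have hρ2 : √(l / nT) ^ 2 = l / nT := Real.sq_sqrt (by positivity)
  obtain ⟨hu1, hu2⟩ := weighted_error_bounds (N := N) hNdef hnT hnTS (by omega) hl.le hC₁ hC₂ hC₃
    ha hm0 (fun i : Fin nT => x 0 i) (fun (k : Fin K) (i : Fin nS) => x k.succ i) hx₀ hx
    Δ₀ D d B hB hxB hmN
  obtain ⟨u, hu⟩ : ∃ u, u = Δ₀ + ((nS : ℝ) / N) • ∑ k, (D k + d k) := ⟨_, rfl⟩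
  rw [← hu] at hu1 hu2
  -- the debias step
  obtain ⟨δs, hδs⟩ : ∃ δs, δs = -(((nS : ℝ) / N) • ∑ k, δ k) := ⟨_, rfl⟩
  -- `β 0 - δs` is the weighted average of the true parameters. Thus `u` is the estimation error
  -- proper and `δs` the ideal correction, of `ℓ₁` norm at most h̄.
  have hw : weightedAverage nT nS b = β 0 + u - δs := by
    have h1 : (nT : ℝ) / N = 1 - nS / N * K := by rw [hNdef] at hN0 ⊢; field_simp; ring
    have h2 : ∑ k, (D k + d k) = ∑ k : Fin K, b k.succ - (K : ℝ) • b 0 - ∑ k, δ k := by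
      rw [hD]
      simp only [sub_add_cancel, Finset.sum_sub_distrib, Finset.sum_const, Finset.card_univ,
        Fintype.card_fin, Nat.cast_smul_eq_nsmul]
    rw [weightedAverage, ← hN, hu, hδs, hΔ₀, h2, h1]
    module
  have hdeb := debias_basic_inequality (lam := c₁ * √(l / nT)) (by positivity) hnT
    (fun i : Fin nT => x 0 i) (fun i : Fin nT => e 0 i) u (dl - δs) δs
    (by
      have h1 : debiasObjective x (response β x e) (lambdaTilde c₁ p nT)
          (weightedAverage nT nS b) dl
          ≤ debiasObjective x (response β x e) (lambdaTilde c₁ p nT)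
            (weightedAverage nT nS b) δs := hdl (Set.mem_univ _)
      have h2 : ∀ v, debiasObjective x (response β x e) (lambdaTilde c₁ p nT)
          (weightedAverage nT nS b) v = 1 / (2 * (nT : ℝ))
            * ∑ i : Fin nT, (e 0 i - inner ℝ (x 0 i) (u + (v - δs))) ^ 2
            + c₁ * √(l / nT) * l1norm v := fun v => by
        unfold debiasObjective
        rw [hw]
        refine congrArg₂ _ (congrArg _ (Finset.sum_congr rfl fun i _ => ?_)) rfl
        simp only [response, inner_sub_right, inner_add_right]; ring
      rw [h2, h2, sub_self, add_zero] at h1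
      rw [add_sub_cancel]
      exact h1)
    (fun j => (htar j).trans (le_of_eq (by
      have : √(nT * l) = nT * √(l / nT) := by
        rw [show (nT : ℝ) * l = nT ^ 2 * (l / nT) by field_simp, Real.sqrt_mul (sq_nonneg _),
          Real.sqrt_sq hnT'.le]
      rw [this]; ring)))
  have hfinal := hx₀ (u + (dl - δs))
  have herr : weightedAverage nT nS b + dl - β 0 = u + (dl - δs) := by rw [hw]; abel
  rw [herr]
  have hlT : √l = √(l / nT) * √nT := by
    rw [← Real.sqrt_mul (by positivity), div_mul_cancel₀ _ hnT'.ne']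
  refine hcomb m (l1norm Δ₀ + a * ∑ k ∈ Bᶜ, l1norm (D k))
    (l1norm (((nS : ℝ) / N) • ∑ k, d k)) (√(l / nT)) R (l1norm u) ‖u‖ (l1norm (dl - δs))
    (predSq (fun i : Fin nT => x 0 i) u / nT)
    (predSq (fun i : Fin nT => x 0 i) (u + (dl - δs)) / nT) ‖u + (dl - δs)‖
    (l1norm δs) (by positivity) (add_nonneg (l1norm_nonneg _) hG0) (l1norm_nonneg _) hR0 hR1
    (l1norm_nonneg _) (norm_nonneg _) (l1norm_nonneg _)
    (div_nonneg (predSq_nonneg _ _) hnT'.le) (norm_nonneg _) ?_ ?_ ?_ ?_ ?_ hu1 hu2 ?_ ?_ ?_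
  · refine hcm.trans ?_
    rw [mul_assoc]
    refine mul_le_mul_of_nonneg_left ?_ (by positivity)
    linarith
  · rw [hρ2]
    refine (mul_le_mul_of_nonneg_left hcZ (by positivity)).trans ?_
    have h1 : l / nT * (lam ^ 2 * (s : ℝ) ^ 2 + (a * ∑ k, h k) ^ 2)
        ≤ (c₀ ^ 2 * CT + 128) * R := by linarith
    have := mul_le_mul_of_nonneg_left h1
      (by positivity : 0 ≤ 3200 * (100 * C₁ ^ 4 + 10 * C₁ ^ 2 + 1))
    linarith
  · refine hdbar.trans ?_
    have h1 : l / N ≤ s * l / N := by gcongr; exact le_mul_of_one_le_left hl.le hs'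
    have h2 : 0 ≤ hbar nT nS h * √(l / nT) := by positivity
    linarith
  · rw [hρ2, div_le_iff₀ hnT']
    exact le_trans (le_mul_of_one_le_left hl.le hs') hT
  · have h1 : l1norm δs ≤ hbar nT nS h := by
      rw [hδs, l1norm_neg, l1norm_smul, abs_of_nonneg (by positivity)]
      exact mul_le_mul_of_nonneg_left ((l1norm_sum_le _ _).trans hδh) (by positivity)
    have h2 : √(l / nT) * l1norm δs ≤ √(l / nT) * hbar nT nS h := by gcongr
    have h3 : 0 ≤ (s : ℝ) * l / N := by positivity
    linarith
  · rw [hρ2, div_le_iff₀ hnT', mul_comm]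
    exact hup u
  · linarith
  · have h1 : ‖u + (dl - δs)‖ ≤ (C₁ * √(predSq (fun i : Fin nT => x 0 i) (u + (dl - δs)))
        + C₂ * √l * l1norm (u + (dl - δs))) / √nT := by
      rw [le_div_iff₀ (by positivity), mul_comm]; exact hfinal
    refine h1.trans ?_
    rw [add_div, Real.sqrt_div' _ hnT'.le, hlT, mul_div_assoc]
    have h2 : C₂ * (√(l / nT) * √nT) * l1norm (u + (dl - δs)) / √nT
        = C₂ * √(l / nT) * l1norm (u + (dl - δs)) := by
      field_simp
    rw [h2]
    have := l1norm_add_le u (dl - δs)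
    gcongr

end Deterministic

/-! ### Maurey's empirical method: from sparse sums to all vectors. -/

section Maurey

/-- Maurey's empirical method for quadratic forms: nonnegativity at all sums of `m` atoms passes
to an averaged inequality at the barycentre `∑ w i • V i` of the atoms. -/
theorem nonneg_average_of_nonneg_sums {ι E : Type*} [Fintype ι] [AddCommGroup E] [Module ℝ E]
    (Q : E →ₗ[ℝ] E →ₗ[ℝ] ℝ) (hQ : ∀ v w, Q v w = Q w v) (w : ι → ℝ) (hw : ∀ i, 0 ≤ w i)
    (hw1 : ∑ i, w i = 1) (V : ι → E) (m : ℕ) (z : E)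
    (h : ∀ f : Fin m → ι, 0 ≤ Q (z + ∑ i, V (f i)) (z + ∑ i, V (f i))) :
    0 ≤ Q z z + 2 * m * Q z (∑ i, w i • V i)
      + m * (m - 1) * Q (∑ i, w i • V i) (∑ i, w i • V i) + m * ∑ i, w i * Q (V i) (V i) := by
  -- The quantity to be bounded is the mean of `Q y y` at `y = z +` a sum of `m` independent atoms
  -- drawn with law `w`. The induction fixes the first atom, moves it into `z`, and averages.
  induction m generalizing z with
  | zero => simpa using h Fin.elim0
  | succ m ih =>
    set v := ∑ i, w i • V i with hv
    have h1 : ∀ i, 0 ≤ w i * (Q (z + V i) (z + V i) + 2 * m * Q (z + V i) v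
        + m * (m - 1) * Q v v + m * ∑ i, w i * Q (V i) (V i)) := fun i => by
      refine mul_nonneg (hw i) (ih (z + V i) fun f => ?_)
      have := h (Fin.cons i f)
      rw [Fin.sum_univ_succ] at this
      simpa only [Fin.cons_zero, Fin.cons_succ, ← add_assoc] using this
    have h2 := Finset.sum_nonneg fun i (_ : i ∈ Finset.univ) => h1 i
    have hlin : ∀ y, ∑ i, w i * Q y (V i) = Q y v := fun y => by simp [hv, map_sum]
    have hlin' : ∑ i, w i * Q (V i) v = Q v v := by
      rw [← hlin v]; exact Finset.sum_congr rfl fun i _ => by rw [hQ]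
    set S := ∑ i, w i * Q (V i) (V i) with hS
    have h3 : ∑ i, w i * (Q (z + V i) (z + V i) + 2 * m * Q (z + V i) v
        + m * (m - 1) * Q v v + m * S)
        = Q z z + 2 * Q z v + S + 2 * m * (Q z v + Q v v) + m * (m - 1) * Q v v + m * S := by
      have e : ∀ i, w i * (Q (z + V i) (z + V i) + 2 * m * Q (z + V i) v
          + m * (m - 1) * Q v v + m * S)
          = w i * (Q z z + 2 * m * Q z v + m * (m - 1) * Q v v + m * S)
            + 2 * (w i * Q z (V i)) + w i * Q (V i) (V i) + 2 * m * (w i * Q (V i) v) := by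
        intro i
        simp only [map_add, LinearMap.add_apply]
        rw [hQ (V i) z]
        ring
      rw [Finset.sum_congr rfl fun i _ => e i]
      simp only [Finset.sum_add_distrib, ← Finset.mul_sum, ← Finset.sum_mul, hw1, hlin, hlin', ← hS]
      ring
    rw [h3] at h2
    push_cast
    linarith

variable {p n : ℕ}

/-- A signed vector of the standard basis. -/
noncomputable def signedBasis (a : Fin p × Bool) : EuclideanSpace ℝ (Fin p) :=
  (if a.2 then (1 : ℝ) else -1) • EuclideanSpace.single a.1 1

/-- The sums of `m` signed basis vectors. -/
noncomputable def netPoint {m : ℕ} (f : Fin m → Fin p × Bool) : EuclideanSpace ℝ (Fin p) :=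
  ∑ i, signedBasis (f i)

theorem norm_signedBasis (a : Fin p × Bool) : ‖signedBasis a‖ = 1 := by
  unfold signedBasis
  rw [norm_smul]
  split_ifs <;> simp

theorem predSq_signedBasis (x : Fin n → EuclideanSpace ℝ (Fin p)) (a : Fin p × Bool) :
    predSq x (signedBasis a) = ∑ i, x i a.1 ^ 2 := by
  unfold signedBasis
  rw [predSq_smul]
  split_ifs <;> simp [predSq, EuclideanSpace.inner_single_right]

/-- The symmetric bilinear form `s ⟨x v, x w⟩ + t ⟨v, w⟩`. -/
noncomputable def gramForm (x : Fin n → EuclideanSpace ℝ (Fin p)) (s t : ℝ) :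
    EuclideanSpace ℝ (Fin p) →ₗ[ℝ] EuclideanSpace ℝ (Fin p) →ₗ[ℝ] ℝ :=
  LinearMap.mk₂ ℝ (fun v w => s * ∑ i, inner ℝ (x i) v * inner ℝ (x i) w + t * inner ℝ v w)
    (fun v v' w => by
      simp only [inner_add_right, inner_add_left, add_mul, Finset.sum_add_distrib]; ring)
    (fun c v w => by
      simp only [inner_smul_right, real_inner_smul_left, mul_assoc, ← Finset.mul_sum, smul_eq_mul]
      ring)
    (fun v w w' => by
      simp only [inner_add_right, mul_add, Finset.sum_add_distrib]; ring)
    (fun c v w => by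
      simp only [inner_smul_right, mul_left_comm _ c, ← Finset.mul_sum, smul_eq_mul]; ring)

theorem gramForm_symm (x : Fin n → EuclideanSpace ℝ (Fin p)) (s t : ℝ)
    (v w : EuclideanSpace ℝ (Fin p)) : gramForm x s t v w = gramForm x s t w v := by
  simp [gramForm, real_inner_comm, mul_comm]

theorem gramForm_self (x : Fin n → EuclideanSpace ℝ (Fin p)) (s t : ℝ)
    (v : EuclideanSpace ℝ (Fin p)) : gramForm x s t v v = s * predSq x v + t * ‖v‖ ^ 2 := by
  simp [gramForm, predSq, sq]

/-- A lower bound for a quadratic form on the sums of `m` signed basis vectors extends to all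
vectors, up to a multiple of the squared `ℓ₁` norm. -/
theorem gramForm_self_ge_of_netPoint {m : ℕ} (hm : 2 ≤ m)
    (x : Fin n → EuclideanSpace ℝ (Fin p)) {s t U : ℝ}
    (h : ∀ f : Fin m → Fin p × Bool, 0 ≤ s * predSq x (netPoint f) + t * ‖netPoint f‖ ^ 2)
    (hU : ∀ a, s * predSq x (signedBasis a) + t ≤ U) (v : EuclideanSpace ℝ (Fin p)) :
    0 ≤ (m - 1) * (s * predSq x v + t * ‖v‖ ^ 2) + U * l1norm v ^ 2 := by
  have hm' : (2 : ℝ) ≤ m := by exact_mod_cast hm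
  rcases (l1norm_nonneg v).eq_or_lt with hv | hv
  · have hv0 : v = 0 := norm_le_zero_iff.1 ((norm_le_l1norm v).trans hv.ge)
    simp [hv0, predSq]
  set L := l1norm v with hL
  -- `v / ‖v‖₁` is the barycentre of signed basis vectors with weights `|v j| / ‖v‖₁`.
  set V : Fin p → EuclideanSpace ℝ (Fin p) := fun j => signedBasis (j, decide (0 ≤ v j)) with hV
  have hsum : ∑ j, (|v j| / L) • V j = L⁻¹ • v := by
    have e : ∀ j, (|v j| / L) • V j = L⁻¹ • EuclideanSpace.single j (v j) := fun j => by
      have h1 : |v j| • V j = EuclideanSpace.single j (v j) := by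
        simp only [hV, signedBasis, smul_smul]
        ext i
        by_cases h0 : 0 ≤ v j
        · simp [h0, abs_of_nonneg]
        · simp [h0, abs_of_neg (not_le.1 h0)]
      rw [← h1, smul_smul, div_eq_inv_mul]
    rw [Finset.sum_congr rfl fun j _ => e j, ← Finset.smul_sum]
    congr 1
    ext i
    simp [Pi.single_apply]
  have hw1 : ∑ j, |v j| / L = 1 := by
    rw [← Finset.sum_div]; exact div_self hv.ne'
  have key := nonneg_average_of_nonneg_sums (gramForm x s t) (gramForm_symm x s t)
    (fun j => |v j| / L) (fun j => by positivity) hw1 V m 0 fun f => by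
      rw [zero_add, gramForm_self]
      exact h fun i => (f i, decide (0 ≤ v (f i)))
  rw [hsum] at key
  simp only [gramForm_self, map_zero, LinearMap.zero_apply, mul_zero, zero_add, predSq_smul,
    norm_smul, mul_pow, hV, norm_signedBasis, one_pow, mul_one] at key
  have hUs : ∑ j, |v j| / L * (s * predSq x (signedBasis (j, decide (0 ≤ v j))) + t) ≤ U := by
    calc _ ≤ ∑ j, |v j| / L * U := Finset.sum_le_sum fun j _ =>
          mul_le_mul_of_nonneg_left (hU _) (by positivity)
      _ = U := by rw [← Finset.sum_mul, hw1, one_mul]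
  have h1 := mul_le_mul_of_nonneg_left hUs (by linarith : (0 : ℝ) ≤ m)
  have h2 : 0 ≤ m / L ^ 2 * ((m - 1) * (s * predSq x v + t * ‖v‖ ^ 2) + U * L ^ 2) := by
    have e : (m : ℝ) / L ^ 2 * ((m - 1) * (s * predSq x v + t * ‖v‖ ^ 2) + U * L ^ 2)
        = m * (m - 1) * (s * (L⁻¹ ^ 2 * predSq x v) + t * (‖L⁻¹‖ ^ 2 * ‖v‖ ^ 2)) + m * U := by
      rw [Real.norm_of_nonneg (by positivity)]
      field_simp
    rw [e]
    linarith
  exact nonneg_of_mul_nonneg_right h2 (by positivity)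

/-- Maurey's method for the form `predSq - θ ‖·‖²`; its diagonal term is at most a squared column
norm. -/
theorem predSq_ge_of_netPoint {m : ℕ} (hm : 2 ≤ m) (x : Fin n → EuclideanSpace ℝ (Fin p))
    {θ U : ℝ} (hθ : 0 ≤ θ)
    (h : ∀ f : Fin m → Fin p × Bool, θ * ‖netPoint f‖ ^ 2 ≤ predSq x (netPoint f))
    (hU : ∀ j, ∑ i, x i j ^ 2 ≤ U) (v : EuclideanSpace ℝ (Fin p)) :
    (m - 1) * (θ * ‖v‖ ^ 2) ≤ (m - 1) * predSq x v + U * l1norm v ^ 2 := by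
  have := gramForm_self_ge_of_netPoint hm x (s := 1) (t := -θ) (U := U)
    (fun f => by linarith [h f]) (fun a => by rw [predSq_signedBasis]; linarith [hU a.1]) v
  linarith

/-- Here the form is `τ ‖·‖² - predSq`. Its diagonal term is at most `τ`, so no prior bound on the
columns is needed. -/
theorem predSq_le_of_netPoint {m : ℕ} (hm : 2 ≤ m) (x : Fin n → EuclideanSpace ℝ (Fin p))
    {τ : ℝ} (h : ∀ f : Fin m → Fin p × Bool, predSq x (netPoint f) ≤ τ * ‖netPoint f‖ ^ 2)
    (v : EuclideanSpace ℝ (Fin p)) :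
    (m - 1) * predSq x v ≤ τ * ((m - 1) * ‖v‖ ^ 2 + l1norm v ^ 2) := by
  have := gramForm_self_ge_of_netPoint hm x (s := -1) (t := τ) (U := τ)
    (fun f => by linarith [h f]) (fun a => by linarith [predSq_nonneg x (signedBasis a)]) v
  linarith

end Maurey

/-! ### Tail bounds for sums of squares of sub-Gaussian variables. -/

section SubGaussian

variable {Ω : Type*} [MeasurableSpace Ω] {μ : Measure Ω}

theorem lintegral_exp_sq_div_four_gaussianReal :
    ∫⁻ g, ENNReal.ofReal (Real.exp (g ^ 2 / 4)) ∂(gaussianReal 0 1) = ENNReal.ofReal √2 := by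
  rw [gaussianReal_of_var_ne_zero 0 one_ne_zero,
    lintegral_withDensity_eq_lintegral_mul _ (measurable_gaussianPDF 0 1) (by fun_prop)]
  have h : ∀ g : ℝ, (gaussianPDF 0 1 * fun g : ℝ => ENNReal.ofReal (Real.exp (g ^ 2 / 4))) g
      = ENNReal.ofReal ((√(2 * Real.pi))⁻¹ * Real.exp (-(1 / 4) * g ^ 2)) := by
    intro g
    rw [Pi.mul_apply, gaussianPDF, ← ENNReal.ofReal_mul (gaussianPDFReal_nonneg _ _ _),
      gaussianPDFReal, mul_assoc, ← Real.exp_add]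
    congr 3
    · simp
    · simp; ring
  simp_rw [h]
  rw [← ofReal_integral_eq_lintegral_ofReal
    ((integrable_exp_neg_mul_sq (by norm_num)).const_mul _)
    (Filter.Eventually.of_forall fun g => by positivity), integral_const_mul, integral_gaussian]
  congr 1
  rw [← Real.sqrt_inv, ← Real.sqrt_mul (by positivity)]
  congr 1
  field_simp
  norm_num

/-- Gaussian linearisation: `exp (t y²)` is the mean of `exp (√(2 t) y g)` over a standard Gaussian
`g`. After Tonelli the sub-Gaussian bound leaves `exp (t v g²) ≤ exp (g² / 4)`, of mean √2. -/
theorem lintegral_exp_mul_sq_le [SFinite μ] {Y : Ω → ℝ} {v : ℝ≥0} (hY : Measurable Y)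
    (h : HasSubgaussianMGF Y v μ) {t : ℝ} (ht : 0 ≤ t) (htv : 4 * (t * v) ≤ 1) :
    ∫⁻ ω, ENNReal.ofReal (Real.exp (t * Y ω ^ 2)) ∂μ ≤ ENNReal.ofReal √2 := by
  have hid : ∀ y : ℝ, ENNReal.ofReal (Real.exp (t * y ^ 2))
      = ∫⁻ g, ENNReal.ofReal (Real.exp (√(2 * t) * y * g)) ∂(gaussianReal 0 1) := by
    intro y
    have h1 := congrFun (mgf_fun_id_gaussianReal (μ := 0) (v := 1)) (√(2 * t) * y)
    rw [mgf] at h1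
    rw [← ofReal_integral_eq_lintegral_ofReal (integrable_exp_mul_gaussianReal _)
      (Filter.Eventually.of_forall fun g => by positivity), h1]
    congr 2
    rw [mul_pow, Real.sq_sqrt (by positivity)]
    simp; ring
  simp_rw [hid]
  rw [lintegral_lintegral_swap (by fun_prop)]
  calc ∫⁻ g, ∫⁻ ω, ENNReal.ofReal (Real.exp (√(2 * t) * Y ω * g)) ∂μ ∂(gaussianReal 0 1)
      ≤ ∫⁻ g, ENNReal.ofReal (Real.exp (g ^ 2 / 4)) ∂(gaussianReal 0 1) := by
        refine lintegral_mono fun g => ?_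
        have e : ∀ ω, √(2 * t) * Y ω * g = √(2 * t) * g * Y ω := fun ω => by ring
        simp_rw [e]
        rw [← ofReal_integral_eq_lintegral_ofReal (h.integrable_exp_mul _)
          (Filter.Eventually.of_forall fun ω => by positivity)]
        refine ENNReal.ofReal_le_ofReal ((h.mgf_le _).trans (Real.exp_le_exp.2 ?_))
        rw [mul_pow, Real.sq_sqrt (by positivity)]
        nlinarith [mul_le_mul_of_nonneg_right htv (sq_nonneg g)]
    _ = ENNReal.ofReal √2 := lintegral_exp_sq_div_four_gaussianReal

theorem integrable_exp_mul_sq [SFinite μ] {Y : Ω → ℝ} {v : ℝ≥0} (hY : Measurable Y)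
    (h : HasSubgaussianMGF Y v μ) {t : ℝ} (ht : 0 ≤ t) (htv : 4 * (t * v) ≤ 1) :
    Integrable (fun ω => Real.exp (t * Y ω ^ 2)) μ :=
  (lintegral_ofReal_ne_top_iff_integrable (by fun_prop)
    (Filter.Eventually.of_forall fun ω => by positivity)).1
    ((lintegral_exp_mul_sq_le hY h ht htv).trans_lt ENNReal.ofReal_lt_top).ne

theorem integral_exp_mul_sq_le [SFinite μ] {Y : Ω → ℝ} {v : ℝ≥0} (hY : Measurable Y)
    (h : HasSubgaussianMGF Y v μ) {t : ℝ} (ht : 0 ≤ t) (htv : 4 * (t * v) ≤ 1) :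
    ∫ ω, Real.exp (t * Y ω ^ 2) ∂μ ≤ 2 := by
  rw [integral_eq_lintegral_of_nonneg_ae (Filter.Eventually.of_forall fun ω => by positivity)
    (by fun_prop)]
  refine (ENNReal.toReal_mono ENNReal.ofReal_ne_top (lintegral_exp_mul_sq_le hY h ht htv)).trans ?_
  rw [ENNReal.toReal_ofReal (by positivity), Real.sqrt_le_left (by norm_num)]
  norm_num

/-- `y² / 2 ≤ exp y` at `y = Y² / (4 V)` reduces the fourth moment to the exponential moment of the
square. -/
theorem integral_sq_sq_le [SFinite μ] {Y : Ω → ℝ} {v : ℝ≥0} (hY : Measurable Y)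
    (h : HasSubgaussianMGF Y v μ) {V : ℝ} (hV : 0 < V) (hvV : v ≤ V) :
    Integrable (fun ω => (Y ω ^ 2) ^ 2) μ ∧ ∫ ω, (Y ω ^ 2) ^ 2 ∂μ ≤ 64 * V ^ 2 := by
  have htv : 4 * (1 / (4 * V) * v) ≤ 1 := by
    rw [show 4 * (1 / (4 * V) * (v : ℝ)) = v / V by field_simp, div_le_one hV]; exact hvV
  have hint := (integrable_exp_mul_sq hY h (by positivity) htv).const_mul (32 * V ^ 2)
  have hle : ∀ ω, (Y ω ^ 2) ^ 2 ≤ 32 * V ^ 2 * Real.exp (1 / (4 * V) * Y ω ^ 2) := by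
    intro ω
    have h1 := Real.quadratic_le_exp_of_nonneg (x := 1 / (4 * V) * Y ω ^ 2) (by positivity)
    have h2 : (1 / (4 * V) * Y ω ^ 2) ^ 2 / 2 ≤ Real.exp (1 / (4 * V) * Y ω ^ 2) := by
      have : 0 ≤ 1 / (4 * V) * Y ω ^ 2 := by positivity
      linarith
    have h3 : (Y ω ^ 2) ^ 2 = 32 * V ^ 2 * ((1 / (4 * V) * Y ω ^ 2) ^ 2 / 2) := by
      field_simp; ring
    rw [h3]
    gcongr
  have hint' : Integrable (fun ω => (Y ω ^ 2) ^ 2) μ :=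
    hint.mono' (by fun_prop) (Filter.Eventually.of_forall fun ω => by
      rw [Real.norm_of_nonneg (by positivity)]; exact hle ω)
  refine ⟨hint', (integral_mono hint' hint hle).trans ?_⟩
  rw [integral_const_mul]
  have := integral_exp_mul_sq_le hY h (by positivity) htv
  nlinarith [sq_nonneg V]

variable [IsProbabilityMeasure μ]

/-- Lower tail of a sum of independent nonnegative variables with bounded second moments. -/
theorem measureReal_sum_le_le_exp {n : ℕ} {Y : Fin n → Ω → ℝ} (hY : ∀ i, Measurable (Y i))
    (hind : iIndepFun Y μ) (h0 : ∀ i ω, 0 ≤ Y i ω) {a M : ℝ} (ha : 0 < a) (hM : 0 < M)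
    (h1 : ∀ i, a ≤ ∫ ω, Y i ω ∂μ) (hint : ∀ i, Integrable (fun ω => Y i ω ^ 2) μ)
    (h2 : ∀ i, ∫ ω, Y i ω ^ 2 ∂μ ≤ M) :
    μ.real {ω | ∑ i, Y i ω ≤ n * (a / 2)} ≤ Real.exp (-(a ^ 2 / (8 * M)) * n) := by
  -- The minimizer of the Chernoff exponent `-t a / 2 + t² M / 2`.
  set t := a / (2 * M) with ht
  have ht0 : 0 ≤ t := by positivity
  have hexpint : ∀ i, Integrable (fun ω => Real.exp (-t * Y i ω)) μ := fun i =>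
    Integrable.of_bound (C := 1) (by fun_prop) (Filter.Eventually.of_forall fun ω => by
      rw [Real.norm_of_nonneg (by positivity), Real.exp_le_one_iff]
      nlinarith [h0 i ω])
  have hint1 : ∀ i, Integrable (Y i) μ := fun i =>
    ((memLp_two_iff_integrable_sq (hY i).aestronglyMeasurable).2 (hint i)).integrable
      (by norm_num)
  have hmgf : ∀ i, mgf (Y i) μ (-t) ≤ Real.exp (-(t * a) + t ^ 2 * M / 2) := by
    intro i
    -- For `x ≥ 0`, `exp (-x) ≤ 1 / (1 + x + x²/2) ≤ 1 - x + x²/2`, since the product of the two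
    -- quadratics is `1 + x⁴/4`.
    have hpt : ∀ ω, Real.exp (-t * Y i ω) ≤ 1 - t * Y i ω + t ^ 2 / 2 * Y i ω ^ 2 := by
      intro ω
      have hx : 0 ≤ t * Y i ω := mul_nonneg ht0 (h0 i ω)
      have hq := Real.quadratic_le_exp_of_nonneg hx
      have hpos : 0 < 1 + t * Y i ω + (t * Y i ω) ^ 2 / 2 := by positivity
      rw [neg_mul, Real.exp_neg]
      refine (inv_anti₀ hpos hq).trans ?_
      rw [inv_eq_one_div, div_le_iff₀ hpos]
      nlinarith [pow_nonneg hx 4]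
    have hI1 : Integrable (fun ω => 1 - t * Y i ω) μ :=
      (integrable_const _).sub ((hint1 i).const_mul _)
    have hI2 : Integrable (fun ω => t ^ 2 / 2 * Y i ω ^ 2) μ := (hint i).const_mul _
    have hI : Integrable (fun ω => 1 - t * Y i ω + t ^ 2 / 2 * Y i ω ^ 2) μ := hI1.add hI2
    have h3 : mgf (Y i) μ (-t) ≤ 1 - t * ∫ ω, Y i ω ∂μ + t ^ 2 / 2 * ∫ ω, Y i ω ^ 2 ∂μ := by
      refine (integral_mono (hexpint i) hI hpt).trans (le_of_eq ?_)
      rw [integral_add hI1 hI2, integral_sub (integrable_const _) ((hint1 i).const_mul _),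
        integral_const_mul, integral_const_mul]
      simp
    have h4 := Real.add_one_le_exp (-(t * a) + t ^ 2 * M / 2)
    have h5 := mul_le_mul_of_nonneg_left (h1 i) ht0
    have h6 := mul_le_mul_of_nonneg_left (h2 i) (by positivity : 0 ≤ t ^ 2 / 2)
    linarith
  have hsum := measure_le_le_exp_mul_mgf (μ := μ) (X := ∑ i, Y i) (t := -t) (n * (a / 2))
    (by linarith) (hind.integrable_exp_mul_sum hY fun i _ => hexpint i)
  rw [hind.mgf_sum hY] at hsum
  simp only [Finset.sum_apply] at hsum
  refine hsum.trans ?_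
  have hprod : ∏ i, mgf (Y i) μ (-t) ≤ Real.exp (n * (-(t * a) + t ^ 2 * M / 2)) := by
    rw [Real.exp_nat_mul]
    refine (Finset.prod_le_prod (fun i _ => mgf_nonneg) fun i _ => hmgf i).trans ?_
    simp
  calc Real.exp (-(-t) * (n * (a / 2))) * ∏ i, mgf (Y i) μ (-t)
      ≤ Real.exp (-(-t) * (n * (a / 2))) * Real.exp (n * (-(t * a) + t ^ 2 * M / 2)) := by
        gcongr
    _ = Real.exp (-(a ^ 2 / (8 * M)) * n) := by
        rw [← Real.exp_add]
        congr 1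
        rw [ht]; field_simp; ring

/-- Upper tail of a sum of independent variables with bounded exponential moments. -/
theorem measureReal_sum_ge_le_exp {n : ℕ} {Y : Fin n → Ω → ℝ} (hY : ∀ i, Measurable (Y i))
    (hind : iIndepFun Y μ) {t : ℝ} (ht : 0 ≤ t)
    (hint : ∀ i, Integrable (fun ω => Real.exp (t * Y i ω)) μ)
    (h2 : ∀ i, ∫ ω, Real.exp (t * Y i ω) ∂μ ≤ 2) (b : ℝ) :
    μ.real {ω | n * b ≤ ∑ i, Y i ω} ≤ Real.exp (-(t * b - 1) * n) := by
  have hsum := measure_ge_le_exp_mul_mgf (μ := μ) (X := ∑ i, Y i) (t := t) (n * b) ht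
    (hind.integrable_exp_mul_sum hY fun i _ => hint i)
  rw [hind.mgf_sum hY] at hsum
  simp only [Finset.sum_apply] at hsum
  refine hsum.trans ?_
  have h2e : (2 : ℝ) ≤ Real.exp 1 := by linarith [Real.add_one_le_exp (1 : ℝ)]
  have hprod : ∏ i, mgf (Y i) μ t ≤ Real.exp (n * 1) := by
    rw [Real.exp_nat_mul]
    refine (Finset.prod_le_prod (fun i _ => mgf_nonneg) fun i _ => (h2 i).trans h2e).trans ?_
    simp
  calc Real.exp (-t * (n * b)) * ∏ i, mgf (Y i) μ t
      ≤ Real.exp (-t * (n * b)) * Real.exp (n * 1) := by gcongr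
    _ = Real.exp (-(t * b - 1) * n) := by
        rw [← Real.exp_add]
        congr 1
        ring

end SubGaussian

theorem sqrt_add_le_add_sqrt {a b : ℝ} (ha : 0 ≤ a) (hb : 0 ≤ b) : √(a + b) ≤ √a + √b :=
  Real.sqrt_le_iff.2 ⟨by positivity, by
    nlinarith [Real.sq_sqrt ha, Real.sq_sqrt hb, mul_nonneg (Real.sqrt_nonneg a) (Real.sqrt_nonneg b)]⟩

/-! ### Restricted eigenvalue bounds for sub-Gaussian designs. -/

section Design

variable {p n : ℕ}

/-- Restricted eigenvalue conditions on a design: a lower and an upper bound for the prediction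
norm, both up to a multiple of the `ℓ₁` norm. -/
def DesignRegular (C₁ C₂ C₄ l : ℝ) (x : Fin n → EuclideanSpace ℝ (Fin p)) : Prop :=
  (∀ v, √n * ‖v‖ ≤ C₁ * √(predSq x v) + C₂ * √l * l1norm v) ∧
    ∀ v, predSq x v ≤ n * (C₄ * (‖v‖ ^ 2 + l / n * l1norm v ^ 2))

/-- Closedness makes regularity a measurable event, on which the noise bounds are conditioned. -/
theorem isClosed_designRegular (C₁ C₂ C₄ l : ℝ) :
    IsClosed {x : Fin n → EuclideanSpace ℝ (Fin p) | DesignRegular C₁ C₂ C₄ l x} := by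
  have h : ∀ v : EuclideanSpace ℝ (Fin p), Continuous
      fun x : Fin n → EuclideanSpace ℝ (Fin p) => predSq x v := fun v => by
    unfold predSq; fun_prop
  simp only [DesignRegular, Set.ofPred_and, Set.ofPred_forall]
  refine (isClosed_iInter fun v => isClosed_le continuous_const ?_).inter
    (isClosed_iInter fun v => isClosed_le (h v) continuous_const)
  exact (continuous_const.mul (h v).sqrt).add continuous_const

variable {Ω : Type*} [MeasurableSpace Ω] {μ : Measure Ω} [IsProbabilityMeasure μ]

/-- The squares are nonnegative, so their second and fourth root moments suffice: a mean at least
`‖v‖² / c` and a second moment of the square at most `64 (V ‖v‖²)²`. The ratio `a² / (8 M)` does not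
depend on `v`. -/
theorem measureReal_predSq_lt_le {X : Fin n → Ω → EuclideanSpace ℝ (Fin p)} {κ : ℝ≥0} {c V : ℝ}
    (hX : ∀ i, Measurable (X i)) (hind : iIndepFun X μ) (hc : 0 < c) (hV : 0 < V) (hκ : κ ≤ V)
    (hsub : ∀ i (u : EuclideanSpace ℝ (Fin p)),
      HasSubgaussianMGF (fun ω => inner ℝ u (X i ω)) (κ * ‖u‖₊ ^ 2) μ)
    (hmom : ∀ i (u : EuclideanSpace ℝ (Fin p)),
      1 / c * ‖u‖ ^ 2 ≤ ∫ ω, inner ℝ u (X i ω) ^ 2 ∂μ) (v : EuclideanSpace ℝ (Fin p)) :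
    μ.real {ω | predSq (fun i => X i ω) v < n * (1 / (2 * c)) * ‖v‖ ^ 2}
      ≤ Real.exp (-(1 / (512 * c ^ 2 * V ^ 2)) * n) := by
  rcases eq_or_ne v 0 with rfl | hv
  · have : {ω | predSq (fun i => X i ω) 0 < n * (1 / (2 * c)) * ‖(0 : EuclideanSpace ℝ (Fin p))‖ ^ 2}
        = ∅ := by ext; simp [predSq]
    rw [this, measureReal_empty]
    positivity
  have hv' : 0 < ‖v‖ := norm_pos_iff.2 hv
  have hm : ∀ i, Measurable fun ω => inner ℝ v (X i ω) := fun i => (hX i).const_inner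
  have hκv : ((κ * ‖v‖₊ ^ 2 : ℝ≥0) : ℝ) ≤ V * ‖v‖ ^ 2 := by
    push_cast
    gcongr
  have hmain := measureReal_sum_le_le_exp (μ := μ) (Y := fun i ω => inner ℝ v (X i ω) ^ 2)
    (fun i => (hm i).pow_const 2)
    (hind.comp (fun _ y => inner ℝ v y ^ 2) fun _ => by fun_prop)
    (fun i ω => sq_nonneg _) (a := 1 / c * ‖v‖ ^ 2) (M := 64 * (V * ‖v‖ ^ 2) ^ 2)
    (by positivity) (by positivity) (fun i => hmom i v)
    (fun i => (integral_sq_sq_le (hm i) (hsub i v) (by positivity) hκv).1)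
    (fun i => (integral_sq_sq_le (hm i) (hsub i v) (by positivity) hκv).2)
  refine (measureReal_mono ?_).trans (hmain.trans (le_of_eq ?_))
  · intro ω hω
    simp only [Set.mem_ofPred_eq, predSq, real_inner_comm v] at hω ⊢
    refine hω.le.trans (le_of_eq ?_)
    field_simp
  · congr 2
    field_simp
    norm_num

/-- At `t = 1 / (4 V ‖v‖²)` each square has exponential moment at most `2 ≤ e`, which accounts for
the `-1` in the rate. -/
theorem measureReal_predSq_gt_le {X : Fin n → Ω → EuclideanSpace ℝ (Fin p)} {κ : ℝ≥0} {V : ℝ}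
    (hX : ∀ i, Measurable (X i)) (hind : iIndepFun X μ) (hV : 0 < V) (hκ : κ ≤ V)
    (hsub : ∀ i (u : EuclideanSpace ℝ (Fin p)),
      HasSubgaussianMGF (fun ω => inner ℝ u (X i ω)) (κ * ‖u‖₊ ^ 2) μ)
    (τ : ℝ) (v : EuclideanSpace ℝ (Fin p)) :
    μ.real {ω | n * τ * ‖v‖ ^ 2 < predSq (fun i => X i ω) v}
      ≤ Real.exp (-(τ / (4 * V) - 1) * n) := by
  rcases eq_or_ne v 0 with rfl | hv
  · have : {ω | n * τ * ‖(0 : EuclideanSpace ℝ (Fin p))‖ ^ 2 < predSq (fun i => X i ω) 0}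
        = ∅ := by ext; simp [predSq]
    rw [this, measureReal_empty]
    positivity
  have hv' : 0 < ‖v‖ := norm_pos_iff.2 hv
  have hm : ∀ i, Measurable fun ω => inner ℝ v (X i ω) := fun i => (hX i).const_inner
  have htv : 4 * (1 / (4 * (V * ‖v‖ ^ 2)) * ((κ * ‖v‖₊ ^ 2 : ℝ≥0) : ℝ)) ≤ 1 := by
    have hκv : ((κ * ‖v‖₊ ^ 2 : ℝ≥0) : ℝ) ≤ V * ‖v‖ ^ 2 := by
      push_cast
      gcongr
    have hpos : 0 < V * ‖v‖ ^ 2 := by positivity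
    rw [show 4 * (1 / (4 * (V * ‖v‖ ^ 2)) * ((κ * ‖v‖₊ ^ 2 : ℝ≥0) : ℝ))
      = ((κ * ‖v‖₊ ^ 2 : ℝ≥0) : ℝ) / (V * ‖v‖ ^ 2) by field_simp, div_le_one hpos]
    exact hκv
  have hmain := measureReal_sum_ge_le_exp (μ := μ) (Y := fun i ω => inner ℝ v (X i ω) ^ 2)
    (fun i => (hm i).pow_const 2)
    (hind.comp (fun _ y => inner ℝ v y ^ 2) fun _ => by fun_prop)
    (t := 1 / (4 * (V * ‖v‖ ^ 2))) (by positivity)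
    (fun i => integrable_exp_mul_sq (hm i) (hsub i v) (by positivity) htv)
    (fun i => integral_exp_mul_sq_le (hm i) (hsub i v) (by positivity) htv) (τ * ‖v‖ ^ 2)
  refine (measureReal_mono ?_).trans (hmain.trans (le_of_eq ?_))
  · intro ω hω
    simp only [Set.mem_ofPred_eq, predSq, real_inner_comm v] at hω ⊢
    rw [← mul_assoc]
    exact hω.le
  · congr 3
    field_simp

theorem card_netPoint_le (hp : 2 ≤ p) (m : ℕ) :
    (Fintype.card (Fin m → Fin p × Bool) : ℝ) ≤ Real.exp (2 * m * Real.log p) := by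
  have hp' : (2 : ℝ) ≤ p := by exact_mod_cast hp
  have h1 : Real.exp (2 * m * Real.log p) = ((p : ℝ) * p) ^ m := by
    rw [mul_assoc, mul_left_comm, Real.exp_nat_mul, two_mul, Real.exp_add,
      Real.exp_log (by linarith)]
  rw [h1]
  simp only [Fintype.card_pi, Fintype.card_prod, Fintype.card_fin, Fintype.card_bool,
    Finset.prod_const, Finset.card_univ]
  push_cast
  gcongr

/-- A finite union bound over the sums of signed basis vectors. -/
theorem measureReal_exists_netPoint_le (hp : 2 ≤ p) {m : ℕ} {r : ℝ}
    (P : Ω → EuclideanSpace ℝ (Fin p) → Prop) (h : ∀ v, μ.real {ω | P ω v} ≤ Real.exp r) :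
    μ.real {ω | ∃ f : Fin m → Fin p × Bool, P ω (netPoint f)}
      ≤ Real.exp (2 * m * Real.log p + r) := by
  have : {ω | ∃ f : Fin m → Fin p × Bool, P ω (netPoint f)}
      = ⋃ f : Fin m → Fin p × Bool, {ω | P ω (netPoint f)} := by ext; simp
  rw [this]
  refine (measureReal_iUnion_fintype_le _).trans ?_
  calc ∑ f : Fin m → Fin p × Bool, μ.real {ω | P ω (netPoint f)}
      ≤ ∑ _f : Fin m → Fin p × Bool, Real.exp r := Finset.sum_le_sum fun f _ => h _
    _ ≤ Real.exp (2 * m * Real.log p) * Real.exp r := by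
      rw [Finset.sum_const, nsmul_eq_mul, Finset.card_univ]
      gcongr
      exact card_netPoint_le hp m
    _ = Real.exp (2 * m * Real.log p + r) := (Real.exp_add _ _).symm

/-- Test at a basis vector, which has both norms equal to 1. The column bound serves the lower
restricted eigenvalue inequality and the variances of the scores. -/
theorem sum_sq_le_of_predSq_le {C₄ l CT : ℝ} {x : Fin n → EuclideanSpace ℝ (Fin p)}
    (hC₄ : 0 ≤ C₄) (hn : 0 < n) (hl : l ≤ CT * n)
    (hx : ∀ v, predSq x v ≤ n * (C₄ * (‖v‖ ^ 2 + l / n * l1norm v ^ 2))) (j : Fin p) :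
    ∑ i, x i j ^ 2 ≤ n * (C₄ * (1 + CT)) := by
  have hn' : (0 : ℝ) < n := by exact_mod_cast hn
  have h1 := hx (signedBasis (j, true))
  rw [predSq_signedBasis, norm_signedBasis] at h1
  have h2 : l1norm (signedBasis (j, true)) = 1 := by
    simp [signedBasis, l1norm, apply_ite abs]
  rw [h2, one_pow, mul_one] at h1
  refine h1.trans ?_
  have : l / n ≤ CT := by rw [div_le_iff₀ hn']; exact hl
  gcongr

/-- Sub-Gaussian designs with independent rows are regular with exponentially high probability. -/
theorem exists_measureReal_not_designRegular_le {c V CT : ℝ} (hc : 0 < c) (hV : 0 < V)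
    (hCT : 0 < CT) :
    ∃ C₁ C₂ C₄ a : ℝ, 0 < C₁ ∧ 0 < C₂ ∧ 0 < C₄ ∧ 0 < a ∧
      ∀ (Ω : Type*) [MeasurableSpace Ω] (μ : Measure Ω) [IsProbabilityMeasure μ] (n p : ℕ)
        (X : Fin n → Ω → EuclideanSpace ℝ (Fin p)) (κ : ℝ≥0),
      (∀ i, Measurable (X i)) → iIndepFun X μ → κ ≤ V →
      (∀ i (u : EuclideanSpace ℝ (Fin p)),
        HasSubgaussianMGF (fun ω => inner ℝ u (X i ω)) (κ * ‖u‖₊ ^ 2) μ) →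
      (∀ i (u : EuclideanSpace ℝ (Fin p)),
        1 / c * ‖u‖ ^ 2 ≤ ∫ ω, inner ℝ u (X i ω) ^ 2 ∂μ) →
      2 ≤ p → 0 < n → Real.log p ≤ CT * n →
      μ.real {ω | ¬ DesignRegular C₁ C₂ C₄ (Real.log p) fun i => X i ω} ≤ 2 * Real.exp (-a * n) := by
  -- `cl` is the lower-tail rate for one vector. `τ` makes the upper-tail rate `4 CT + 3`, which
  -- beats the net entropy `2 mu l ≤ 4 l + 2 n` with `n` to spare. `CU` bounds the columns. The two
  -- terms of `D₂` serve `ml ≥ 2` and `ml < 2`.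
  set cl := 1 / (512 * c ^ 2 * V ^ 2) with hcl
  have hcl0 : 0 < cl := by positivity
  set τ := 4 * V * (4 * CT + 4) with hτ
  have hτ0 : 0 < τ := by positivity
  set CU := τ * (1 + CT) with hCU
  have hCU0 : 0 < CU := by positivity
  set D₂ := 24 * c * CU / cl + 8 / cl with hD₂
  have hD₂0 : 0 < D₂ := by positivity
  refine ⟨√(2 * c), √D₂, τ, min (cl / 2) 1, by positivity, by positivity, hτ0,
    lt_min (by positivity) one_pos, ?_⟩
  intro Ω _ μ _ n p X κ hX hind hκ hsub hmom hp hn hlog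
  have hn' : (0 : ℝ) < n := by exact_mod_cast hn
  have hl : 0 < Real.log p := Real.log_pos (by exact_mod_cast hp)
  set l := Real.log p with hl_def
  -- the upper bound
  obtain ⟨mu, hmu⟩ : ∃ mu : ℕ, mu = 2 + ⌊(n : ℝ) / l⌋₊ := ⟨_, rfl⟩
  -- So many atoms that Maurey's remainder `‖v‖₁² / (mu - 1)` is at most `(l / n) ‖v‖₁²`.
  have hmu1 : (n : ℝ) / l ≤ mu - 1 := by
    rw [hmu]; push_cast; linarith [Nat.lt_floor_add_one ((n : ℝ) / l)]
  have hmu2 : mu * l ≤ 2 * l + n := by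
    have h1 : (⌊(n : ℝ) / l⌋₊ : ℝ) ≤ n / l := Nat.floor_le (by positivity)
    have h2 : (⌊(n : ℝ) / l⌋₊ : ℝ) * l ≤ n := by rwa [le_div_iff₀ hl] at h1
    rw [hmu]; push_cast; linarith
  have hup := measureReal_exists_netPoint_le (μ := μ) hp (m := mu)
    (fun ω v => n * τ * ‖v‖ ^ 2 < predSq (fun i => X i ω) v)
    (fun v => measureReal_predSq_gt_le hX hind hV hκ hsub τ v)
  have hup' : μ.real {ω | ∃ f : Fin mu → Fin p × Bool,
      n * τ * ‖netPoint f‖ ^ 2 < predSq (fun i => X i ω) (netPoint f)}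
      ≤ Real.exp (-min (cl / 2) 1 * n) := by
    refine hup.trans (Real.exp_le_exp.2 ?_)
    have h1 : τ / (4 * V) = 4 * CT + 4 := by rw [hτ]; field_simp
    rw [h1]
    have h2 : min (cl / 2) 1 * n ≤ 1 * n := by gcongr; exact min_le_right _ _
    linarith
  have hupper : ∀ ω, (¬ ∃ f : Fin mu → Fin p × Bool,
      n * τ * ‖netPoint f‖ ^ 2 < predSq (fun i => X i ω) (netPoint f)) →
      ∀ v, predSq (fun i => X i ω) v ≤ n * (τ * (‖v‖ ^ 2 + l / n * l1norm v ^ 2)) := by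
    intro ω hω v
    push Not at hω
    have h1 := predSq_le_of_netPoint (m := mu) (by omega) (fun i => X i ω) hω v
    have h2 : 0 < (mu : ℝ) - 1 := lt_of_lt_of_le (by positivity) hmu1
    have h3 : l1norm v ^ 2 ≤ (mu - 1) * (l / n * l1norm v ^ 2) := by
      have : 1 ≤ ((mu : ℝ) - 1) * (l / n) := by
        rw [← mul_div_assoc, le_div_iff₀ hn', one_mul]
        rwa [div_le_iff₀ hl] at hmu1
      calc l1norm v ^ 2 = 1 * l1norm v ^ 2 := (one_mul _).symm
        _ ≤ ((mu : ℝ) - 1) * (l / n) * l1norm v ^ 2 := by gcongr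
        _ = _ := by ring
    refine le_of_mul_le_mul_left (h1.trans ?_) h2
    calc n * τ * ((mu - 1) * ‖v‖ ^ 2 + l1norm v ^ 2)
        ≤ n * τ * ((mu - 1) * ‖v‖ ^ 2 + (mu - 1) * (l / n * l1norm v ^ 2)) := by gcongr
      _ = (mu - 1) * (n * (τ * (‖v‖ ^ 2 + l / n * l1norm v ^ 2))) := by ring
  -- passage from squares to square roots
  have hsqrt : ∀ ω v, n * ‖v‖ ^ 2 ≤ 2 * c * predSq (fun i => X i ω) v + D₂ * (l * l1norm v ^ 2) →
      √n * ‖v‖ ≤ √(2 * c) * √(predSq (fun i => X i ω) v) + √D₂ * √l * l1norm v := by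
    intro ω v h
    have hP := predSq_nonneg (fun i => X i ω) v
    have e1 : √n * ‖v‖ = √(n * ‖v‖ ^ 2) := by
      rw [Real.sqrt_mul hn'.le, Real.sqrt_sq (norm_nonneg v)]
    have e2 : √D₂ * √l * l1norm v = √(D₂ * (l * l1norm v ^ 2)) := by
      rw [Real.sqrt_mul hD₂0.le, Real.sqrt_mul hl.le, Real.sqrt_sq (l1norm_nonneg v)]; ring
    rw [e1, e2, ← Real.sqrt_mul (by positivity)]
    exact (Real.sqrt_le_sqrt h).trans (sqrt_add_le_add_sqrt (by positivity) (by positivity))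
  -- the lower bound
  obtain ⟨ml, hml⟩ : ∃ ml : ℕ, ml = ⌊cl * n / (4 * l)⌋₊ := ⟨_, rfl⟩
  have hml1 : cl * n / (4 * l) < ml + 1 := by rw [hml]; exact Nat.lt_floor_add_one _
  have hml2 : ml * l ≤ cl * n / 4 := by
    have h1 : (ml : ℝ) ≤ cl * n / (4 * l) := by rw [hml]; exact Nat.floor_le (by positivity)
    rw [le_div_iff₀ (by positivity)] at h1
    linarith
  -- The entropy `2 ml l ≤ cl n / 2` takes half of the lower-tail rate. If fewer than two atoms are
  -- allowed, then `n ≤ D₂ l` and the lower bound is trivial from `‖v‖ ≤ ‖v‖₁`.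
  by_cases hm2 : 2 ≤ ml
  · have hlow := measureReal_exists_netPoint_le (μ := μ) hp (m := ml)
      (fun ω v => predSq (fun i => X i ω) v < n * (1 / (2 * c)) * ‖v‖ ^ 2)
      (fun v => measureReal_predSq_lt_le hX hind hc hV hκ hsub hmom v)
    have hlow' : μ.real {ω | ∃ f : Fin ml → Fin p × Bool,
        predSq (fun i => X i ω) (netPoint f) < n * (1 / (2 * c)) * ‖netPoint f‖ ^ 2}
        ≤ Real.exp (-min (cl / 2) 1 * n) := by
      refine hlow.trans (Real.exp_le_exp.2 ?_)
      rw [← hcl]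
      have h2 : min (cl / 2) 1 * n ≤ cl / 2 * n := by gcongr; exact min_le_left _ _
      linarith
    refine (measureReal_mono (s₂ := {ω | ∃ f : Fin mu → Fin p × Bool,
      n * τ * ‖netPoint f‖ ^ 2 < predSq (fun i => X i ω) (netPoint f)} ∪
      {ω | ∃ f : Fin ml → Fin p × Bool,
        predSq (fun i => X i ω) (netPoint f) < n * (1 / (2 * c)) * ‖netPoint f‖ ^ 2}) ?_).trans
      ((measureReal_union_le _ _).trans (by linarith))
    intro ω hω
    by_contra hcon
    rw [Set.mem_union, not_or] at hcon
    have hu := hupper ω hcon.1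
    refine hω ⟨fun v => hsqrt ω v ?_, hu⟩
    have h2 := hcon.2
    simp only [Set.mem_ofPred_eq, not_exists, not_lt] at h2
    have hcol : ∀ j, ∑ i, X i ω j ^ 2 ≤ n * CU := fun j =>
      sum_sq_le_of_predSq_le hτ0.le hn hlog hu j
    have h3 := predSq_ge_of_netPoint hm2 (fun i => X i ω) (by positivity) h2 hcol v
    have hm2' : (2 : ℝ) ≤ ml := by exact_mod_cast hm2
    have h4 : cl * n / 12 ≤ (ml - 1) * l := by
      rw [div_lt_iff₀ (by positivity)] at hml1
      nlinarith
    have h5 : 2 * c * (n * CU) ≤ (ml - 1) * (D₂ * l) := by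
      have h6 : 24 * c * CU / cl ≤ D₂ := by rw [hD₂]; linarith [show 0 < 8 / cl by positivity]
      calc 2 * c * (n * CU) = 24 * c * CU / cl * (cl * n / 12) := by field_simp; norm_num
        _ ≤ D₂ * ((ml - 1) * l) := by gcongr
        _ = _ := by ring
    have h7 := mul_le_mul_of_nonneg_right h5 (sq_nonneg (l1norm v))
    have h8 := mul_le_mul_of_nonneg_left h3 (by positivity : 0 ≤ 2 * c)
    have h9 : 2 * c * ((ml - 1) * (n * (1 / (2 * c)) * ‖v‖ ^ 2)) = (ml - 1) * (n * ‖v‖ ^ 2) := by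
      field_simp
    rw [h9] at h8
    refine le_of_mul_le_mul_left ?_ (by linarith : (0 : ℝ) < ml - 1)
    linarith
  · refine (measureReal_mono (s₂ := {ω | ∃ f : Fin mu → Fin p × Bool,
      n * τ * ‖netPoint f‖ ^ 2 < predSq (fun i => X i ω) (netPoint f)}) ?_).trans
      (hup'.trans (by linarith [Real.exp_pos (-min (cl / 2) 1 * n)]))
    intro ω hω
    by_contra hcon
    refine hω ⟨fun v => hsqrt ω v ?_, hupper ω hcon⟩
    have hm2' : (ml : ℝ) + 1 ≤ 2 := by exact_mod_cast (by omega : ml + 1 ≤ 2)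
    have h1 : (n : ℝ) ≤ D₂ * l := by
      have h2 : cl * n ≤ 8 * l := by
        have := hml1.le.trans hm2'
        rw [div_le_iff₀ (by positivity)] at this
        linarith
      have h3 : 8 / cl ≤ D₂ := by rw [hD₂]; linarith [show 0 < 24 * c * CU / cl by positivity]
      calc (n : ℝ) = cl * n / cl := by field_simp
        _ ≤ 8 * l / cl := by gcongr
        _ = 8 / cl * l := by ring
        _ ≤ D₂ * l := by gcongr
    have h2 : ‖v‖ ^ 2 ≤ l1norm v ^ 2 := by gcongr; exact norm_le_l1norm v
    have h3 : 0 ≤ 2 * c * predSq (fun i => X i ω) v := by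
      have := predSq_nonneg (fun i => X i ω) v
      positivity
    have h4 : n * ‖v‖ ^ 2 ≤ D₂ * l * l1norm v ^ 2 := by gcongr
    linarith

end Design

/-! ### From the spectrum of the covariance to second moments of marginals. -/

section SecondMoment

variable {Ω : Type*} [MeasurableSpace Ω] {μ : Measure Ω} {p : ℕ}

/-- A symmetric matrix whose spectrum is bounded below by `r` has quadratic form at least
`r ‖u‖²`. -/
theorem le_sum_mul_of_spectrum_ge {A : Matrix (Fin p) (Fin p) ℝ} (hA : A.IsHermitian) {r : ℝ}
    (hr : ∀ t ∈ spectrum ℝ A, r ≤ t) (u : EuclideanSpace ℝ (Fin p)) :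
    r * ‖u‖ ^ 2 ≤ ∑ j, ∑ l, u j * u l * A j l := by
  have hB : (A - algebraMap ℝ _ r).IsHermitian := by
    refine hA.sub ?_
    rw [Algebra.algebraMap_eq_smul_one]
    exact Matrix.isHermitian_one.smul (IsSelfAdjoint.all r)
  have hpos : (A - algebraMap ℝ _ r).PosSemidef := by
    rw [hB.posSemidef_iff_eigenvalues_nonneg]
    intro i
    have h1 := hB.eigenvalues_mem_spectrum_real i
    rw [← spectrum.sub_singleton_eq] at h1
    obtain ⟨t, ht, q, hq, h2⟩ := h1
    have h3 := hr t ht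
    rw [Set.mem_singleton_iff] at hq
    simp only [Pi.zero_apply]
    rw [← h2, hq]
    linarith
  have h := hpos.dotProduct_mulVec_nonneg u.ofLp
  have e : star u.ofLp ⬝ᵥ (A - algebraMap ℝ _ r).mulVec u.ofLp
      = (∑ j, ∑ l, u j * u l * A j l) - r * ‖u‖ ^ 2 := by
    rw [Matrix.sub_mulVec, dotProduct_sub, Algebra.algebraMap_eq_smul_one, Matrix.smul_mulVec,
      Matrix.one_mulVec, EuclideanSpace.real_norm_sq_eq]
    simp only [dotProduct, Matrix.mulVec, Finset.mul_sum, Pi.star_apply, star_trivial,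
      Pi.smul_apply, smul_eq_mul]
    congr 1
    · exact Finset.sum_congr rfl fun j _ => Finset.sum_congr rfl fun l _ => by ring
    · exact Finset.sum_congr rfl fun j _ => by ring
  linarith

theorem le_integral_inner_sq [IsProbabilityMeasure μ] {Y : Ω → EuclideanSpace ℝ (Fin p)} {κ : ℝ≥0}
    {A : Matrix (Fin p) (Fin p) ℝ} {r : ℝ}
    (hmean : ∀ j, ∫ ω, Y ω j ∂μ = 0)
    (hcov : ∀ j l, cov[fun ω => Y ω j, fun ω => Y ω l; μ] = A j l)
    (hr : ∀ t ∈ spectrum ℝ A, r ≤ t)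
    (hsub : ∀ u : EuclideanSpace ℝ (Fin p),
      HasSubgaussianMGF (fun ω => inner ℝ u (Y ω)) (κ * ‖u‖₊ ^ 2) μ)
    (u : EuclideanSpace ℝ (Fin p)) : r * ‖u‖ ^ 2 ≤ ∫ ω, inner ℝ u (Y ω) ^ 2 ∂μ := by
  have hA : A.IsHermitian := by
    ext j l
    rw [Matrix.conjTranspose_apply, star_trivial, ← hcov, ← hcov, covariance_comm]
  have hmem : ∀ j, MemLp (fun ω => Y ω j) 2 μ := fun j => by
    have := (hsub (EuclideanSpace.single j 1)).memLp 2
    simpa [EuclideanSpace.inner_single_left] using this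
  have hint : ∀ j l, Integrable (fun ω => Y ω j * Y ω l) μ := fun j l =>
    (hmem j).integrable_mul (hmem l)
  refine (le_sum_mul_of_spectrum_ge hA hr u).trans (le_of_eq ?_)
  have e : ∀ ω, inner ℝ u (Y ω) ^ 2 = ∑ j, ∑ l, u j * u l * (Y ω j * Y ω l) := fun ω => by
    rw [PiLp.inner_apply, sq, Finset.sum_mul_sum]
    refine Finset.sum_congr rfl fun j _ => Finset.sum_congr rfl fun l _ => ?_
    simp only [RCLike.inner_apply, conj_trivial]
    ring
  simp_rw [e]
  rw [integral_finsetSum _ fun j _ => integrable_finsetSum _ fun l _ => (hint j l).const_mul _]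
  refine Finset.sum_congr rfl fun j _ => ?_
  rw [integral_finsetSum _ fun l _ => (hint j l).const_mul _]
  refine Finset.sum_congr rfl fun l _ => ?_
  rw [integral_const_mul, ← hcov, covariance_eq_sub (hmem j) (hmem l), hmean, hmean]
  simp

end SecondMoment

/-! ### Conditioning on the designs, and measurability of projections. -/

section Conditioning

variable {Ω A B : Type*} [MeasurableSpace Ω] [MeasurableSpace A] [MeasurableSpace B]
  {μ : Measure Ω} [IsProbabilityMeasure μ]

/-- If `Y` and `Z` are independent, a bound on the probability of `(y, Z) ∈ S` for each fixed
`y ∈ G` carries over to `(Y, Z) ∈ S` on the event `Y ∈ G`. -/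
theorem measureReal_le_of_indepFun {Y : Ω → A} {Z : Ω → B} (hY : Measurable Y) (hZ : Measurable Z)
    (hind : IndepFun Y Z μ) {G : Set A} {S : Set (A × B)} (hG : MeasurableSet G)
    (hS : MeasurableSet S) {δ : ℝ} (hδ : 0 ≤ δ) (h : ∀ y ∈ G, μ.real {ω | (y, Z ω) ∈ S} ≤ δ) :
    μ.real {ω | Y ω ∈ G ∧ (Y ω, Z ω) ∈ S} ≤ δ := by
  have hmap := (indepFun_iff_map_prod_eq_prod_map_map hY.aemeasurable hZ.aemeasurable).1 hind
  have hT : MeasurableSet (G ×ˢ Set.univ ∩ S) := (hG.prod MeasurableSet.univ).inter hS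
  have hpm := Measure.isProbabilityMeasure_map (μ := μ) hY.aemeasurable
  have hpm' := Measure.isProbabilityMeasure_map (μ := μ) hZ.aemeasurable
  have e : {ω | Y ω ∈ G ∧ (Y ω, Z ω) ∈ S} = (fun ω => (Y ω, Z ω)) ⁻¹' (G ×ˢ Set.univ ∩ S) := by
    ext; simp
  rw [measureReal_def, e, ← Measure.map_apply (hY.prodMk hZ) hT, hmap, Measure.prod_apply hT]
  refine ENNReal.toReal_le_of_le_ofReal hδ ?_
  calc ∫⁻ y, (μ.map Z) (Prod.mk y ⁻¹' (G ×ˢ Set.univ ∩ S)) ∂(μ.map Y)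
      ≤ ∫⁻ _, ENNReal.ofReal δ ∂(μ.map Y) := by
        refine lintegral_mono fun y => ?_
        by_cases hy : y ∈ G
        · have e2 : Prod.mk y ⁻¹' (G ×ˢ Set.univ ∩ S) = {z | (y, z) ∈ S} := by ext; simp [hy]
          have hm : MeasurableSet {z | (y, z) ∈ S} := measurable_prodMk_left hS
          rw [e2, Measure.map_apply hZ hm]
          exact (ENNReal.le_ofReal_iff_toReal_le (measure_ne_top _ _) hδ).2 (h y hy)
        · have e2 : Prod.mk y ⁻¹' (G ×ˢ Set.univ ∩ S) = ∅ := by ext; simp [hy]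
          rw [e2, measure_empty]
          exact zero_le
    _ = ENNReal.ofReal δ := by simp

end Conditioning

/-- The projection of a closed set along a σ-compact factor is a Borel set. -/
theorem measurableSet_image_fst_of_isClosed {A B : Type*} [TopologicalSpace A] [T2Space A]
    [MeasurableSpace A] [OpensMeasurableSpace A] [TopologicalSpace B] [SigmaCompactSpace (A × B)]
    {S : Set (A × B)} (hS : IsClosed S) : MeasurableSet {a | ∃ b, (a, b) ∈ S} := by
  have h1 : IsSigmaCompact S := by
    have := isSigmaCompact_univ (X := A × B)
    exact this.of_isClosed_subset hS (Set.subset_univ _)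
  obtain ⟨f, hf, hfS⟩ := h1.image continuous_fst
  have e : {a | ∃ b, (a, b) ∈ S} = ⋃ i, f i := by
    rw [hfS]; ext a; simp
  rw [e]
  exact MeasurableSet.iUnion fun i => (hf i).isClosed.measurableSet

/-! ### The lasso fit as an odd Lipschitz function of the score. -/

section LassoFit

variable {p n : ℕ}

/-- The product of the Gram matrix of the design with a vector. -/
noncomputable def gramMul (x : Fin n → EuclideanSpace ℝ (Fin p)) (d : EuclideanSpace ℝ (Fin p)) :
    EuclideanSpace ℝ (Fin p) :=
  score x fun i => inner ℝ (x i) d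

theorem inner_gramMul (x : Fin n → EuclideanSpace ℝ (Fin p)) (d v : EuclideanSpace ℝ (Fin p)) :
    inner ℝ (gramMul x d) v = ∑ i, inner ℝ (x i) d * inner ℝ (x i) v := by
  rw [gramMul, inner_score]

theorem inner_gramMul_self (x : Fin n → EuclideanSpace ℝ (Fin p))
    (d : EuclideanSpace ℝ (Fin p)) : inner ℝ (gramMul x d) d = predSq x d := by
  rw [inner_gramMul, predSq]
  exact Finset.sum_congr rfl fun i _ => by ring

theorem gramMul_sub (x : Fin n → EuclideanSpace ℝ (Fin p)) (d v : EuclideanSpace ℝ (Fin p)) :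
    gramMul x (d - v) = gramMul x d - gramMul x v := by
  simp only [gramMul, score, inner_sub_right, sub_smul, Finset.sum_sub_distrib]

theorem gramMul_neg (x : Fin n → EuclideanSpace ℝ (Fin p)) (d : EuclideanSpace ℝ (Fin p)) :
    gramMul x (-d) = -gramMul x d := by
  simp only [gramMul, score, inner_neg_right, neg_smul, Finset.sum_neg_distrib]

theorem gramMul_zero (x : Fin n → EuclideanSpace ℝ (Fin p)) : gramMul x 0 = 0 := by
  simp [gramMul, score]

theorem score_sub_inner (x : Fin n → EuclideanSpace ℝ (Fin p)) (e : Fin n → ℝ)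
    (d : EuclideanSpace ℝ (Fin p)) :
    (score x fun i => e i - inner ℝ (x i) d) = score x e - gramMul x d := by
  simp only [gramMul, score, sub_smul, Finset.sum_sub_distrib]

theorem continuous_gramMul (x : Fin n → EuclideanSpace ℝ (Fin p)) : Continuous (gramMul x) := by
  unfold gramMul score; fun_prop

theorem predSq_add (x : Fin n → EuclideanSpace ℝ (Fin p)) (d v : EuclideanSpace ℝ (Fin p)) :
    predSq x (d + v) = predSq x d + 2 * inner ℝ (gramMul x d) v + predSq x v := by
  rw [inner_gramMul, predSq, predSq, predSq, Finset.mul_sum, ← Finset.sum_add_distrib,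
    ← Finset.sum_add_distrib]
  exact Finset.sum_congr rfl fun i _ => by rw [inner_add_right]; ring

theorem gramMul_sq_le (x : Fin n → EuclideanSpace ℝ (Fin p)) (d : EuclideanSpace ℝ (Fin p))
    (j : Fin p) : gramMul x d j ^ 2 ≤ predSq x d * ∑ i, x i j ^ 2 := by
  rw [gramMul, score_apply, predSq]
  exact Finset.sum_mul_sq_le_sq_mul_sq _ _ _

/-- The variational inequality satisfied by the minimizers of
`½ predSq x d - ⟪z, d⟫ + L ‖d‖₁`. -/
def LassoOptimal (x : Fin n → EuclideanSpace ℝ (Fin p)) (L : ℝ)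
    (z d : EuclideanSpace ℝ (Fin p)) : Prop :=
  ∀ v, inner ℝ z v - inner ℝ (gramMul x d) v ≤ L * (l1norm (d + v) - l1norm d)

/-- The objective is coercive, so it has a minimizer `d`. Moving from `d` a fraction `t` of the way
to `d + v`, with convexity of the `ℓ₁` norm, gives the variational inequality up to `t * predSq x v
/ 2`, and `t` is arbitrarily small. -/
theorem exists_lassoOptimal (x : Fin n → EuclideanSpace ℝ (Fin p)) {m L : ℝ} (hm : 0 < m)
    (hL : 0 ≤ L) (hx : ∀ v, m * ‖v‖ ^ 2 ≤ predSq x v) (z : EuclideanSpace ℝ (Fin p)) :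
    ∃ d, LassoOptimal x L z d := by
  have hcont : Continuous fun d => predSq x d / 2 - inner ℝ z d + L * l1norm d := by
    have h1 : Continuous fun d => predSq x d := by unfold predSq; fun_prop
    have h2 := continuous_l1norm (p := p)
    fun_prop
  have hpt : ∀ d : EuclideanSpace ℝ (Fin p), 2 * ‖z‖ / m ≤ ‖d‖ →
      0 ≤ predSq x d / 2 - inner ℝ z d + L * l1norm d := fun d hd => by
    have h2 := real_inner_le_norm z d
    have h3 : 2 * ‖z‖ ≤ ‖d‖ * m := by rwa [div_le_iff₀ hm] at hd
    have h4 := mul_le_mul_of_nonneg_right h3 (norm_nonneg d)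
    have h5 := mul_nonneg hL (l1norm_nonneg d)
    linarith [hx d, sq (‖d‖)]
  have hzero : predSq x 0 / 2 - inner ℝ z 0 + L * l1norm (0 : EuclideanSpace ℝ (Fin p)) = 0 := by simp [predSq]
  have hev : ∀ᶠ d : EuclideanSpace ℝ (Fin p) in Filter.cocompact _,
      predSq x 0 / 2 - inner ℝ z 0 + L * l1norm (0 : EuclideanSpace ℝ (Fin p))
        ≤ predSq x d / 2 - inner ℝ z d + L * l1norm d := by
    rw [hzero]
    exact ((tendsto_norm_cocompact_atTop (E := EuclideanSpace ℝ (Fin p))).eventually_ge_atTop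
      (2 * ‖z‖ / m)).mono hpt
  obtain ⟨d, hd⟩ := hcont.exists_forall_le' 0 hev
  refine ⟨d, fun v => ?_⟩
  have hlim : ∀ t : ℝ, 0 < t → t ≤ 1 → inner ℝ z v - inner ℝ (gramMul x d) v
      ≤ L * (l1norm (d + v) - l1norm d) + t * (predSq x v / 2) := by
    intro t ht ht1
    have h1 := hd (d + t • v)
    have h2 : l1norm (d + t • v) ≤ (1 - t) * l1norm d + t * l1norm (d + v) := by
      have e : d + t • v = (1 - t) • d + t • (d + v) := by module
      rw [e]
      refine (l1norm_add_le _ _).trans ?_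
      rw [l1norm_smul, l1norm_smul, abs_of_nonneg (by linarith), abs_of_pos ht]
    have h3 := mul_le_mul_of_nonneg_left h2 hL
    rw [predSq_add, predSq_smul, inner_smul_right, inner_add_right, inner_smul_right] at h1
    refine le_of_mul_le_mul_left ?_ ht
    linarith
  have hq := predSq_nonneg x v
  by_contra hcon
  push Not at hcon
  set gap := inner ℝ z v - inner ℝ (gramMul x d) v - L * (l1norm (d + v) - l1norm d) with hgap
  have hgap0 : 0 < gap := by linarith
  have h := hlim (min 1 (gap / (predSq x v + 1))) (by positivity) (min_le_left _ _)
  have h1 : min 1 (gap / (predSq x v + 1)) * (predSq x v / 2) ≤ gap / 2 := by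
    calc _ ≤ gap / (predSq x v + 1) * (predSq x v / 2) := by gcongr; exact min_le_right _ _
      _ = gap / 2 * (predSq x v / (predSq x v + 1)) := by ring
      _ ≤ gap / 2 * 1 := by gcongr; rw [div_le_one (by positivity)]; linarith
      _ = _ := mul_one _
  linarith

theorem LassoOptimal.neg {x : Fin n → EuclideanSpace ℝ (Fin p)} {L : ℝ}
    {z d : EuclideanSpace ℝ (Fin p)} (h : LassoOptimal x L z d) : LassoOptimal x L (-z) (-d) := by
  intro v
  have := h (-v)
  rw [inner_neg_right, inner_neg_right] at this
  rw [gramMul_neg, inner_neg_left, inner_neg_left, l1norm_neg,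
    show -d + v = -(d + -v) by abel, l1norm_neg]
  linarith

theorem lassoOptimal_zero (x : Fin n → EuclideanSpace ℝ (Fin p)) {L : ℝ} (hL : 0 ≤ L) :
    LassoOptimal x L 0 0 := by
  intro v
  have := mul_nonneg hL (l1norm_nonneg v)
  simpa [gramMul_zero] using this

/-- Test each variational inequality at the other solution and add: the penalties cancel. Uniqueness
and Lipschitz dependence on the score follow for well-conditioned designs. -/
theorem LassoOptimal.predSq_sub_le {x : Fin n → EuclideanSpace ℝ (Fin p)} {L : ℝ}
    {z z' d d' : EuclideanSpace ℝ (Fin p)} (h : LassoOptimal x L z d)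
    (h' : LassoOptimal x L z' d') : predSq x (d - d') ≤ inner ℝ (z - z') (d - d') := by
  have h1 := h (d' - d)
  have h2 := h' (d - d')
  rw [add_sub_cancel] at h1 h2
  rw [← neg_sub d d', inner_neg_right, inner_neg_right] at h1
  rw [← inner_gramMul_self, gramMul_sub, inner_sub_left, inner_sub_left]
  linarith

theorem LassoOptimal.norm_sub_le {x : Fin n → EuclideanSpace ℝ (Fin p)} {L m : ℝ}
    (hx : ∀ v, m * ‖v‖ ^ 2 ≤ predSq x v)
    {z z' d d' : EuclideanSpace ℝ (Fin p)} (h : LassoOptimal x L z d)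
    (h' : LassoOptimal x L z' d') : m * ‖d - d'‖ ≤ ‖z - z'‖ := by
  rcases (norm_nonneg (d - d')).eq_or_lt with h0 | h0
  · rw [← h0, mul_zero]; exact norm_nonneg _
  refine le_of_mul_le_mul_right ?_ h0
  have h1 := h.predSq_sub_le h'
  have h2 := real_inner_le_norm (z - z') (d - d')
  have h3 := hx (d - d')
  nlinarith

/-- For a well-conditioned design the lasso fit is a continuous and odd function of the
score, bounded by a multiple of it. -/
theorem exists_lassoFit (x : Fin n → EuclideanSpace ℝ (Fin p)) {m L : ℝ} (hm : 0 < m)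
    (hL : 0 ≤ L) (hx : ∀ v, m * ‖v‖ ^ 2 ≤ predSq x v) :
    ∃ D : EuclideanSpace ℝ (Fin p) → EuclideanSpace ℝ (Fin p), Continuous D ∧
      (∀ z, D (-z) = -D z) ∧ (∀ z, m * ‖D z‖ ≤ ‖z‖) ∧ (∀ z, m * predSq x (D z) ≤ ‖z‖ ^ 2) ∧
      ∀ z, LassoOptimal x L z (D z) := by
  choose D hD using exists_lassoOptimal x hm hL hx
  have hlip : ∀ z z', m * ‖D z - D z'‖ ≤ ‖z - z'‖ := fun z z' =>
    (hD z).norm_sub_le hx (hD z')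
  have hnorm : ∀ z, m * ‖D z‖ ≤ ‖z‖ := fun z => by
    simpa using (hD z).norm_sub_le hx (lassoOptimal_zero x hL)
  refine ⟨D, ?_, fun z => ?_, hnorm, fun z => ?_, hD⟩
  · refine LipschitzWith.continuous (K := Real.toNNReal (1 / m))
      (LipschitzWith.of_dist_le_mul fun z z' => ?_)
    rw [Real.coe_toNNReal _ (by positivity), dist_eq_norm, dist_eq_norm, one_div_mul_eq_div,
      le_div_iff₀ hm, mul_comm]
    exact hlip z z'
  -- Oddness is uniqueness: `D (-z)` and `-D z` both solve the problem at `-z`.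
  · have h := (hD (-z)).norm_sub_le hx (hD z).neg
    rw [sub_self, norm_zero] at h
    have h1 : ‖D (-z) - -D z‖ ≤ 0 := by
      by_contra hcon
      push Not at hcon
      have := mul_pos hm hcon
      linarith
    exact sub_eq_zero.1 (norm_le_zero_iff.1 h1)
  · have h1 := (hD z).predSq_sub_le (lassoOptimal_zero x hL)
    rw [sub_zero, sub_zero] at h1
    have h2 := real_inner_le_norm z (D z)
    calc m * predSq x (D z) ≤ m * (‖z‖ * ‖D z‖) := by gcongr; exact h1.trans h2
      _ = ‖z‖ * (m * ‖D z‖) := by ring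
      _ ≤ ‖z‖ * ‖z‖ := by gcongr; exact hnorm z
      _ = ‖z‖ ^ 2 := by ring

end LassoFit

/-! ### Gaussian noise: tails, truncated second moments, symmetry. -/

section Noise

variable {Ω : Type*} [MeasurableSpace Ω] {μ : Measure Ω} [IsProbabilityMeasure μ]

theorem hasSubgaussianMGF_of_map_eq_gaussianReal {Z : Ω → ℝ} {v : ℝ≥0} (hZ : Measurable Z)
    (h : μ.map Z = gaussianReal 0 v) : HasSubgaussianMGF Z v μ where
  integrable_exp_mul t := by
    have h1 := integrable_exp_mul_gaussianReal (μ := 0) (v := v) t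
    rw [← h] at h1
    exact (integrable_map_measure (by fun_prop) hZ.aemeasurable).1 h1
  mgf_le t := by
    rw [mgf_gaussianReal h]
    simp

/-- A weighted sum of independent centred Gaussian variables is sub-Gaussian. -/
theorem hasSubgaussianMGF_sum_mul {ι : Type*} [Fintype ι] {ξ : ι → Ω → ℝ} {σ V : ℝ}
    (hm : ∀ i, Measurable (ξ i))
    (hg : ∀ i, ∃ v : ℝ≥0, (v : ℝ) ≤ σ ^ 2 ∧ μ.map (ξ i) = gaussianReal 0 v)
    (hind : iIndepFun ξ μ) (a : ι → ℝ) (hV : σ ^ 2 * ∑ i, a i ^ 2 ≤ V) :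
    HasSubgaussianMGF (fun ω => ∑ i, ξ i ω * a i) V.toNNReal μ := by
  choose v hv hmap using hg
  have hV0 : 0 ≤ V := le_trans (by positivity) hV
  have h1 : ∀ i ∈ Finset.univ, HasSubgaussianMGF (fun ω => ξ i ω * a i)
      ((a i ^ 2).toNNReal * v i) μ := fun i _ => by
    rw [Real.toNNReal_of_nonneg (sq_nonneg (a i))]
    have := (hasSubgaussianMGF_of_map_eq_gaussianReal (hm i) (hmap i)).const_mul (a i)
    rw [show (fun ω => ξ i ω * a i) = fun ω => a i * ξ i ω from funext fun ω => mul_comm _ _]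
    exact this
  have h2 := HasSubgaussianMGF.sum_of_iIndepFun
    (hind.comp (fun i y => y * a i) fun i => by fun_prop) h1
  refine ⟨h2.integrable_exp_mul, fun t => (h2.mgf_le t).trans (Real.exp_le_exp.2 ?_)⟩
  gcongr
  rw [← NNReal.coe_le_coe, Real.coe_toNNReal _ hV0]
  refine le_trans ?_ hV
  rw [NNReal.coe_sum, Finset.mul_sum]
  refine Finset.sum_le_sum fun i _ => ?_
  rw [NNReal.coe_mul, Real.coe_toNNReal _ (sq_nonneg _), mul_comm]
  exact mul_le_mul_of_nonneg_right (hv i) (sq_nonneg _)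

theorem measureReal_lt_abs_le {Z : Ω → ℝ} {V : ℝ} (hV : 0 ≤ V)
    (h : HasSubgaussianMGF Z V.toNNReal μ) {θ : ℝ} (hθ : 0 ≤ θ) (τ : ℝ) :
    μ.real {ω | τ < |Z ω|} ≤ 2 * Real.exp (-(θ * τ) + θ ^ 2 * V / 2) := by
  have key : ∀ {Y : Ω → ℝ}, HasSubgaussianMGF Y V.toNNReal μ →
      μ.real {ω | τ ≤ Y ω} ≤ Real.exp (-(θ * τ) + θ ^ 2 * V / 2) := by
    intro Y hY
    refine (measure_ge_le_exp_mul_mgf τ hθ (hY.integrable_exp_mul θ)).trans ?_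
    rw [Real.exp_add, neg_mul]
    gcongr
    refine (hY.mgf_le θ).trans (le_of_eq ?_)
    rw [Real.coe_toNNReal _ hV]
    ring_nf
  refine (measureReal_mono (s₂ := {ω | τ ≤ Z ω} ∪ {ω | τ ≤ (-Z) ω}) ?_).trans
    ((measureReal_union_le _ _).trans ?_)
  · intro ω hω
    simp only [Set.mem_ofPred_eq, Set.mem_union, Pi.neg_apply] at hω ⊢
    rcases lt_abs.1 hω with h | h
    · exact Or.inl h.le
    · exact Or.inr h.le
  · linarith [key h, key h.neg]

/-- Beyond the threshold, `z² ≤ (2 / θ²) exp (θ |z|)` and `exp (θ |z|) ≤ exp (-θ τ) exp (2 θ |z|)`: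
doubling the exponent buys the small factor `exp (-θ τ)`. -/
theorem sq_indicator_le {θ : ℝ} (hθ : 0 < θ) (τ z : ℝ) :
    (if τ < |z| then z ^ 2 else 0)
      ≤ 2 / θ ^ 2 * Real.exp (-(θ * τ)) * (Real.exp (2 * θ * z) + Real.exp (-(2 * θ) * z)) := by
  split_ifs with h
  · have h1 : (θ * |z|) ^ 2 / 2 ≤ Real.exp (θ * |z|) := by
      have := Real.quadratic_le_exp_of_nonneg (x := θ * |z|) (by positivity)
      have : 0 ≤ θ * |z| := by positivity
      linarith
    have h2 : Real.exp (θ * |z|) ≤ Real.exp (-(θ * τ)) * Real.exp (2 * θ * |z|) := by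
      rw [← Real.exp_add]
      refine Real.exp_le_exp.2 ?_
      nlinarith
    have h3 : Real.exp (2 * θ * |z|) ≤ Real.exp (2 * θ * z) + Real.exp (-(2 * θ) * z) := by
      rcases abs_choice z with h | h <;> rw [h]
      · linarith [Real.exp_pos (-(2 * θ) * z)]
      · rw [mul_neg, neg_mul]; linarith [Real.exp_pos (2 * θ * z)]
    calc z ^ 2 = 2 / θ ^ 2 * ((θ * |z|) ^ 2 / 2) := by rw [mul_pow, sq_abs]; field_simp
      _ ≤ 2 / θ ^ 2 * (Real.exp (-(θ * τ)) * (Real.exp (2 * θ * z) + Real.exp (-(2 * θ) * z))) := by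
        gcongr
        exact h1.trans (h2.trans (by gcongr))
      _ = _ := by ring
  · positivity

theorem integral_sq_indicator_le {Z : Ω → ℝ} {V : ℝ} (hZ : Measurable Z) (hV : 0 ≤ V)
    (h : HasSubgaussianMGF Z V.toNNReal μ) {θ : ℝ} (hθ : 0 < θ) (τ : ℝ) :
    Integrable (fun ω => if τ < |Z ω| then Z ω ^ 2 else 0) μ ∧
      ∫ ω, (if τ < |Z ω| then Z ω ^ 2 else 0) ∂μ
        ≤ 4 / θ ^ 2 * Real.exp (-(θ * τ) + 2 * θ ^ 2 * V) := by
  have hint : Integrable (fun ω => 2 / θ ^ 2 * Real.exp (-(θ * τ)) *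
      (Real.exp (2 * θ * Z ω) + Real.exp (-(2 * θ) * Z ω))) μ :=
    ((h.integrable_exp_mul _).add (h.integrable_exp_mul _)).const_mul _
  have hmeas : Measurable fun ω => if τ < |Z ω| then Z ω ^ 2 else 0 :=
    Measurable.ite (measurableSet_lt measurable_const (by fun_prop)) (by fun_prop) measurable_const
  have hint' : Integrable (fun ω => if τ < |Z ω| then Z ω ^ 2 else 0) μ := by
    refine hint.mono' hmeas.aestronglyMeasurable (Filter.Eventually.of_forall fun ω => ?_)
    rw [Real.norm_of_nonneg (by positivity)]
    exact sq_indicator_le hθ τ (Z ω)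
  refine ⟨hint', (integral_mono hint' hint fun ω => sq_indicator_le hθ τ (Z ω)).trans ?_⟩
  rw [integral_const_mul, integral_add (h.integrable_exp_mul _) (h.integrable_exp_mul _)]
  have h1 := h.mgf_le (2 * θ)
  have h2 := h.mgf_le (-(2 * θ))
  rw [Real.coe_toNNReal _ hV] at h1 h2
  rw [mgf] at h1 h2
  have e1 : V * (2 * θ) ^ 2 / 2 = 2 * θ ^ 2 * V := by ring
  have e2 : V * (-(2 * θ)) ^ 2 / 2 = 2 * θ ^ 2 * V := by ring
  rw [e1] at h1
  rw [e2] at h2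
  calc _ ≤ 2 / θ ^ 2 * Real.exp (-(θ * τ)) *
        (Real.exp (2 * θ ^ 2 * V) + Real.exp (2 * θ ^ 2 * V)) := by gcongr
    _ = _ := by rw [Real.exp_add]; ring

/-- Odd functions of independent centred Gaussian variables have mean zero. -/
theorem integral_odd_eq_zero {ι : Type*} [Fintype ι] {ξ : ι → Ω → ℝ} (hm : ∀ i, Measurable (ξ i))
    (hg : ∀ i, ∃ v : ℝ≥0, μ.map (ξ i) = gaussianReal 0 v) (hind : iIndepFun ξ μ)
    {f : (ι → ℝ) → ℝ} (hf : Measurable f) (hodd : ∀ e, f (-e) = -f e) :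
    ∫ ω, f (fun i => ξ i ω) ∂μ = 0 := by
  choose v hmap using hg
  have hlaw : μ.map (fun ω i => ξ i ω) = Measure.pi fun i => gaussianReal 0 (v i) := by
    rw [(iIndepFun_iff_map_fun_eq_pi_map fun i => (hm i).aemeasurable).1 hind]
    simp_rw [hmap]
  have hneg : ∀ i, (gaussianReal 0 (v i)).IsNegInvariant := fun i =>
    ⟨by rw [Measure.neg]; exact (gaussianReal_map_neg).trans (by rw [neg_zero])⟩
  have h1 : ∫ ω, f (fun i => ξ i ω) ∂μ = ∫ e, f e ∂(Measure.pi fun i => gaussianReal 0 (v i)) := by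
    rw [← hlaw, integral_map (measurable_pi_lambda _ hm).aemeasurable hf.aestronglyMeasurable]
  have h2 := integral_neg_eq_self f (Measure.pi fun i => gaussianReal 0 (v i))
  simp_rw [hodd] at h2
  rw [integral_neg] at h2
  rw [h1]
  linarith

/-- Disjoint blocks of an independent family are independent. -/
theorem indepFun_blocks {κ : Type*} [Fintype κ] {ι : κ → Type*}
    [∀ k, Fintype (ι k)] {ξ : (k : κ) → ι k → Ω → ℝ} (hm : ∀ k i, Measurable (ξ k i))
    (hind : iIndepFun (fun (ki : (k : κ) × ι k) => ξ ki.1 ki.2) μ) {k k' : κ} (hk : k ≠ k') :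
    IndepFun (fun ω i => ξ k i ω) (fun ω i => ξ k' i ω) μ := by
  classical
  have h := hind.indepFun_finset (Finset.univ.filter fun ki : (k : κ) × ι k => ki.1 = k)
    (Finset.univ.filter fun ki : (k : κ) × ι k => ki.1 = k')
    (Finset.disjoint_filter.2 fun ki _ h1 h2 => hk (h1.symm.trans h2)) (fun ki => hm ki.1 ki.2)
  exact h.comp (φ := fun f i => f ⟨⟨k, i⟩, by simp⟩) (ψ := fun f i => f ⟨⟨k', i⟩, by simp⟩)
    (measurable_pi_lambda _ fun i => measurable_pi_apply _)
    (measurable_pi_lambda _ fun i => measurable_pi_apply _)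

/-- The second moment of a sum of centred, pairwise independent variables. -/
theorem integral_sum_sq_eq {ι : Type*} [Fintype ι] {W : ι → Ω → ℝ} (hW : ∀ k, MemLp (W k) 2 μ)
    (h0 : ∀ k, ∫ ω, W k ω ∂μ = 0) (hind : ∀ k k', k ≠ k' → IndepFun (W k) (W k') μ) :
    ∫ ω, (∑ k, W k ω) ^ 2 ∂μ = ∑ k, ∫ ω, W k ω ^ 2 ∂μ := by
  have h1 := IndepFun.variance_sum (s := Finset.univ) (fun k _ => hW k)
    (fun k _ k' _ h => hind k k' h)
  have hS : MemLp (∑ k, W k) 2 μ := memLp_finsetSum' _ fun k _ => hW k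
  have hS0 : ∫ ω, (∑ k, W k) ω ∂μ = 0 := by
    simp only [Finset.sum_apply]
    rw [integral_finsetSum _ fun k _ => (hW k).integrable (by norm_num)]
    simp [h0]
  rw [variance_of_integral_eq_zero hS.aestronglyMeasurable.aemeasurable hS0] at h1
  simp only [Finset.sum_apply] at h1
  rw [h1]
  exact Finset.sum_congr rfl fun k _ =>
    variance_of_integral_eq_zero (hW k).aestronglyMeasurable.aemeasurable (h0 k)

end Noise

/-! ### Excess of the scores over a threshold, and truncated fits. -/

section Excess

variable {p : ℕ}

/-- A bound for `‖z‖²` on the event that some entry of `z` exceeds the threshold `τ`. -/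
noncomputable def excess (τ : ℝ) (z : EuclideanSpace ℝ (Fin p)) : ℝ :=
  p * ∑ j, if τ < |z j| then z j ^ 2 else 0

theorem excess_nonneg (τ : ℝ) (z : EuclideanSpace ℝ (Fin p)) : 0 ≤ excess τ z :=
  mul_nonneg (Nat.cast_nonneg _) (Finset.sum_nonneg fun j _ => by positivity)

/-- The largest entry passes the threshold, and `‖z‖²` is at most `p` times its square. Being a sum
over single coordinates, `excess` has a mean that depends only on the marginals. -/
theorem norm_sq_le_excess {τ : ℝ} {z : EuclideanSpace ℝ (Fin p)} (h : ∃ j, τ < |z j|) :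
    ‖z‖ ^ 2 ≤ excess τ z := by
  obtain ⟨j₀, h₀⟩ := h
  obtain ⟨j, -, hj⟩ := Finset.exists_max_image Finset.univ (fun j => |z j|) ⟨j₀, Finset.mem_univ _⟩
  have hτ : τ < |z j| := h₀.trans_le (hj j₀ (Finset.mem_univ _))
  rw [EuclideanSpace.real_norm_sq_eq]
  calc ∑ i, z i ^ 2 ≤ ∑ _i : Fin p, z j ^ 2 :=
        Finset.sum_le_sum fun i hi => sq_le_sq.2 (hj i hi)
    _ = p * (if τ < |z j| then z j ^ 2 else 0) := by rw [if_pos hτ]; simp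
    _ ≤ excess τ z := by
      unfold excess
      gcongr
      exact Finset.single_le_sum (f := fun i => if τ < |z i| then z i ^ 2 else 0)
        (fun i _ => by positivity) (Finset.mem_univ j)

theorem sq_le_excess {τ : ℝ} (hτ : 0 ≤ τ) {z : EuclideanSpace ℝ (Fin p)} (h : ∃ j, τ < |z j|) :
    τ ^ 2 ≤ excess τ z := by
  refine le_trans ?_ (norm_sq_le_excess h)
  obtain ⟨j, hj⟩ := h
  have h1 : |z j| ≤ ‖z‖ := by simpa using PiLp.norm_apply_le z j
  exact pow_le_pow_left₀ hτ (hj.le.trans h1) 2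

theorem measurableSet_exists_lt (τ : ℝ) :
    MeasurableSet {z : EuclideanSpace ℝ (Fin p) | ∃ j, τ < |z j|} := by
  rw [Set.ofPred_exists]
  exact MeasurableSet.iUnion fun j => measurableSet_lt measurable_const (by fun_prop)

open Classical in
/-- The lasso fit of the noise where it exceeds the threshold, and `0` elsewhere. -/
theorem exists_truncatedLassoFit {n : ℕ} (x : Fin n → EuclideanSpace ℝ (Fin p)) {m L : ℝ}
    (hm : 0 < m) (hL : 0 ≤ L) (hx : ∀ v, m * ‖v‖ ^ 2 ≤ predSq x v) (τ : ℝ) :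
    ∃ D : EuclideanSpace ℝ (Fin p) → EuclideanSpace ℝ (Fin p), Measurable D ∧
      (∀ z, D (-z) = -D z) ∧ (∀ z, m ^ 2 * ‖D z‖ ^ 2 ≤ excess τ z) ∧
      (∀ z, m * predSq x (D z) ≤ excess τ z) ∧
      (∀ z, (∃ j, τ < |z j|) → LassoOptimal x L z (D z)) ∧
      ∀ z, (¬ ∃ j, τ < |z j|) → D z = 0 := by
  obtain ⟨D, hD, hodd, hnorm, hpred, hopt⟩ := exists_lassoFit x hm hL hx
  have hsymm : ∀ z : EuclideanSpace ℝ (Fin p), (∃ j, τ < |(-z) j|) ↔ ∃ j, τ < |z j| := by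
    intro z; simp
  refine ⟨fun z => if ∃ j, τ < |z j| then D z else 0,
    Measurable.ite (measurableSet_exists_lt τ) hD.measurable measurable_const,
    fun z => ?_, fun z => ?_, fun z => ?_, fun z h => ?_, fun z h => if_neg h⟩
  · simp only [hsymm]
    split_ifs
    · exact hodd z
    · exact neg_zero.symm
  · dsimp only
    split_ifs with h
    · rw [← mul_pow]
      exact (pow_le_pow_left₀ (by positivity) (hnorm z) 2).trans (norm_sq_le_excess h)
    · simpa using excess_nonneg τ z
  · dsimp only
    split_ifs with h
    · exact (hpred z).trans (norm_sq_le_excess h)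
    · simpa [predSq] using excess_nonneg τ z
  · dsimp only
    rw [if_pos h]
    exact hopt z

variable {Ω : Type*} [MeasurableSpace Ω] {μ : Measure Ω} [IsProbabilityMeasure μ]

theorem integral_excess_le {Z : Ω → EuclideanSpace ℝ (Fin p)} {V θ : ℝ} (hZ : Measurable Z)
    (hV : 0 ≤ V) (h : ∀ j, HasSubgaussianMGF (fun ω => Z ω j) V.toNNReal μ) (hθ : 0 < θ) (τ : ℝ) :
    Integrable (fun ω => excess τ (Z ω)) μ ∧ ∫ ω, excess τ (Z ω) ∂μ
      ≤ p ^ 2 * (4 / θ ^ 2) * Real.exp (-(θ * τ) + 2 * θ ^ 2 * V) := by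
  have h1 := fun j => integral_sq_indicator_le (Z := fun ω => Z ω j) (by fun_prop) hV (h j) hθ τ
  refine ⟨(integrable_finsetSum _ fun j _ => (h1 j).1).const_mul _, ?_⟩
  unfold excess
  rw [integral_const_mul, integral_finsetSum _ fun j _ => (h1 j).1]
  calc _ ≤ (p : ℝ) * ∑ _j : Fin p, 4 / θ ^ 2 * Real.exp (-(θ * τ) + 2 * θ ^ 2 * V) := by
        gcongr with j; exact (h1 j).2
    _ = _ := by simp; ring

/-- Markov's inequality for a sum of nonnegative variables. -/
theorem measureReal_sum_ge_le {ι : Type*} [Fintype ι] {W : ι → Ω → ℝ} {q T : ℝ}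
    (hW : ∀ k ω, 0 ≤ W k ω) (hint : ∀ k, Integrable (W k) μ) (hq : ∀ k, ∫ ω, W k ω ∂μ ≤ q)
    (hT : 0 < T) : μ.real {ω | T ≤ ∑ k, W k ω} ≤ Fintype.card ι * q / T := by
  rw [le_div_iff₀ hT, mul_comm]
  refine (mul_meas_ge_le_integral_of_nonneg
    (Filter.Eventually.of_forall fun ω => Finset.sum_nonneg fun k _ => hW k ω)
    (integrable_finsetSum _ fun k _ => hint k) T).trans ?_
  rw [integral_finsetSum _ fun k _ => hint k]
  calc _ ≤ ∑ _k : ι, q := Finset.sum_le_sum fun k _ => hq k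
    _ = _ := by simp

/-- Chebyshev's inequality for a sum of odd functions of the scores of independent tasks. -/
theorem measureReal_abs_sum_odd_gt_le {K n : ℕ} {x : Fin K → Fin n → EuclideanSpace ℝ (Fin p)}
    {ξ : Fin K → Fin n → Ω → ℝ} (hm : ∀ k i, Measurable (ξ k i))
    (hg : ∀ k i, ∃ v : ℝ≥0, μ.map (ξ k i) = gaussianReal 0 v)
    (hind : iIndepFun (fun (ki : (_ : Fin K) × Fin n) => ξ ki.1 ki.2) μ)
    {τ A Q T : ℝ} (hA : 0 ≤ A) (hT : 0 < T)
    (hint : ∀ k, Integrable (fun ω => excess τ (score (x k) fun i => ξ k i ω)) μ)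
    (hQ : ∀ k, ∫ ω, excess τ (score (x k) fun i => ξ k i ω) ∂μ ≤ Q)
    {g : Fin K → EuclideanSpace ℝ (Fin p) → ℝ} (hgm : ∀ k, Measurable (g k))
    (hodd : ∀ k z, g k (-z) = -g k z) (hle : ∀ k z, g k z ^ 2 ≤ A * excess τ z) :
    μ.real {ω | T < |∑ k, g k (score (x k) fun i => ξ k i ω)|} ≤ K * (A * Q) / T ^ 2 := by
  have hsm : ∀ k, Measurable fun e : Fin n → ℝ => g k (score (x k) e) := fun k =>
    (hgm k).comp (by unfold score; fun_prop)
  have hem : ∀ k, Measurable fun ω i => ξ k i ω := fun k => measurable_pi_lambda _ (hm k)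
  have hWm : ∀ k, Measurable fun ω => g k (score (x k) fun i => ξ k i ω) := fun k =>
    (hsm k).comp (hem k)
  have hsq : ∀ k, Integrable (fun ω => g k (score (x k) fun i => ξ k i ω) ^ 2) μ := fun k =>
    ((hint k).const_mul A).mono' ((hWm k).pow_const 2).aestronglyMeasurable
      (Filter.Eventually.of_forall fun ω => by
        rw [Real.norm_of_nonneg (sq_nonneg _)]; exact hle k _)
  have hmem : ∀ k, MemLp (fun ω => g k (score (x k) fun i => ξ k i ω)) 2 μ := fun k =>
    (memLp_two_iff_integrable_sq (hWm k).aestronglyMeasurable).2 (hsq k)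
  -- For a fixed design the score is linear in the noise, so the integrand is an odd function of a
  -- symmetric vector. Centring and independence keep the variance of the sum of order `K`, not
  -- `K²`.
  have hzero : ∀ k, ∫ ω, g k (score (x k) fun i => ξ k i ω) ∂μ = 0 := fun k => by
    have hk : iIndepFun (ξ k) μ :=
      hind.precomp (g := fun i => (⟨k, i⟩ : (_ : Fin K) × Fin n)) fun i j hij => by simpa using hij
    exact integral_odd_eq_zero (hm k) (hg k) hk (hsm k) fun e => by rw [score_neg, hodd]
  have hpair : ∀ k k', k ≠ k' → IndepFun (fun ω => g k (score (x k) fun i => ξ k i ω))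
      (fun ω => g k' (score (x k') fun i => ξ k' i ω)) μ := fun k k' h =>
    (indepFun_blocks hm hind h).comp (hsm k) (hsm k')
  have hsum := integral_sum_sq_eq hmem hzero hpair
  have hle2 : ∀ k, ∫ ω, g k (score (x k) fun i => ξ k i ω) ^ 2 ∂μ ≤ A * Q := fun k => by
    calc _ ≤ ∫ ω, A * excess τ (score (x k) fun i => ξ k i ω) ∂μ :=
          integral_mono (hsq k) ((hint k).const_mul A) fun ω => hle k _
      _ ≤ A * Q := by rw [integral_const_mul]; gcongr; exact hQ k
  have hS : MemLp (fun ω => ∑ k, g k (score (x k) fun i => ξ k i ω)) 2 μ :=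
    memLp_finsetSum _ fun k _ => hmem k
  have hT2 : 0 < T ^ 2 := by positivity
  rw [le_div_iff₀ hT2, mul_comm]
  refine (mul_le_mul_of_nonneg_left (measureReal_mono (s₂ := {ω | T ^ 2 ≤
    (∑ k, g k (score (x k) fun i => ξ k i ω)) ^ 2}) ?_) hT2.le).trans
    ((mul_meas_ge_le_integral_of_nonneg (Filter.Eventually.of_forall fun ω => sq_nonneg _)
      hS.integrable_sq (T ^ 2)).trans ?_)
  · intro ω hω
    simp only [Set.mem_ofPred_eq] at hω ⊢
    rw [← sq_abs (∑ k, g k _)]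
    exact pow_le_pow_left₀ hT.le hω.le 2
  · rw [hsum]
    calc _ ≤ ∑ _k : Fin K, A * Q := Finset.sum_le_sum fun k _ => hle2 k
      _ = _ := by simp

end Excess

/-! ### The noise event and its measurability. -/

section NoiseRegular

/-- The designs of all tasks. -/
abbrev Designs (p K nT nS : ℕ) : Type :=
  (k : Fin (K + 1)) → Fin (sampleSize nT nS k) → EuclideanSpace ℝ (Fin p)

/-- The errors of all tasks. -/
abbrev Errors (K nT nS : ℕ) : Type :=
  (k : Fin (K + 1)) → Fin (sampleSize nT nS k) → ℝ

variable {p K nT nS : ℕ}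

/-- The conditions on the noise under which the two-step estimator is accurate. The tasks in the
exceptional set `B` are those with a large score, and `d k` is a lasso fit of their noise. -/
def NoiseRegular (c₀ c₁ : ℝ)
    (x : Designs p K nT nS) (e : Errors K nT nS) : Prop :=
  ∃ (B : Finset (Fin K)) (d : Fin K → EuclideanSpace ℝ (Fin p)),
    10 * (p * B.card) ≤ K ∧
    (∀ k ∉ B, d k = 0 ∧
      ∀ j, |score (n := nS) (x k.succ) (e k.succ) j| ≤ 4 * c₀ * √(nS * Real.log p)) ∧
    (∀ k ∈ B, ∀ v, inner ℝ (score (n := nS) (x k.succ)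
      fun i => e k.succ i - inner ℝ (x k.succ i) (d k)) v
        ≤ 8 * c₀ * √(nS * Real.log p) * (l1norm (d k + v) - l1norm (d k))) ∧
    (∀ j, |(score (n := nT) (x 0) (e 0) + ∑ k : Fin K, score (n := nS) (x k.succ)
      fun i => e k.succ i - inner ℝ (x k.succ i) (d k)) j|
        ≤ c₀ * √(totalSize K nT nS * Real.log p) / 2) ∧
    l1norm (((nS : ℝ) / totalSize K nT nS) • ∑ k, d k) ^ 2 ≤ Real.log p / totalSize K nT nS ∧
    ∀ j, |score (n := nT) (x 0) (e 0) j| ≤ c₁ * √(nT * Real.log p) / 2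

theorem continuous_score_comp {A : Type*} [TopologicalSpace A] {n : ℕ}
    {f : A → Fin n → EuclideanSpace ℝ (Fin p)} {g : A → Fin n → ℝ} (hf : Continuous f)
    (hg : Continuous g) : Continuous fun a => score (f a) (g a) := by
  unfold score
  exact continuous_finsetSum _ fun i _ =>
    ((continuous_apply i).comp hg).smul ((continuous_apply i).comp hf)

/-- For each of the finitely many `B`, the conditions are closed jointly in designs, errors and `d`;
projecting out the finite-dimensional `d` leaves a Borel set. -/
theorem measurableSet_noiseRegular (c₀ c₁ : ℝ) :
    MeasurableSet {q : Designs p K nT nS × Errors K nT nS | NoiseRegular c₀ c₁ q.1 q.2} := by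
  simp only [NoiseRegular, Set.ofPred_exists]
  refine MeasurableSet.iUnion fun B => ?_
  rw [← Set.ofPred_exists]
  refine measurableSet_image_fst_of_isClosed (S := {r : (Designs p K nT nS × Errors K nT nS) ×
      (Fin K → EuclideanSpace ℝ (Fin p)) | 10 * (p * B.card) ≤ K ∧
    (∀ k ∉ B, r.2 k = 0 ∧
      ∀ j, |score (n := nS) (r.1.1 k.succ) (r.1.2 k.succ) j| ≤ 4 * c₀ * √(nS * Real.log p)) ∧
    (∀ k ∈ B, ∀ v, inner ℝ (score (n := nS) (r.1.1 k.succ)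
      fun i => r.1.2 k.succ i - inner ℝ (r.1.1 k.succ i) (r.2 k)) v
        ≤ 8 * c₀ * √(nS * Real.log p) * (l1norm (r.2 k + v) - l1norm (r.2 k))) ∧
    (∀ j, |(score (n := nT) (r.1.1 0) (r.1.2 0) + ∑ k : Fin K, score (n := nS) (r.1.1 k.succ)
      fun i => r.1.2 k.succ i - inner ℝ (r.1.1 k.succ i) (r.2 k)) j|
        ≤ c₀ * √(totalSize K nT nS * Real.log p) / 2) ∧
    l1norm (((nS : ℝ) / totalSize K nT nS) • ∑ k, r.2 k) ^ 2 ≤ Real.log p / totalSize K nT nS ∧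
    ∀ j, |score (n := nT) (r.1.1 0) (r.1.2 0) j| ≤ c₁ * √(nT * Real.log p) / 2}) ?_
  have hd : ∀ k : Fin K, Continuous fun r :
      (Designs p K nT nS × Errors K nT nS) × (Fin K → EuclideanSpace ℝ (Fin p)) =>
      r.2 k := fun k => by fun_prop
  have hx : ∀ k : Fin (K + 1), Continuous fun r :
      (Designs p K nT nS × Errors K nT nS) × (Fin K → EuclideanSpace ℝ (Fin p)) =>
      r.1.1 k := fun k => by fun_prop
  have he : ∀ k : Fin (K + 1), Continuous fun r :
      (Designs p K nT nS × Errors K nT nS) × (Fin K → EuclideanSpace ℝ (Fin p)) =>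
      r.1.2 k := fun k => by fun_prop
  have hs : ∀ k, Continuous fun r :
      (Designs p K nT nS × Errors K nT nS) × (Fin K → EuclideanSpace ℝ (Fin p)) =>
      score (r.1.1 k) (r.1.2 k) := fun k =>
    continuous_score_comp (hx k) (he k)
  have hr : ∀ k : Fin K, Continuous fun r :
      (Designs p K nT nS × Errors K nT nS) × (Fin K → EuclideanSpace ℝ (Fin p)) =>
      score (n := nS) (r.1.1 k.succ)
        fun i => r.1.2 k.succ i - inner ℝ (r.1.1 k.succ i) (r.2 k) := fun k => by
    refine continuous_score_comp (n := nS) (hx k.succ) (continuous_pi fun i => ?_)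
    exact ((continuous_apply i).comp (he k.succ)).sub
      (((continuous_apply i).comp (hx k.succ)).inner (hd k))
  have hl := continuous_l1norm (p := p)
  simp only [Set.ofPred_and, Set.ofPred_forall]
  refine isClosed_const.inter (IsClosed.inter ?_ (IsClosed.inter ?_ (IsClosed.inter ?_
    (IsClosed.inter ?_ ?_))))
  · exact isClosed_iInter fun k => isClosed_iInter fun _ =>
      (isClosed_eq (hd k) continuous_const).inter (isClosed_iInter fun j =>
        isClosed_le (((EuclideanSpace.proj j).continuous.comp (hs k.succ)).abs) continuous_const)
  · exact isClosed_iInter fun k => isClosed_iInter fun _ => isClosed_iInter fun v =>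
      isClosed_le ((hr k).inner continuous_const)
        (continuous_const.mul ((hl.comp ((hd k).add continuous_const)).sub (hl.comp (hd k))))
  · exact isClosed_iInter fun j => isClosed_le (((EuclideanSpace.proj j).continuous.comp
      ((hs 0).add (continuous_finsetSum _ fun k _ => hr k))).abs) continuous_const
  · have h1 : Continuous fun r :
        (Designs p K nT nS × Errors K nT nS) × (Fin K → EuclideanSpace ℝ (Fin p)) =>
        ((nS : ℝ) / totalSize K nT nS) • ∑ k, r.2 k := by fun_prop
    have h2 : Continuous fun r :
        (Designs p K nT nS × Errors K nT nS) × (Fin K → EuclideanSpace ℝ (Fin p)) =>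
        l1norm (((nS : ℝ) / totalSize K nT nS) • ∑ k, r.2 k) := hl.comp h1
    exact isClosed_le (h2.pow 2) continuous_const
  · exact isClosed_iInter fun j => isClosed_le
      (((EuclideanSpace.proj j).continuous.comp (hs 0)).abs) continuous_const

end NoiseRegular

/-! ### Tail and moment bounds for the scores. -/

section NoiseProbability

variable {p : ℕ} {Ω : Type*} [MeasurableSpace Ω] {μ : Measure Ω} [IsProbabilityMeasure μ]

theorem exp_neg_mul_log (hp : 2 ≤ p) (r : ℕ) : Real.exp (-(r * Real.log p)) = 1 / (p : ℝ) ^ r := by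
  have : (0 : ℝ) < p := by positivity
  rw [Real.exp_neg, Real.exp_nat_mul, Real.exp_log this, one_div]

theorem sqrt_div_mul_sqrt_mul {l n : ℝ} (hl : 0 ≤ l) (hn : 0 < n) : √(l / n) * √(n * l) = l := by
  rw [← Real.sqrt_mul (by positivity), show l / n * (n * l) = l ^ 2 by field_simp, Real.sqrt_sq hl]

theorem measureReal_exists_le {P : Fin p → Ω → Prop} {δ : ℝ}
    (h : ∀ j, μ.real {ω | P j ω} ≤ δ) : μ.real {ω | ∃ j, P j ω} ≤ p * δ := by
  rw [Set.ofPred_exists]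
  refine (measureReal_iUnion_fintype_le _).trans ?_
  calc _ ≤ ∑ _j : Fin p, δ := Finset.sum_le_sum fun j _ => h j
    _ = _ := by simp

/-- Chernoff at `θ = √(log p / n)` gives exponent `(-a + v / 2) log p ≤ -r log p` per coordinate. -/
theorem measureReal_exists_lt_abs_le {Z : Ω → EuclideanSpace ℝ (Fin p)} {v n a : ℝ} (hp : 2 ≤ p)
    (hn : 0 < n) (hv : 0 ≤ v) (h : ∀ j, HasSubgaussianMGF (fun ω => Z ω j) (v * n).toNNReal μ)
    (r : ℕ) (hra : r + v / 2 ≤ a) :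
    μ.real {ω | ∃ j, a * √(n * Real.log p) < |Z ω j|} ≤ p * (2 * (1 / (p : ℝ) ^ r)) := by
  have hl : 0 < Real.log p := Real.log_pos (by exact_mod_cast hp)
  refine measureReal_exists_le fun j => ?_
  refine (measureReal_lt_abs_le (by positivity) (h j) (Real.sqrt_nonneg (Real.log p / n)) _).trans ?_
  rw [← exp_neg_mul_log hp, mul_left_comm, sqrt_div_mul_sqrt_mul hl.le hn,
    Real.sq_sqrt (by positivity)]
  gcongr
  have : Real.log p / n * (v * n) / 2 = v / 2 * Real.log p := by field_simp
  rw [this]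
  nlinarith

theorem hasSubgaussianMGF_score {n : ℕ} {x : Fin n → EuclideanSpace ℝ (Fin p)} {ξ : Fin n → Ω → ℝ}
    {σ U : ℝ} (hm : ∀ i, Measurable (ξ i))
    (hg : ∀ i, ∃ v : ℝ≥0, (v : ℝ) ≤ σ ^ 2 ∧ μ.map (ξ i) = gaussianReal 0 v)
    (hind : iIndepFun ξ μ) (j : Fin p) (hcol : ∑ i, x i j ^ 2 ≤ n * U) :
    HasSubgaussianMGF (fun ω => score x (fun i => ξ i ω) j) (σ ^ 2 * U * n).toNNReal μ := by
  simp only [score_apply]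
  refine hasSubgaussianMGF_sum_mul hm hg hind _ ?_
  calc _ ≤ σ ^ 2 * (n * U) := by gcongr
    _ = _ := by ring

/-- The pooled score is one weighted sum of all `N` independent errors, so its variance proxy is
linear in `N`: this gives the rate √(N log p) for the target direction. -/
theorem hasSubgaussianMGF_total_score {K nT nS : ℕ} {x : Designs p K nT nS}
    {ε : (k : Fin (K + 1)) → Fin (sampleSize nT nS k) → Ω → ℝ}
    {σ U : ℝ} (hm : ∀ k i, Measurable (ε k i))
    (hg : ∀ k i, ∃ v : ℝ≥0, (v : ℝ) ≤ σ ^ 2 ∧ μ.map (ε k i) = gaussianReal 0 v)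
    (hind : iIndepFun
      (fun (ki : (k : Fin (K + 1)) × Fin (sampleSize nT nS k)) => ε ki.1 ki.2) μ) (j : Fin p)
    (hcol : ∀ k, ∑ i, x k i j ^ 2 ≤ sampleSize nT nS k * U) :
    HasSubgaussianMGF (fun ω => (score (n := nT) (x 0) (fun i => ε 0 i ω) +
      ∑ k : Fin K, score (n := nS) (x k.succ) fun i => ε k.succ i ω) j)
      (σ ^ 2 * U * totalSize K nT nS).toNNReal μ := by
  have e : ∀ ω, (score (n := nT) (x 0) (fun i => ε 0 i ω) +
      ∑ k : Fin K, score (n := nS) (x k.succ) fun i => ε k.succ i ω) j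
      = ∑ ki : (k : Fin (K + 1)) × Fin (sampleSize nT nS k), ε ki.1 ki.2 ω * x ki.1 ki.2 j := by
    intro ω
    rw [Fintype.sum_sigma, Fin.sum_univ_succ]
    simp only [PiLp.add_apply, WithLp.ofLp_sum, Finset.sum_apply]
    exact congrArg₂ (· + ·) (score_apply (n := nT) _ _ j)
      (Finset.sum_congr rfl fun k _ => score_apply (n := nS) _ _ j)
  simp only [e]
  refine hasSubgaussianMGF_sum_mul
    (ξ := fun (ki : (k : Fin (K + 1)) × Fin (sampleSize nT nS k)) => ε ki.1 ki.2)
    (fun ki => hm ki.1 ki.2) (fun ki => hg ki.1 ki.2) hind _ ?_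
  have h1 : ∑ k : Fin (K + 1), (sampleSize nT nS k : ℝ) = totalSize K nT nS := by
    rw [Fin.sum_univ_succ]
    simp [sampleSize, totalSize]
    ring
  calc _ ≤ σ ^ 2 * ∑ k : Fin (K + 1), sampleSize nT nS k * U := by
        rw [Fintype.sum_sigma]
        gcongr with k
        exact hcol k
    _ = _ := by rw [← Finset.sum_mul, h1]; ring

/-- At `θ = √(log p / n)` the threshold leaves a factor `p⁻⁶`, hence `p⁻⁴` after the prefactor `p²`;
this high power is spent in the Markov and Chebyshev bounds. -/
theorem integral_excess_score_le {n : ℕ} {x : Fin n → EuclideanSpace ℝ (Fin p)}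
    {ξ : Fin n → Ω → ℝ} {v a : ℝ} (hp : 2 ≤ p) (hn : 0 < n) (hv : 0 ≤ v)
    (hm : ∀ i, Measurable (ξ i))
    (h : ∀ j, HasSubgaussianMGF (fun ω => score x (fun i => ξ i ω) j) (v * n).toNNReal μ)
    (ha : 6 + 2 * v ≤ a) :
    Integrable (fun ω => excess (a * √(n * Real.log p)) (score x fun i => ξ i ω)) μ ∧
      ∫ ω, excess (a * √(n * Real.log p)) (score x fun i => ξ i ω) ∂μ
        ≤ 4 * n / (Real.log p * p ^ 4) := by
  have hl : 0 < Real.log p := Real.log_pos (by exact_mod_cast hp)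
  have hn' : (0 : ℝ) < n := by exact_mod_cast hn
  have hp' : (0 : ℝ) < p := by positivity
  have hZ : Measurable fun ω => score x fun i => ξ i ω := by
    unfold score
    exact Finset.measurable_fun_sum _ fun i _ => (hm i).smul_const _
  obtain ⟨h1, h2⟩ := integral_excess_le hZ (by positivity) h
    (Real.sqrt_pos.2 (div_pos hl hn')) (a * √(n * Real.log p))
  refine ⟨h1, h2.trans ?_⟩
  rw [mul_left_comm, sqrt_div_mul_sqrt_mul hl.le hn', Real.sq_sqrt (by positivity)]
  calc (p : ℝ) ^ 2 * (4 / (Real.log p / n)) *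
        Real.exp (-(a * Real.log p) + 2 * (Real.log p / n) * (v * n))
      ≤ (p : ℝ) ^ 2 * (4 / (Real.log p / n)) * Real.exp (-((6 : ℕ) * Real.log p)) := by
        gcongr
        have : 2 * (Real.log p / n) * (v * n) = 2 * v * Real.log p := by field_simp
        rw [this]
        push_cast
        nlinarith
    _ = _ := by
      rw [exp_neg_mul_log hp]
      field_simp

end NoiseProbability

/-! ### Probability of the noise event, for few and for many sources. -/

section NoiseRegularProbability

variable {p K nT nS : ℕ} {Ω : Type*} [MeasurableSpace Ω] {μ : Measure Ω} [IsProbabilityMeasure μ]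

/-- Tail powers 2, 2 and 3, one power being lost to the coordinates. The extra power for the sources
pays for a union over at most `p` of them. The pooled score uses only half of its allowance, leaving
room for the Gram images of the fits. -/
theorem measureReal_total_score_gt_le {x : Designs p K nT nS}
    {ε : (k : Fin (K + 1)) → Fin (sampleSize nT nS k) → Ω → ℝ} {σ U : ℝ} (hU : 0 ≤ U) (hp : 2 ≤ p)
    (hnT : 0 < nT) (hm : ∀ k i, Measurable (ε k i))
    (hg : ∀ k i, ∃ v : ℝ≥0, (v : ℝ) ≤ σ ^ 2 ∧ μ.map (ε k i) = gaussianReal 0 v)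
    (hind : iIndepFun
      (fun (ki : (k : Fin (K + 1)) × Fin (sampleSize nT nS k)) => ε ki.1 ki.2) μ)
    (hcol : ∀ k j, ∑ i, x k i j ^ 2 ≤ sampleSize nT nS k * U) :
    μ.real {ω | ∃ j, (8 + 2 * (σ ^ 2 * U)) / 4 * √(totalSize K nT nS * Real.log p) <
      |(score (n := nT) (x 0) (fun i => ε 0 i ω) +
        ∑ k : Fin K, score (n := nS) (x k.succ) fun i => ε k.succ i ω) j|} ≤ 2 / p ∧
    μ.real {ω | ∃ j, (8 + 2 * (σ ^ 2 * U)) / 2 * √(nT * Real.log p) <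
      |score (n := nT) (x 0) (fun i => ε 0 i ω) j|} ≤ 2 / p ∧
    ∀ k : Fin K, μ.real {ω | ∃ j, 4 * (8 + 2 * (σ ^ 2 * U)) * √(nS * Real.log p) <
      |score (n := nS) (x k.succ) (fun i => ε k.succ i ω) j|} ≤ 2 / (p * p) := by
  have hp' : (0 : ℝ) < p := by positivity
  have hnT' : (0 : ℝ) < nT := by exact_mod_cast hnT
  have hN : 0 < totalSize K nT nS := by unfold totalSize; positivity
  have hv : 0 ≤ σ ^ 2 * U := by positivity
  have hk : ∀ k, iIndepFun (ε k) μ := fun k =>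
    hind.precomp (g := fun i => (⟨k, i⟩ : (k : Fin (K + 1)) × Fin (sampleSize nT nS k)))
      fun i j hij => by simpa using hij
  refine ⟨(measureReal_exists_lt_abs_le hp hN hv
      (fun j => hasSubgaussianMGF_total_score hm hg hind j fun k => hcol k j) 2 ?_).trans ?_,
    (measureReal_exists_lt_abs_le hp hnT' hv
      (fun j => hasSubgaussianMGF_score (hm 0) (hg 0) (hk 0) j (hcol 0 j)) 2 ?_).trans ?_,
    fun k => ?_⟩
  · push_cast; linarith
  · exact le_of_eq (by field_simp)
  · push_cast; linarith
  · exact le_of_eq (by field_simp)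
  · rcases Nat.eq_zero_or_pos nS with h0 | hnS
    · have : {ω | ∃ j, 4 * (8 + 2 * (σ ^ 2 * U)) * √(nS * Real.log p) <
          |score (n := nS) (x k.succ) (fun i => ε k.succ i ω) j|} = ∅ := by
        ext ω
        subst h0
        simp [score]
      rw [this, measureReal_empty]
      positivity
    · have hnS' : (0 : ℝ) < nS := by exact_mod_cast hnS
      refine (measureReal_exists_lt_abs_le hp hnS' hv (fun j =>
        hasSubgaussianMGF_score (n := nS) (hm k.succ) (hg k.succ) (hk k.succ) j
          (hcol k.succ j)) 3 ?_).trans ?_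
      · push_cast; linarith
      · exact le_of_eq (by field_simp)

/-- With at most `p` sources no source has a large score, by a union bound. -/
theorem measureReal_not_noiseRegular_le_of_le {x : Designs p K nT nS}
    {ε : (k : Fin (K + 1)) → Fin (sampleSize nT nS k) → Ω → ℝ} {σ U : ℝ} (hU : 0 ≤ U) (hp : 2 ≤ p)
    (hnT : 0 < nT) (hm : ∀ k i, Measurable (ε k i))
    (hg : ∀ k i, ∃ v : ℝ≥0, (v : ℝ) ≤ σ ^ 2 ∧ μ.map (ε k i) = gaussianReal 0 v)
    (hind : iIndepFun
      (fun (ki : (k : Fin (K + 1)) × Fin (sampleSize nT nS k)) => ε ki.1 ki.2) μ)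
    (hcol : ∀ k j, ∑ i, x k i j ^ 2 ≤ sampleSize nT nS k * U) (hK : K ≤ p) :
    μ.real {ω | ¬ NoiseRegular (8 + 2 * (σ ^ 2 * U)) (8 + 2 * (σ ^ 2 * U)) x
      fun k i => ε k i ω} ≤ 6 / p := by
  have hp' : (0 : ℝ) < p := by positivity
  have hl : 0 < Real.log p := Real.log_pos (by exact_mod_cast hp)
  obtain ⟨h1, h2, h3⟩ := measureReal_total_score_gt_le hU hp hnT hm hg hind hcol
  set c₀ := 8 + 2 * (σ ^ 2 * U) with hc₀
  have hc₀0 : 0 ≤ c₀ := by positivity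
  have h4 : μ.real {ω | ∃ k : Fin K, ∃ j, 4 * c₀ * √(nS * Real.log p) <
      |score (n := nS) (x k.succ) (fun i => ε k.succ i ω) j|} ≤ 2 / p := by
    refine (measureReal_exists_le h3).trans ?_
    calc (K : ℝ) * (2 / (p * p)) ≤ p * (2 / (p * p)) := by gcongr
      _ = _ := by field_simp
  refine (measureReal_mono (s₂ := {ω | ∃ j, c₀ / 4 * √(totalSize K nT nS * Real.log p) <
      |(score (n := nT) (x 0) (fun i => ε 0 i ω) +
        ∑ k : Fin K, score (n := nS) (x k.succ) fun i => ε k.succ i ω) j|} ∪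
      ({ω | ∃ j, c₀ / 2 * √(nT * Real.log p) <
      |score (n := nT) (x 0) (fun i => ε 0 i ω) j|} ∪
      {ω | ∃ k : Fin K, ∃ j, 4 * c₀ * √(nS * Real.log p) <
      |score (n := nS) (x k.succ) (fun i => ε k.succ i ω) j|})) ?_).trans
    ((measureReal_union_le _ _).trans ((add_le_add_right (measureReal_union_le _ _) _).trans ?_))
  · intro ω hω
    by_contra hcon
    simp only [Set.mem_union, Set.mem_ofPred_eq, not_or, not_exists, not_lt] at hcon
    obtain ⟨g1, g2, g3⟩ := hcon
    refine hω ⟨∅, fun _ => 0, by simp, fun k _ => ⟨rfl, g3 k⟩, by simp, fun j => ?_, ?_,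
      fun j => (g2 j).trans (le_of_eq (by ring))⟩
    · simp only [inner_zero_right, sub_zero]
      refine (g1 j).trans ?_
      have := Real.sqrt_nonneg (totalSize K nT nS * Real.log p)
      nlinarith
    · have hN : 0 ≤ totalSize K nT nS := by unfold totalSize; positivity
      simp only [Finset.sum_const_zero, smul_zero, l1norm_zero]
      rw [zero_pow two_ne_zero]
      exact div_nonneg hl.le hN
  · have : (6 : ℝ) / p = 2 / p + (2 / p + 2 / p) := by ring
    rw [this]
    gcongr

/-- For many sources with well-conditioned designs there are lasso fits of the noise of the sources
with a large score, such that few sources have a large score and the fits nearly cancel. -/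
theorem exists_noiseFits {n : ℕ} {x : Fin K → Fin n → EuclideanSpace ℝ (Fin p)}
    {ξ : Fin K → Fin n → Ω → ℝ} {σ U C₁ N c₀ : ℝ} (hU : 0 ≤ U)
    (hC₁ : 0 < C₁) (hp : 2 ≤ p) (hn : 0 < n) (hK : 0 < K) (hKN : K * n ≤ N)
    (hm : ∀ k i, Measurable (ξ k i))
    (hg : ∀ k i, ∃ v : ℝ≥0, (v : ℝ) ≤ σ ^ 2 ∧ μ.map (ξ k i) = gaussianReal 0 v)
    (hind : iIndepFun (fun (ki : (_ : Fin K) × Fin n) => ξ ki.1 ki.2) μ)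
    (hcol : ∀ k j, ∑ i, x k i j ^ 2 ≤ n * U)
    (hwell : ∀ k v, n / (4 * C₁ ^ 2) * ‖v‖ ^ 2 ≤ predSq (x k) v)
    (hc₀ : 8 + 2 * (σ ^ 2 * U) ≤ c₀) :
    ∃ D : Fin K → EuclideanSpace ℝ (Fin p) → EuclideanSpace ℝ (Fin p),
      (∀ k z, (∃ j, 4 * c₀ * √(n * Real.log p) < |z j|) →
        LassoOptimal (x k) (8 * c₀ * √(n * Real.log p)) z (D k z)) ∧
      (∀ k z, (¬ ∃ j, 4 * c₀ * √(n * Real.log p) < |z j|) → D k z = 0) ∧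
      μ.real {ω | (4 * c₀ * √(n * Real.log p)) ^ 2 * K / (10 * p) ≤
        ∑ k, excess (4 * c₀ * √(n * Real.log p)) (score (x k) fun i => ξ k i ω)} ≤ 10 / p ∧
      μ.real {ω | ∃ j, √(Real.log p * N) / (n * p) <
        |∑ k, D k (score (x k) fun i => ξ k i ω) j|} ≤ 256 * C₁ ^ 4 / p ∧
      μ.real {ω | ∃ j, c₀ * √(N * Real.log p) / 4 <
        |∑ k, gramMul (x k) (D k (score (x k) fun i => ξ k i ω)) j|}
          ≤ 1024 * (C₁ ^ 2 * U) / p := by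
  have hp1 : (1 : ℝ) ≤ p := by exact_mod_cast (by omega : 1 ≤ p)
  have hp' : (0 : ℝ) < p := by positivity
  have hn' : (0 : ℝ) < n := by exact_mod_cast hn
  have hK' : (0 : ℝ) < K := by exact_mod_cast hK
  have hN : 0 < N := lt_of_lt_of_le (by positivity) hKN
  -- A numerical lower bound on `log p` suffices to discard the powers of `log p` in the comparisons
  -- below.
  have hl : 1 / 2 ≤ Real.log p := by
    have h1 : Real.log 2 ≤ Real.log p := Real.log_le_log two_pos (by exact_mod_cast hp)
    linarith [Real.log_two_gt_d9]
  have hv : 0 ≤ σ ^ 2 * U := by positivity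
  have hc₀8 : 8 ≤ c₀ := by linarith
  have hexc := fun k => integral_excess_score_le (a := 4 * c₀) (x := x k) (ξ := ξ k) hp hn hv (hm k)
    (fun j => hasSubgaussianMGF_score (hm k) (hg k)
      (hind.precomp (g := fun i => (⟨k, i⟩ : (_ : Fin K) × Fin n))
        fun i j hij => by simpa using hij) j (hcol k j)) (by linarith)
  obtain ⟨l, hl_def⟩ : ∃ l, l = Real.log p := ⟨_, rfl⟩
  rw [← hl_def] at hl hexc ⊢
  have hl0 : 0 < l := by linarith
  obtain ⟨τ, hτ⟩ : ∃ τ, τ = 4 * c₀ * √(n * l) := ⟨_, rfl⟩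
  rw [← hτ] at hexc ⊢
  have hτ0 : 0 < τ := by rw [hτ]; positivity
  obtain ⟨m, hm_def⟩ : ∃ m, m = n / (4 * C₁ ^ 2) := ⟨_, rfl⟩
  rw [← hm_def] at hwell
  have hm0 : 0 < m := by rw [hm_def]; positivity
  choose D hDm hodd hnorm hpred hopt hzero using fun k =>
    exists_truncatedLassoFit (x k) (L := 8 * c₀ * √(n * l)) hm0 (by positivity) (hwell k) τ
  have hg' : ∀ k i, ∃ v : ℝ≥0, μ.map (ξ k i) = gaussianReal 0 v :=
    fun k i => (hg k i).imp fun v hv => hv.2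
  have i1 : 1 / 4 ≤ l ^ 2 := by nlinarith
  have i2 : 1 ≤ c₀ ^ 2 := by nlinarith
  have i3 : 1 ≤ 4 * (c₀ ^ 2 * l ^ 2) := by nlinarith
  have i4 : (1 : ℝ) ≤ (p : ℝ) ^ 2 := by nlinarith
  have i5 : 1 ≤ 4 * (c₀ ^ 2 * l ^ 2) * (p : ℝ) ^ 2 := by nlinarith
  refine ⟨D, hopt, hzero, ?_, ?_, ?_⟩
  · refine (measureReal_sum_ge_le (fun k ω => excess_nonneg _ _) (fun k => (hexc k).1)
      (fun k => (hexc k).2) (by positivity)).trans ?_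
    rw [Fintype.card_fin, hτ, mul_pow, Real.sq_sqrt (by positivity)]
    have e : K * (4 * n / (l * p ^ 4)) / ((4 * c₀) ^ 2 * (n * l) * K / (10 * p))
        = 10 / p * (1 / (4 * (c₀ ^ 2 * l ^ 2) * p ^ 2)) := by field_simp
    rw [e]
    refine mul_le_of_le_one_right (by positivity) ?_
    rw [div_le_one (by positivity)]
    exact i5
  -- The level √(l N) / (n p), summed over `p` coordinates and scaled by `n / N`, becomes √(l / N),
  -- as required of the average fit.
  · refine (measureReal_exists_le fun j => measureReal_abs_sum_odd_gt_le (A := 1 / m ^ 2) hm hg'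
      hind (by positivity) (by positivity) (fun k => (hexc k).1) (fun k => (hexc k).2)
      (g := fun k w => D k w j) (fun k => by have := hDm k; fun_prop)
      (fun k w => by rw [hodd]; rfl) (fun k w => ?_)).trans ?_
    · rw [one_div, inv_mul_eq_div, le_div_iff₀ (by positivity), mul_comm]
      refine le_trans ?_ (hnorm k w)
      have : |D k w j| ≤ ‖D k w‖ := by simpa using PiLp.norm_apply_le (D k w) j
      exact mul_le_mul_of_nonneg_left (sq_le_sq.2 (this.trans (le_abs_self _))) (by positivity)
    · rw [div_pow (√(l * N)), Real.sq_sqrt (by positivity), hm_def]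
      have e : (p : ℝ) * (K * (1 / (n / (4 * C₁ ^ 2)) ^ 2 * (4 * n / (l * p ^ 4))) /
          (l * N / (n * p) ^ 2)) = 256 * C₁ ^ 4 / p * (K * n / (4 * l ^ 2 * N)) := by
        field_simp; norm_num
      rw [e]
      refine mul_le_of_le_one_right (by positivity) ?_
      rw [div_le_one (by positivity)]
      nlinarith
  -- By Cauchy–Schwarz a squared entry of the Gram image is at most the prediction error of the fit,
  -- `excess / m`, times the squared column norm `n U`.
  · refine (measureReal_exists_le fun j => measureReal_abs_sum_odd_gt_le (A := n * U / m) hm hg'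
      hind (by positivity) (by positivity) (fun k => (hexc k).1) (fun k => (hexc k).2)
      (g := fun k w => gramMul (x k) (D k w) j) (fun k => ?_)
      (fun k w => by rw [hodd, gramMul_neg]; rfl) (fun k w => ?_)).trans ?_
    · have i1 := (continuous_gramMul (x k)).measurable.comp (hDm k)
      have i2 : Measurable fun w => gramMul (x k) (D k w) := i1
      fun_prop
    · refine (gramMul_sq_le _ _ _).trans ?_
      have i1 := hpred k w
      calc _ ≤ predSq (x k) (D k w) * (n * U) :=
            mul_le_mul_of_nonneg_left (hcol k j) (predSq_nonneg _ _)
        _ = n * U / m * (m * predSq (x k) (D k w)) := by field_simp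
        _ ≤ _ := by gcongr
    · rw [div_pow (c₀ * √(N * l)), mul_pow, Real.sq_sqrt (by positivity), hm_def]
      have e : (p : ℝ) * (K * (n * U / (n / (4 * C₁ ^ 2)) * (4 * n / (l * p ^ 4))) /
          (c₀ ^ 2 * (N * l) / 4 ^ 2))
          = 1024 * (C₁ ^ 2 * U) / p * (K * n / (4 * (c₀ ^ 2 * l ^ 2) * p ^ 2 * N)) := by
        field_simp; norm_num
      rw [e]
      refine mul_le_of_le_one_right (by positivity) ?_
      rw [div_le_one (by positivity)]
      nlinarith

/-- With many sources and well-conditioned source designs, few sources have a large score, and the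
lasso fits of their noise nearly cancel. -/
theorem measureReal_not_noiseRegular_le_of_wellConditioned {x : Designs p K nT nS}
    {ε : (k : Fin (K + 1)) → Fin (sampleSize nT nS k) → Ω → ℝ} {σ U C₁ : ℝ} (hU : 0 ≤ U)
    (hC₁ : 0 < C₁) (hp : 2 ≤ p) (hnT : 0 < nT) (hnS : 0 < nS) (hK : 0 < K)
    (hm : ∀ k i, Measurable (ε k i))
    (hg : ∀ k i, ∃ v : ℝ≥0, (v : ℝ) ≤ σ ^ 2 ∧ μ.map (ε k i) = gaussianReal 0 v)
    (hind : iIndepFun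
      (fun (ki : (k : Fin (K + 1)) × Fin (sampleSize nT nS k)) => ε ki.1 ki.2) μ)
    (hcol : ∀ k j, ∑ i, x k i j ^ 2 ≤ sampleSize nT nS k * U)
    (hwell : ∀ (k : Fin K) v, nS / (4 * C₁ ^ 2) * ‖v‖ ^ 2 ≤ predSq (n := nS) (x k.succ) v) :
    μ.real {ω | ¬ NoiseRegular (8 + 2 * (σ ^ 2 * U)) (8 + 2 * (σ ^ 2 * U)) x
      fun k i => ε k i ω} ≤ (14 + 256 * C₁ ^ 4 + 1024 * (C₁ ^ 2 * U)) / p := by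
  have hp1 : (1 : ℝ) ≤ p := by exact_mod_cast (by omega : 1 ≤ p)
  have hp' : (0 : ℝ) < p := by positivity
  have hnS' : (0 : ℝ) < nS := by exact_mod_cast hnS
  have hnT' : (0 : ℝ) < nT := by exact_mod_cast hnT
  have hK' : (0 : ℝ) < K := by exact_mod_cast hK
  have hl : 0 < Real.log p := Real.log_pos (by exact_mod_cast hp)
  have hN : 0 < totalSize K nT nS := by unfold totalSize; positivity
  have hKN : K * nS ≤ totalSize K nT nS := by unfold totalSize; linarith
  obtain ⟨h1, h2, -⟩ := measureReal_total_score_gt_le hU hp hnT hm hg hind hcol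
  have hind' : iIndepFun (fun (ki : (_ : Fin K) × Fin nS) => ε ki.1.succ ki.2) μ :=
    hind.precomp (g := fun ki : (_ : Fin K) × Fin nS =>
      (⟨ki.1.succ, ki.2⟩ : (k : Fin (K + 1)) × Fin (sampleSize nT nS k)))
      (Function.Injective.sigma_map (β₂ := fun k => Fin (sampleSize nT nS k))
        (f₂ := fun _ => id) (Fin.succ_injective K) fun _ => Function.injective_id)
  obtain ⟨D, hopt, hzero, h3, h4, h5⟩ := exists_noiseFits (n := nS) (μ := μ)
    (x := fun k : Fin K => x k.succ) (ξ := fun (k : Fin K) i => ε k.succ i) hU hC₁ hp hnS hK hKN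
    (fun k i => hm k.succ i) (fun k i => hg k.succ i) hind' (fun k j => hcol k.succ j) hwell le_rfl
  have hv : 0 ≤ σ ^ 2 * U := by positivity
  obtain ⟨N, hN_def⟩ : ∃ N, N = totalSize K nT nS := ⟨_, rfl⟩
  obtain ⟨c₀, hc₀⟩ : ∃ c₀, c₀ = 8 + 2 * (σ ^ 2 * U) := ⟨_, rfl⟩
  obtain ⟨l, hl_def⟩ : ∃ l, l = Real.log p := ⟨_, rfl⟩
  obtain ⟨τ, hτ⟩ : ∃ τ, τ = 4 * c₀ * √(nS * l) := ⟨_, rfl⟩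
  rw [← hl_def, ← hN_def, ← hc₀] at h1
  rw [← hl_def, ← hc₀] at h2
  rw [← hl_def, ← hc₀, ← hτ] at h3
  simp only [← hl_def, ← hc₀, ← hτ] at hopt hzero
  rw [← hl_def, ← hN_def] at h4
  rw [← hl_def, ← hN_def, ← hc₀] at h5
  rw [← hc₀]
  rw [← hl_def] at hl
  rw [← hN_def] at hN
  have hτ0 : 0 < τ := by rw [hτ, hc₀]; positivity
  set z : Fin K → Ω → EuclideanSpace ℝ (Fin p) := fun k ω =>
    score (n := nS) (x k.succ) fun i => ε k.succ i ω with hz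
  refine (measureReal_mono (s₂ := {ω | ∃ j, c₀ / 4 * √(N * l) <
      |(score (n := nT) (x 0) (fun i => ε 0 i ω) +
        ∑ k : Fin K, score (n := nS) (x k.succ) fun i => ε k.succ i ω) j|} ∪
      ({ω | ∃ j, c₀ / 2 * √(nT * l) < |score (n := nT) (x 0) (fun i => ε 0 i ω) j|} ∪
      ({ω | τ ^ 2 * K / (10 * p) ≤ ∑ k, excess τ (z k ω)} ∪
      ({ω | ∃ j, √(l * N) / (nS * p) < |∑ k, D k (z k ω) j|} ∪
      {ω | ∃ j, c₀ * √(N * l) / 4 <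
        |∑ k : Fin K, gramMul (n := nS) (x k.succ) (D k (z k ω)) j|})))) ?_).trans
    ((measureReal_union_le _ _).trans ((add_le_add_right ((measureReal_union_le _ _).trans
      (add_le_add_right ((measureReal_union_le _ _).trans
        (add_le_add_right (measureReal_union_le _ _) _)) _)) _).trans ?_))
  · intro ω hω
    by_contra hcon
    simp only [Set.mem_union, Set.mem_ofPred_eq, not_or, not_exists, not_lt, not_le] at hcon
    obtain ⟨g1, g2, g3, g4, g5⟩ := hcon
    classical
    refine hω ?_
    unfold NoiseRegular
    rw [← hl_def, ← hN_def]
    refine ⟨Finset.univ.filter fun k => ∃ j, τ < |z k ω j|, fun k => D k (z k ω), ?_,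
      fun k hkB => ?_, fun k hkB v => ?_, fun j => ?_, ?_,
      fun j => (g2 j).trans (le_of_eq (by ring))⟩
    · set B := Finset.univ.filter fun k => ∃ j, τ < |z k ω j| with hB
      -- Each exceptional source contributes at least `τ²` to the total excess.
      have i1 : (B.card : ℝ) * τ ^ 2 ≤ ∑ k, excess τ (z k ω) := by
        calc (B.card : ℝ) * τ ^ 2 = ∑ _k ∈ B, τ ^ 2 := by simp
          _ ≤ ∑ k ∈ B, excess τ (z k ω) := Finset.sum_le_sum fun k hkB =>
              sq_le_excess hτ0.le (Finset.mem_filter.1 hkB).2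
          _ ≤ _ := Finset.sum_le_sum_of_subset_of_nonneg (Finset.subset_univ _)
              fun k _ _ => excess_nonneg _ _
      have i2 := i1.trans g3.le
      rw [le_div_iff₀ (by positivity)] at i2
      have i3 : (10 * (p * B.card) : ℝ) ≤ K := by
        refine le_of_mul_le_mul_left ?_ (by positivity : 0 < τ ^ 2)
        linarith
      exact_mod_cast i3
    · have i1 : ¬ ∃ j, τ < |z k ω j| := by simpa using hkB
      exact ⟨hzero k _ i1, fun j => by push Not at i1; exact (i1 j).trans_eq hτ⟩
    · have i1 : ∃ j, τ < |z k ω j| := by simpa using hkB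
      have i2 := hopt k _ i1 v
      rw [← inner_sub_left] at i2
      exact (congrArg (inner ℝ · v) (score_sub_inner (n := nS) _ _ _)).trans_le i2
    -- The residual score is the pooled score minus the Gram images; each takes `c₀ / 4` of the
    -- allowance `c₀ / 2`.
    · have e : (score (n := nT) (x 0) (fun i => ε 0 i ω) + ∑ k : Fin K, score (n := nS) (x k.succ)
          fun i => ε k.succ i ω - inner ℝ (x k.succ i) (D k (z k ω))) j
          = (score (n := nT) (x 0) (fun i => ε 0 i ω) +
            ∑ k : Fin K, score (n := nS) (x k.succ) fun i => ε k.succ i ω) j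
            - ∑ k : Fin K, gramMul (n := nS) (x k.succ) (D k (z k ω)) j := by
        have i1 : ∀ k : Fin K, (score (n := nS) (x k.succ)
            fun i => ε k.succ i ω - inner ℝ (x k.succ i) (D k (z k ω)))
            = (score (n := nS) (x k.succ) fun i => ε k.succ i ω)
              - gramMul (n := nS) (x k.succ) (D k (z k ω)) := fun k =>
          score_sub_inner (n := nS) _ _ _
        simp only [i1, Finset.sum_sub_distrib, PiLp.add_apply, PiLp.sub_apply, WithLp.ofLp_sum,
          Finset.sum_apply]
        ring
      refine (congrArg abs e).trans_le ((abs_sub _ _).trans ?_)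
      have i1 := g1 j
      have i2 := g5 j
      linarith
    · have i1 : l1norm (∑ k, D k (z k ω)) ≤ p * (√(l * N) / (nS * p)) := by
        calc l1norm (∑ k, D k (z k ω)) = ∑ j, |∑ k, D k (z k ω) j| := by
              simp [l1norm]
          _ ≤ ∑ _j : Fin p, √(l * N) / (nS * p) := Finset.sum_le_sum fun j _ => g4 j
          _ = _ := by simp
      rw [l1norm_smul, mul_pow, sq_abs]
      calc (nS / N) ^ 2 * l1norm (∑ k, D k (z k ω)) ^ 2
          ≤ (nS / N) ^ 2 * (p * (√(l * N) / (nS * p))) ^ 2 := by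
            gcongr; exact l1norm_nonneg _
        _ = l / N := by
          rw [mul_pow, div_pow (√(l * N)), Real.sq_sqrt (by positivity)]
          field_simp
  · have : (14 + 256 * C₁ ^ 4 + 1024 * (C₁ ^ 2 * U)) / p = 2 / p + (2 / p + (10 / p +
        (256 * C₁ ^ 4 / p + 1024 * (C₁ ^ 2 * U) / p))) := by ring
    rw [this]
    gcongr

end NoiseRegularProbability

/-! ### Well-conditioned source designs and the union over all designs. -/

section Assembly

variable {p n : ℕ} {C₁ C₂ C₄ l : ℝ}

/-- A regular design with many more rows than columns is well-conditioned. -/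
theorem DesignRegular.sqrt_mul_norm_le {x : Fin n → EuclideanSpace ℝ (Fin p)}
    (h : DesignRegular C₁ C₂ C₄ l x) (hl : 0 ≤ l) (hC₂ : 0 ≤ C₂) (hn : 4 * C₂ ^ 2 * (l * p) ≤ n)
    (v : EuclideanSpace ℝ (Fin p)) : √n * ‖v‖ ≤ 2 * C₁ * √(predSq x v) := by
  have h1 := h.1 v
  have h2 : C₂ * √l * l1norm v ≤ √n / 2 * ‖v‖ := by
    have h3 : C₂ * √l * √p ≤ √n / 2 := by
      have : 2 * (C₂ * √l * √p) ≤ √n := by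
        refine Real.le_sqrt_of_sq_le (le_trans (le_of_eq ?_) hn)
        rw [mul_pow, mul_pow, mul_pow, Real.sq_sqrt hl, Real.sq_sqrt (Nat.cast_nonneg p)]
        ring
      linarith
    calc C₂ * √l * l1norm v ≤ C₂ * √l * (√p * ‖v‖) := by
          gcongr; exact l1norm_le_sqrt_mul_norm v
      _ = C₂ * √l * √p * ‖v‖ := by ring
      _ ≤ _ := by gcongr
  linarith

theorem DesignRegular.mul_norm_sq_le {x : Fin n → EuclideanSpace ℝ (Fin p)}
    (h : DesignRegular C₁ C₂ C₄ l x) (hl : 0 ≤ l) (hC₁ : 0 < C₁) (hC₂ : 0 ≤ C₂)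
    (hn : 4 * C₂ ^ 2 * (l * p) ≤ n) (v : EuclideanSpace ℝ (Fin p)) :
    n / (4 * C₁ ^ 2) * ‖v‖ ^ 2 ≤ predSq x v := by
  have h1 := pow_le_pow_left₀ (by positivity) (h.sqrt_mul_norm_le hl hC₂ hn v) 2
  rw [mul_pow, mul_pow, Real.sq_sqrt (Nat.cast_nonneg n), Real.sq_sqrt (predSq_nonneg x v)] at h1
  rw [div_mul_eq_mul_div, div_le_iff₀ (by positivity)]
  linarith

theorem DesignRegular.sqrt_mul_l1norm_le {x : Fin n → EuclideanSpace ℝ (Fin p)}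
    (h : DesignRegular C₁ C₂ C₄ l x) (hl : 0 ≤ l) (hC₂ : 0 ≤ C₂)
    (hn : 4 * C₂ ^ 2 * (l * p) ≤ n) (v : EuclideanSpace ℝ (Fin p)) :
    √n * l1norm v ≤ 2 * C₁ * √p * √(predSq x v) := by
  calc √n * l1norm v ≤ √n * (√p * ‖v‖) := by gcongr; exact l1norm_le_sqrt_mul_norm v
    _ = √p * (√n * ‖v‖) := by ring
    _ ≤ √p * (2 * C₁ * √(predSq x v)) :=
        mul_le_mul_of_nonneg_left (h.sqrt_mul_norm_le hl hC₂ hn v) (Real.sqrt_nonneg _)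
    _ = _ := by ring

/-- `K ≤ 2 ^ K ≤ exp (K l)`, so a rate `2 K l` absorbs a union over `K` tasks however large `K` is
compared with `p`. -/
theorem natCast_mul_exp_le {K : ℕ} {l t : ℝ} (hK : 1 ≤ K) (hl : Real.log 2 ≤ l)
    (ht : 2 * K * l ≤ t) : K * Real.exp (-t) ≤ Real.exp (-l) := by
  have hK' : (1 : ℝ) ≤ K := by exact_mod_cast hK
  have hl0 : 0 < l := (Real.log_pos one_lt_two).trans_le hl
  have h1 : (K : ℝ) ≤ Real.exp (K * l) := by
    calc (K : ℝ) ≤ 2 ^ K := by exact_mod_cast Nat.lt_two_pow_self.le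
      _ = Real.exp (K * Real.log 2) := by rw [Real.exp_nat_mul, Real.exp_log two_pos]
      _ ≤ _ := by gcongr
  calc K * Real.exp (-t) ≤ Real.exp (K * l) * Real.exp (-(2 * K * l)) := by gcongr
    _ = Real.exp (-(K * l)) := by rw [← Real.exp_add]; ring_nf
    _ ≤ Real.exp (-l) := by gcongr; nlinarith

/-- All designs are regular with high probability. -/
theorem measureReal_not_forall_designRegular_le {Ω : Type*} [MeasurableSpace Ω] {μ : Measure Ω}
    [IsProbabilityMeasure μ] {K nT nS : ℕ} {X : (k : Fin (K + 1)) → Fin (sampleSize nT nS k) → Ω →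
      EuclideanSpace ℝ (Fin p)} {a CT : ℝ} (hp : 2 ≤ p) (hK : 1 ≤ K) (ha : 0 < a) (hCT : 0 < CT)
    (hT : Real.log p ≤ CT * nT) (hS : 2 * K * Real.log p ≤ a * nS)
    (h : ∀ k, μ.real {ω | ¬ DesignRegular C₁ C₂ C₄ l fun i => X k i ω}
      ≤ 2 * Real.exp (-a * sampleSize nT nS k)) :
    μ.real {ω | ¬ ∀ k, DesignRegular C₁ C₂ C₄ l fun i => X k i ω}
      ≤ 2 * Real.exp (-(a / CT * Real.log p)) + 2 * Real.exp (-Real.log p) := by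
  have hl : Real.log 2 ≤ Real.log p := Real.log_le_log two_pos (by exact_mod_cast hp)
  simp only [not_forall, Set.ofPred_exists]
  refine (measureReal_iUnion_fintype_le _).trans ((Finset.sum_le_sum fun k _ => h k).trans ?_)
  rw [Fin.sum_univ_succ]
  simp only [sampleSize, Fin.cons_zero, Fin.cons_succ, Finset.sum_const, Finset.card_univ,
    Fintype.card_fin, nsmul_eq_mul]
  refine add_le_add ?_ ?_
  · gcongr
    rw [neg_mul, neg_le_neg_iff, div_mul_eq_mul_div, div_le_iff₀ hCT]
    nlinarith
  · have := natCast_mul_exp_le hK hl hS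
    rw [neg_mul]
    linarith

end Assembly

end TransFusion

/-! ### The main theorem: choice of constants and union of the bad events. -/

theorem theorem2 (c σ CT CS : ℝ) (κ : ℝ≥0)
    (hc : 0 < c) (hσ : 0 ≤ σ) (hCT : 0 < CT) (hCS : 0 < CS) :
    ∃ c₀ c₁ c₂ c₃ C η : ℝ, 0 < c₀ ∧ 0 < c₁ ∧ 0 < c₂ ∧ 0 < c₃ ∧ 0 < C ∧ 0 < η ∧
      ∀ (K nT nS p s : ℕ), 1 ≤ K → 1 ≤ s → nT ≤ nS →
      (s : ℝ) * Real.log p ≤ CT * nT →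
      (K : ℝ) ^ 2 * s * Real.log p ≤ CS * nS →
      ∀ (h : Fin K → ℝ),
      TransFusion.hbar nT nS h * √(Real.log p / nT) + (K : ℝ) * s * Real.log p / nS ≤ η →
      ∀ (β : Fin (K + 1) → EuclideanSpace ℝ (Fin p)), β ∈ TransFusion.parameterSpace s h →
      ∀ (Ω : Type*) [MeasurableSpace Ω] (μ : Measure Ω) [IsProbabilityMeasure μ]
        (X : (k : Fin (K + 1)) → Fin (TransFusion.sampleSize nT nS k) → Ω →
          EuclideanSpace ℝ (Fin p))
        (ε : (k : Fin (K + 1)) → Fin (TransFusion.sampleSize nT nS k) → Ω → ℝ)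
        (Cov : Fin (K + 1) → Matrix (Fin p) (Fin p) ℝ),
      TransFusion.SubGaussianDesign μ c κ X Cov →
      TransFusion.GaussianErrors μ σ X ε →
      ∃ E : Set Ω, MeasurableSet E ∧ 1 - c₂ * Real.exp (-c₃ * Real.log p) ≤ μ.real E ∧
        ∀ ω ∈ E, ∀ βhat : EuclideanSpace ℝ (Fin p),
          TransFusion.IsTwoStepEstimate (fun k i => X k i ω)
            (TransFusion.response β (fun k i => X k i ω) (fun k i => ε k i ω))
            (TransFusion.lambdaZero c₀ p s nT nS h) (TransFusion.weight p s nT nS h)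
            (TransFusion.lambdaTilde c₁ p nT) βhat →
          ‖βhat - β 0‖ ^ 2 ≤
            C * ((s : ℝ) * Real.log p / TransFusion.totalSize K nT nS +
              TransFusion.hbar nT nS h * √(Real.log p / nT)) := by
  open TransFusion in
  -- With `η ≤ 1 ≤ CT'`, the bound `log p ≤ CT' n` holds for the source samples as well.
  obtain ⟨CT', hCT'⟩ : ∃ CT', CT' = max CT 1 := ⟨_, rfl⟩
  have hCT1 : CT ≤ CT' := hCT' ▸ le_max_left _ _
  have hCT2 : 1 ≤ CT' := hCT' ▸ le_max_right _ _
  have hCT0 : 0 < CT' := by linarith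
  obtain ⟨C₁, C₂, C₄, a, hC₁, hC₂, hC₄, ha, hdesign⟩ :=
    exists_measureReal_not_designRegular_le hc (lt_max_of_lt_right one_pos : (0 : ℝ) < max κ 1) hCT0
  obtain ⟨U, hU⟩ : ∃ U, U = C₄ * (1 + CT') := ⟨_, rfl⟩
  have hU0 : 0 < U := by rw [hU]; positivity
  obtain ⟨c₀, hc₀⟩ : ∃ c₀, c₀ = 8 + 2 * (σ ^ 2 * U) := ⟨_, rfl⟩
  have hc₀0 : 0 < c₀ := by rw [hc₀]; positivity
  obtain ⟨C, hC, hbound⟩ := twoStep_error_bound (C₃ := 2 * C₁) hC₁.le hC₂.le (by positivity) hC₄.le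
    hCT.le hc₀0 hc₀0
  obtain ⟨Cn, hCn⟩ : ∃ Cn, Cn = 14 + 256 * C₁ ^ 4 + 1024 * (C₁ ^ 2 * U) := ⟨_, rfl⟩
  have hCn6 : 6 ≤ Cn := by
    rw [hCn]; linarith [show 0 ≤ 256 * C₁ ^ 4 + 1024 * (C₁ ^ 2 * U) by positivity]
  -- The three parts of `η` serve in turn: the rate being at most 1; the union over the source
  -- designs, via `2 K log p ≤ a n_S`; the remainder 1/100 in the compatibility bound and the
  -- conditioning of the sources when `K > p`.
  obtain ⟨η, hη_def⟩ : ∃ η, η = min 1 (min (a / 2) ((1 / (100 * C₂)) ^ 2)) := ⟨_, rfl⟩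
  have hη0 : 0 < η := by rw [hη_def]; positivity
  have hη1 : η ≤ 1 := hη_def ▸ min_le_left _ _
  have hη2 : η ≤ a / 2 := hη_def ▸ (min_le_right _ _).trans (min_le_left _ _)
  have hη3 : η ≤ (1 / (100 * C₂)) ^ 2 := hη_def ▸ (min_le_right _ _).trans (min_le_right _ _)
  refine ⟨c₀, c₀, 5 + Cn, min 1 (a / CT'), C, η, hc₀0, hc₀0, by linarith,
    lt_min one_pos (by positivity), hC, hη0, ?_⟩
  intro K nT nS p s hK hs hnTS hT _ h hη β hβ Ω _ μ _ X ε Cov hX hε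
  -- For `p ≤ 1` the logarithm vanishes and `1 - c₂ < 0`, so the empty event suffices.
  rcases lt_or_ge p 2 with hp | hp
  · refine ⟨∅, MeasurableSet.empty, ?_, fun ω hω => hω.elim⟩
    have : Real.log p = 0 := by
      interval_cases p <;> simp
    rw [this, mul_zero, Real.exp_zero, measureReal_empty]
    linarith
  have hp0 : (0 : ℝ) < p := by positivity
  have hl : 0 < Real.log p := Real.log_pos (by exact_mod_cast hp)
  have hs' : (1 : ℝ) ≤ s := by exact_mod_cast hs
  have hK' : (1 : ℝ) ≤ K := by exact_mod_cast hK
  have hls : Real.log p ≤ s * Real.log p := le_mul_of_one_le_left hl.le hs'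
  have hnT' : (0 : ℝ) < nT := by
    by_contra hcon
    have : (nT : ℝ) = 0 := le_antisymm (not_lt.1 hcon) (Nat.cast_nonneg _)
    rw [this, mul_zero] at hT
    linarith
  have hnT : 0 < nT := by exact_mod_cast hnT'
  have hnS : 0 < nS := hnT.trans_le hnTS
  have hnS' : (0 : ℝ) < nS := by exact_mod_cast hnS
  have hh : 0 ≤ hbar nT nS h := by
    unfold hbar totalSize
    have : 0 ≤ ∑ k, h k := Finset.sum_nonneg fun k _ => (l1norm_nonneg _).trans (hβ.2 k)
    positivity
  have hKs : K * (s * Real.log p) ≤ η * nS := by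
    have h1 : (K : ℝ) * s * Real.log p / nS ≤ η := by
      have := mul_nonneg hh (Real.sqrt_nonneg (Real.log p / nT))
      linarith
    rw [div_le_iff₀ hnS'] at h1
    linarith
  have hsS : s * Real.log p ≤ η * nS :=
    (le_mul_of_one_le_left (by positivity) hK').trans hKs
  have hKl : K * Real.log p ≤ η * nS := by
    refine le_trans ?_ hKs
    gcongr
  have hlS : Real.log p ≤ CT' * nS := by
    refine hls.trans (hsS.trans ?_)
    gcongr
    linarith
  have hlT : Real.log p ≤ CT' * nT := by
    refine hls.trans (hT.trans ?_)
    gcongr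
  have hsize : ∀ k : Fin (K + 1), 0 < sampleSize nT nS k ∧
      Real.log p ≤ CT' * sampleSize nT nS k := fun k =>
    Fin.cases ⟨hnT, hlT⟩ (fun k => ⟨hnS, hlS⟩) k
  have hθ : C₂ * √(s * Real.log p / nS) ≤ 1 / 100 := by
    have h1 : √(s * Real.log p / nS) ≤ 1 / (100 * C₂) := by
      refine Real.sqrt_le_iff.2 ⟨by positivity, le_trans ?_ hη3⟩
      rwa [div_le_iff₀ hnS']
    calc C₂ * √(s * Real.log p / nS) ≤ C₂ * (1 / (100 * C₂)) := by gcongr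
      _ = 1 / 100 := by field_simp
  have hwell : p < K → 4 * C₂ ^ 2 * (Real.log p * p) ≤ nS := fun hpK => by
    have hpK' : (p : ℝ) ≤ K := by exact_mod_cast hpK.le
    calc 4 * C₂ ^ 2 * (Real.log p * p) ≤ 4 * C₂ ^ 2 * (Real.log p * K) := by gcongr
      _ ≤ 4 * C₂ ^ 2 * ((1 / (100 * C₂)) ^ 2 * nS) := by
        refine mul_le_mul_of_nonneg_left ?_ (by positivity)
        rw [mul_comm]
        exact hKl.trans (mul_le_mul_of_nonneg_right hη3 hnS'.le)
      _ = 1 / 2500 * nS := by field_simp; norm_num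
      _ ≤ nS := by linarith
  have hfinal : ∀ (x : Designs p K nT nS) (e : Errors K nT nS),
      (∀ k, DesignRegular C₁ C₂ C₄ (Real.log p) (x k)) → NoiseRegular c₀ c₀ x e →
      ∀ βhat, IsTwoStepEstimate x (response β x e) (lambdaZero c₀ p s nT nS h)
        (weight p s nT nS h) (lambdaTilde c₀ p nT) βhat →
      ‖βhat - β 0‖ ^ 2 ≤ C * ((s : ℝ) * Real.log p / totalSize K nT nS +
        hbar nT nS h * √(Real.log p / nT)) := by
    intro x e hx he βhat hest
    obtain ⟨B, d, hB, hgood, hbad, htot, hdbar, htar⟩ := he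
    refine hbound p K nT nS s h β x e d B hK hs hp hnT hnTS hT (hη.trans hη1) hθ hβ (hx 0).1
      (fun k => (hx k.succ).1) (hx 0).2 hB (fun k hkB v => ?_) hgood hbad htot hdbar htar βhat hest
    -- A nonempty `B` forces `10 p ≤ K`, so the source designs are well conditioned whenever this is
    -- needed.
    have hKp : p < K := by
      have := Finset.card_pos.2 ⟨k, hkB⟩
      have h1 : p * 1 ≤ p * B.card := Nat.mul_le_mul_left p this
      omega
    exact DesignRegular.sqrt_mul_l1norm_le (n := nS) (hx k.succ) hl.le hC₂.le (hwell hKp) v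
  -- the designs
  obtain ⟨G, hG⟩ : ∃ G : Set (Designs p K nT nS),
      G = {x | ∀ k, DesignRegular C₁ C₂ C₄ (Real.log p) (x k)} := ⟨_, rfl⟩
  have hGm : MeasurableSet G := by
    rw [hG, Set.ofPred_forall]
    have hcl : IsClosed (⋂ k, {x : Designs p K nT nS |
        DesignRegular C₁ C₂ C₄ (Real.log p) (x k)}) := isClosed_iInter fun k =>
      (isClosed_designRegular C₁ C₂ C₄ (Real.log p)).preimage
        (f := fun x : Designs p K nT nS => x k) (continuous_apply k)
    exact hcl.measurableSet
  have hbad1 : μ.real {ω | ¬ (fun k i => X k i ω) ∈ G}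
      ≤ 2 * Real.exp (-(a / CT' * Real.log p)) + 2 * Real.exp (-Real.log p) := by
    rw [hG]
    refine measureReal_not_forall_designRegular_le hp hK ha hCT0 hlT ?_ fun k =>
      hdesign Ω μ _ p (X k) κ (hX.measurable k) (hX.indep k) (le_max_left _ _) (hX.subGaussian k)
        (fun i => le_integral_inner_sq (hX.mean_zero k i) (hX.covariance_eq k i)
          (fun t ht => (hX.spectrum_subset k ht).1) (hX.subGaussian k i))
        hp (hsize k).1 (hsize k).2
    have : K * Real.log p ≤ a / 2 * nS := hKl.trans (by gcongr)
    linarith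
  -- the noise
  have hbad2 : μ.real {ω | (fun k i => X k i ω) ∈ G ∧
      ((fun k i => X k i ω, fun k i => ε k i ω) : Designs p K nT nS × Errors K nT nS) ∈
        {q : Designs p K nT nS × Errors K nT nS | NoiseRegular c₀ c₀ q.1 q.2}ᶜ} ≤ Cn / p := by
    refine measureReal_le_of_indepFun
      (measurable_pi_lambda _ fun k => measurable_pi_lambda _ fun i => hX.measurable k i)
      (measurable_pi_lambda _ fun k => measurable_pi_lambda _ fun i => hε.measurable k i)
      hε.indep_design.symm hGm (measurableSet_noiseRegular c₀ c₀).compl (by positivity)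
      fun x hx => ?_
    rw [hG] at hx
    have hcol : ∀ k j, ∑ i, x k i j ^ 2 ≤ sampleSize nT nS k * U := fun k j => by
      rw [hU]
      exact sum_sq_le_of_predSq_le hC₄.le (hsize k).1 (hsize k).2 (hx k).2 j
    rw [hc₀]
    rcases le_or_gt K p with hKp | hKp
    · refine (measureReal_not_noiseRegular_le_of_le hU0.le hp hnT hε.measurable hε.gaussian
        hε.indep hcol hKp).trans ?_
      gcongr
    · rw [hCn]
      exact measureReal_not_noiseRegular_le_of_wellConditioned hU0.le hC₁ hp hnT hnS hK
        hε.measurable hε.gaussian hε.indep hcol fun k v =>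
          DesignRegular.mul_norm_sq_le (n := nS) (hx k.succ) hl.le hC₁ hC₂.le (hwell hKp) v
  obtain ⟨Bad, hBad⟩ : ∃ Bad : Set Ω, Bad = {ω | ¬ (fun k i => X k i ω) ∈ G} ∪
      {ω | (fun k i => X k i ω) ∈ G ∧
      ((fun k i => X k i ω, fun k i => ε k i ω) : Designs p K nT nS × Errors K nT nS) ∈
        {q : Designs p K nT nS × Errors K nT nS | NoiseRegular c₀ c₀ q.1 q.2}ᶜ} := ⟨_, rfl⟩
  -- The measurable hull of `Bad` has the same measure, so `Bad` itself need not be shown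
  -- measurable.
  refine ⟨(toMeasurable μ Bad)ᶜ, (measurableSet_toMeasurable _ _).compl, ?_, fun ω hω βhat hest => ?_⟩
  · rw [probReal_compl_eq_one_sub (measurableSet_toMeasurable _ _), measureReal_def,
      measure_toMeasurable, ← measureReal_def]
    have h1 : μ.real Bad ≤ 2 * Real.exp (-(a / CT' * Real.log p)) + 2 * Real.exp (-Real.log p)
        + Cn / p := by
      rw [hBad]
      exact (measureReal_union_le _ _).trans (add_le_add hbad1 hbad2)
    have h2 : Cn / p = Cn * Real.exp (-Real.log p) := by
      rw [Real.exp_neg, Real.exp_log hp0, div_eq_mul_inv]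
    have h3 : Real.exp (-(a / CT' * Real.log p))
        ≤ Real.exp (-min 1 (a / CT') * Real.log p) := by
      rw [neg_mul]
      gcongr
      exact min_le_right _ _
    have h4 : Real.exp (-Real.log p) ≤ Real.exp (-min 1 (a / CT') * Real.log p) := by
      rw [neg_mul]
      gcongr
      calc min 1 (a / CT') * Real.log p ≤ 1 * Real.log p := by gcongr; exact min_le_left _ _
        _ = _ := one_mul _
    have h5 := mul_le_mul_of_nonneg_left h4 (by linarith : 0 ≤ Cn)
    have h6 := Real.exp_pos (-min 1 (a / CT') * Real.log p)
    linarith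
  · have hω' : ω ∉ Bad := fun hmem => hω (subset_toMeasurable μ Bad hmem)
    rw [hBad, Set.mem_union, not_or] at hω'
    have hXG : (fun k i => X k i ω) ∈ G := not_not.1 hω'.1
    have hnoise : NoiseRegular c₀ c₀ (fun k i => X k i ω) (fun k i => ε k i ω) := by
      by_contra hcon
      exact hω'.2 ⟨hXG, hcon⟩
    rw [hG] at hXG
    exact hfinal _ _ hXG hnoise βhat hest
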